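/- **Setting.** For a metric space $\mathcal X$, say that $\mathcal X$ has doubling dimension at most $d$ ($d\ge 0$ real) if for every $R>0$, every $S\subseteq\mathcal X$ with all pairwise distances at most $R$ is the union of at most $2^d$ sets in each of which all pairwise distances are at most $R/2$. Let $r\ge 1$ be an integer. An $r$-gather clustering of a finite set $P\subseteq\mathcal X$ is a partition of $P$ into clusters $P_1,\dots,P_t$ with $|P_i|\ge r$, together with centers $c(P_i)\in\mathcal X$; its radius is $\max_i\max_{p\in P_i}\mathrm{dist}(p,c(P_i))$. Let $\rho^*(P)$ be the infimum of the radii of the $r$-gather clusterings of $P$. An $\alpha$-approximate solution is an $r$-gather clustering of radius at most $\alpha\,\rho^*(P)$. Time is measured on a random access machine whose natural-number registers serve as addresses and counters (successor, predecessor, comparison), whose real registers support addition, subtraction, halving and comparison, and which can store and move points of $\mathcal X$, every step costing $1$; in addition a computation of the distance of two points costs $\tau\ge 1$. The memory is blank at the beginning, except for the inputs $r$ and $\Delta$. **Theorem.** There are constants $A,\alpha\ge1$ and a fixed algorithm (one program per kind of operation, independent of $\mathcal X,d,r,\Delta,\tau$) such that the following holds for every metric space $\mathcal X$ of doubling dimension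 at most $d$, every integer $r\ge1$, every real $\Delta\ge4$ and every $\tau\ge1$. Consider any sequence of operations, each of which inserts a point of $\mathcal X$ into the current set $P$ (initially empty) or is a query, such that at any time the ratio between the largest and the smallest distance of different points of $P$ is at most $\Delta$. Then the algorithm implicitly maintains a clustering of $P$, determined by the sequence of insertions alone, which is an $\alpha$-approximate $r$-gather solution of $P$ whenever $|P|\ge r$, and (with $\log$ to base $2$): 1. every insertion takes time at most $r\cdot A\,2^{A d}\cdot\log^2\Delta\cdot\log\log\Delta\cdot\tau$; 2. the average time of the insertions is at most $A\,2^{A d}\cdot\log^2\Delta\cdot\log\log\Delta\cdot\tau$; 3. every query takes time at most $A\,2^{A d}\cdot\log^2\Delta\cdot\tau$; 4. if $|P|\ge r$, every query returns a number between $\rho$ and $\alpha\rho$, where $\rho$ is the radius of the maintained solution, and, if a point $p\in P$ is given in the query, it also returns the center of the cluster of the maintained solution that contains $p$. -/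

import Mathlib

open scoped NNReal

universe u

namespace RGather

section Metric

variable (X : Type u) [MetricSpace X]

/-- The doubling dimension of `X` is at most `d`: every set of diameter at most `R` is the union of
at most `2 ^ d` sets of diameter at most `R / 2`. -/
def DoublingDimLE (d : ℝ) : Prop :=
  ∀ R : ℝ, 0 < R → ∀ S : Set X, (∀ x ∈ S, ∀ y ∈ S, dist x y ≤ R) →
    ∃ (t : ℕ) (T : Fin t → Set X), (t : ℝ) ≤ (2 : ℝ) ^ d ∧ (⋃ i, T i) = S ∧
      ∀ i, ∀ x ∈ T i, ∀ y ∈ T i, dist x y ≤ R / 2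

variable {X}

/-- The ratio between the largest and the smallest distance of different points of `P` is at most
`Δ`. -/
def AspectRatioLE (P : Set X) (Δ : ℝ) : Prop :=
  ∀ x ∈ P, ∀ y ∈ P, ∀ u ∈ P, ∀ v ∈ P, u ≠ v → dist x y ≤ Δ * dist u v

/-- A partition of the point set `P` into finitely many finite clusters, each with a center in the
ambient space. -/
structure Clustering (P : Set X) where
  num : ℕ
  cluster : Fin num → Finset X
  center : Fin num → X
  disjoint : ∀ i j, i ≠ j → Disjoint (cluster i) (cluster j)
  cover : ∀ x, x ∈ P ↔ ∃ i, x ∈ cluster i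

namespace Clustering

variable {P : Set X}

/-- Every cluster contains at least `r` points. -/
def IsGather (C : Clustering P) (r : ℕ) : Prop :=
  ∀ i, r ≤ (C.cluster i).card

/-- The maximum radius of the clusters. -/
noncomputable def radius (C : Clustering P) : ℝ≥0 :=
  Finset.univ.sup fun i => (C.cluster i).sup fun p => nndist p (C.center i)

end Clustering

/-- The optimal `r`-gather cost of `P` (meaningful when `P` has at least `r` points, so that an
`r`-gather clustering exists). -/
noncomputable def optRadius (r : ℕ) (P : Set X) : ℝ≥0 :=
  sInf {ρ | ∃ C : Clustering P, C.IsGather r ∧ C.radius = ρ}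

/-- `C` is an `α`-approximate `r`-gather solution of `P`. -/
def Clustering.IsApprox {P : Set X} (C : Clustering P) (r : ℕ) (α : ℝ) : Prop :=
  C.IsGather r ∧ (C.radius : ℝ) ≤ α * (optRadius r P : ℝ)

end Metric

/-! The machine: a random access machine with separate registers and arrays for natural numbers
(addresses and counters, with successor and predecessor only, so that a number never exceeds the
input and the literals of the program by more than the number of steps), for real numbers (sum, difference, halving, comparison) and for
points of the metric space, which can be moved around and between which distances can be
computed. A program is a finite piece of text that does not depend on the metric space. -/

/-- Registers and arrays are named by natural numbers. The array names in an instruction are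
literals, the index is the content of a natural number register. -/
inductive Instr : Type
  | natConst (x c : ℕ)
  | natCopy (x y : ℕ)
  | natSucc (x y : ℕ)
  | natPred (x y : ℕ)
  | natLoad (x a i : ℕ)
  | natStore (a i x : ℕ)
  | realOfNat (x i : ℕ)
  | realCopy (x y : ℕ)
  | realAdd (x y z : ℕ)
  | realSub (x y z : ℕ)
  | realHalf (x y : ℕ)
  | realLoad (x a i : ℕ)
  | realStore (a i x : ℕ)
  | ptCopy (x y : ℕ)
  | ptLoad (x a i : ℕ)
  | ptStore (a i x : ℕ)
  | distance (x p q : ℕ)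

/-- Tests on registers. -/
inductive Cond : Type
  | natEq (x y : ℕ)
  | natLt (x y : ℕ)
  | realLt (x y : ℕ)
  | neg (b : Cond)

/-- Programs. -/
inductive Cmd : Type
  | instr (i : Instr)
  | seq (c₁ c₂ : Cmd)
  | ite (b : Cond) (c₁ c₂ : Cmd)
  | while (b : Cond) (c : Cmd)

/-- The content of the registers and of the arrays; `none` is a cell that holds no point. -/
@[ext]
structure State (X : Type u) where
  nat : ℕ → ℕ
  real : ℕ → ℝ
  pt : ℕ → Option X
  natArr : ℕ → ℕ → ℕ
  realArr : ℕ → ℕ → ℝ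
  ptArr : ℕ → ℕ → Option X

section Semantics

variable {X : Type u} [MetricSpace X]

open Function in
/-- The effect of one instruction. The only failure is a distance computation that involves a
register that holds no point. -/
noncomputable def Instr.step : Instr → State X → Option (State X)
  | natConst x c, s => some { s with nat := update s.nat x c }
  | natCopy x y, s => some { s with nat := update s.nat x (s.nat y) }
  | natSucc x y, s => some { s with nat := update s.nat x (s.nat y + 1) }
  | natPred x y, s => some { s with nat := update s.nat x (s.nat y - 1) }
  | natLoad x a i, s => some { s with nat := update s.nat x (s.natArr a (s.nat i)) }
  | natStore a i x, s =>
      some { s with natArr := update s.natArr a (update (s.natArr a) (s.nat i) (s.nat x)) }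
  | realOfNat x i, s => some { s with real := update s.real x (s.nat i : ℝ) }
  | realCopy x y, s => some { s with real := update s.real x (s.real y) }
  | realAdd x y z, s => some { s with real := update s.real x (s.real y + s.real z) }
  | realSub x y z, s => some { s with real := update s.real x (s.real y - s.real z) }
  | realHalf x y, s => some { s with real := update s.real x (s.real y / 2) }
  | realLoad x a i, s => some { s with real := update s.real x (s.realArr a (s.nat i)) }
  | realStore a i x, s =>
      some { s with realArr := update s.realArr a (update (s.realArr a) (s.nat i) (s.real x)) }
  | ptCopy x y, s => some { s with pt := update s.pt x (s.pt y) }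
  | ptLoad x a i, s => some { s with pt := update s.pt x (s.ptArr a (s.nat i)) }
  | ptStore a i x, s =>
      some { s with ptArr := update s.ptArr a (update (s.ptArr a) (s.nat i) (s.pt x)) }
  | distance x p q, s =>
      match s.pt p, s.pt q with
      | some v, some w => some { s with real := update s.real x (dist v w) }
      | _, _ => none

/-- The number of distance computations of one instruction. -/
def Instr.distCount : Instr → ℕ
  | distance _ _ _ => 1
  | _ => 0

/-- The test succeeds. -/
def Cond.Holds : Cond → State X → Prop
  | natEq x y, s => s.nat x = s.nat y
  | natLt x y, s => s.nat x < s.nat y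
  | realLt x y, s => s.real x < s.real y
  | neg b, s => ¬ b.Holds s

/-- `Exec c s s' k q`: the program `c`, started in `s`, halts in `s'` after `k` steps (executed
instructions and evaluated tests), `q` of which are distance computations. -/
inductive Exec : Cmd → State X → State X → ℕ → ℕ → Prop
  | instr {i : Instr} {s s' : State X} (h : i.step s = some s') :
      Exec (.instr i) s s' 1 i.distCount
  | seq {c₁ c₂ : Cmd} {s₁ s₂ s₃ : State X} {k₁ q₁ k₂ q₂ : ℕ}
      (h₁ : Exec c₁ s₁ s₂ k₁ q₁) (h₂ : Exec c₂ s₂ s₃ k₂ q₂) :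
      Exec (.seq c₁ c₂) s₁ s₃ (k₁ + k₂) (q₁ + q₂)
  | iteTrue {b : Cond} {c₁ c₂ : Cmd} {s s' : State X} {k q : ℕ}
      (hb : b.Holds s) (h : Exec c₁ s s' k q) : Exec (.ite b c₁ c₂) s s' (k + 1) q
  | iteFalse {b : Cond} {c₁ c₂ : Cmd} {s s' : State X} {k q : ℕ}
      (hb : ¬ b.Holds s) (h : Exec c₂ s s' k q) : Exec (.ite b c₁ c₂) s s' (k + 1) q
  | whileTrue {b : Cond} {c : Cmd} {s₁ s₂ s₃ : State X} {k₁ q₁ k₂ q₂ : ℕ}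
      (hb : b.Holds s₁) (h₁ : Exec c s₁ s₂ k₁ q₁) (h₂ : Exec (.while b c) s₂ s₃ k₂ q₂) :
      Exec (.while b c) s₁ s₃ (k₁ + k₂ + 1) (q₁ + q₂)
  | whileFalse {b : Cond} {c : Cmd} {s : State X} (hb : ¬ b.Holds s) :
      Exec (.while b c) s s 1 0

/-- The machine is deterministic. -/
theorem Exec.det {c : Cmd} {s s₁ s₂ : State X} {k₁ q₁ k₂ q₂ : ℕ}
    (h₁ : Exec c s s₁ k₁ q₁) (h₂ : Exec c s s₂ k₂ q₂) : s₁ = s₂ ∧ k₁ = k₂ ∧ q₁ = q₂ := by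
  induction h₁ generalizing s₂ k₂ q₂ with
  | instr h => cases h₂ with | instr h' => rw [h] at h'; cases h'; simp
  | seq _ _ ih₁ ih₂ =>
    cases h₂ with
    | seq g₁ g₂ =>
      obtain ⟨rfl, rfl, rfl⟩ := ih₁ g₁
      obtain ⟨rfl, rfl, rfl⟩ := ih₂ g₂
      simp
  | iteTrue hb _ ih =>
    cases h₂ with
    | iteTrue _ g => obtain ⟨rfl, rfl, rfl⟩ := ih g; simp
    | iteFalse hb' _ => exact absurd hb hb'
  | iteFalse hb _ ih =>
    cases h₂ with
    | iteTrue hb' _ => exact absurd hb' hb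
    | iteFalse _ g => obtain ⟨rfl, rfl, rfl⟩ := ih g; simp
  | whileTrue hb _ _ ih₁ ih₂ =>
    cases h₂ with
    | whileTrue _ g₁ g₂ =>
      obtain ⟨rfl, rfl, rfl⟩ := ih₁ g₁
      obtain ⟨rfl, rfl, rfl⟩ := ih₂ g₂
      simp
    | whileFalse hb' => exact absurd hb hb'
  | whileFalse hb =>
    cases h₂ with
    | whileTrue hb' _ _ => exact absurd hb' hb
    | whileFalse _ => simp

end Semantics

section Dynamic

/-- An operation on the dynamic data structure: insert a point, ask for the radius estimate, or ask
for the radius estimate and the center of a given point. -/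
inductive Op (X : Type u) : Type u
  | insert (p : X)
  | queryRadius
  | queryCenter (p : X)

/-- An incremental algorithm: one program for each kind of operation. -/
structure Algorithm where
  insert : Cmd
  queryRadius : Cmd
  queryCenter : Cmd

variable {X : Type u}

/-- The program that handles an operation. -/
def Algorithm.code (alg : Algorithm) : Op X → Cmd
  | .insert _ => alg.insert
  | .queryRadius => alg.queryRadius
  | .queryCenter _ => alg.queryCenter

/-- The point given by an operation is put into point register `0`. -/
def State.load (s : State X) : Op X → State X
  | .insert p => { s with pt := Function.update s.pt 0 (some p) }
  | .queryRadius => s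
  | .queryCenter p => { s with pt := Function.update s.pt 0 (some p) }

/-- The machine at the beginning: natural number register `0` holds `r`, real register `0` holds
`Δ`, and everything else is blank. -/
noncomputable def State.initial (r : ℕ) (Δ : ℝ) : State X where
  nat := Function.update (fun _ => 0) 0 r
  real := Function.update (fun _ => 0) 0 Δ
  pt := fun _ => none
  natArr := fun _ _ => 0
  realArr := fun _ _ => 0
  ptArr := fun _ _ => none

/-- The points inserted by a sequence of operations, in this order. -/
def history : List (Op X) → List X
  | [] => []
  | .insert p :: l => p :: history l
  | .queryRadius :: l => history l
  | .queryCenter _ :: l => history l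

/-- The set of the points of a list. -/
def pointSet (l : List X) : Set X := {x | x ∈ l}

/-- Number of insertions in a sequence of operations. -/
def insertCount (ops : List (Op X)) : ℕ := (history ops).length

/-- The operations are admissible for the aspect ratio bound `Δ`: the set of inserted points
(hence its subset at any earlier time) has aspect ratio at most `Δ`, and centers are asked for
only for points that have been inserted before. -/
def Admissible [MetricSpace X] (Δ : ℝ) (ops : List (Op X)) : Prop :=
  AspectRatioLE (pointSet (history ops)) Δ ∧
    ∀ (i : ℕ) (h : i < ops.length) (p : X), ops[i] = .queryCenter p →
      p ∈ pointSet (history (ops.take i))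

/-- The run of an algorithm on a sequence of operations: `state i` is the state before operation
number `i`, the memory being kept between operations. -/
structure Run [MetricSpace X] (alg : Algorithm) (r : ℕ) (Δ : ℝ) (ops : List (Op X)) where
  state : ℕ → State X
  steps : ℕ → ℕ
  dists : ℕ → ℕ
  start : state 0 = State.initial r Δ
  exec : ∀ (i : ℕ) (h : i < ops.length),
    Exec (alg.code ops[i]) ((state i).load ops[i]) (state (i + 1)) (steps i) (dists i)

namespace Run

variable [MetricSpace X] {alg : Algorithm} {r : ℕ} {Δ : ℝ} {ops : List (Op X)}

/-- The time of operation number `i` if a distance computation takes time `τ`. -/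
noncomputable def time (R : Run alg r Δ ops) (τ : ℝ) (i : ℕ) : ℝ :=
  (R.steps i : ℝ) + (R.dists i : ℝ) * τ

open Classical in
/-- The total time of all insertions. -/
noncomputable def totalInsertTime (R : Run alg r Δ ops) (τ : ℝ) : ℝ :=
  ∑ i : Fin ops.length, if ∃ p, ops[i] = .insert p then R.time τ i else 0

/-- The radius estimate reported by operation number `i`: real register `0`. -/
def radiusAnswer (R : Run alg r Δ ops) (i : ℕ) : ℝ := (R.state (i + 1)).real 0

/-- The center reported by operation number `i`: point register `0`. -/
def centerAnswer (R : Run alg r Δ ops) (i : ℕ) : Option X := (R.state (i + 1)).pt 0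

end Run

end Dynamic

end RGather

/-! Distances between different points vary by a factor of at most Δ. Once two different points are
known, the O(log Δ) scales s_k = S / 2 ^ k with 0 ≤ k ≤ K therefore cover all distances that can
occur. At every scale a greedy net is kept: a new point is assigned to the oldest net point within
s_k, and becomes a net point itself if there is none. For a net point x, `near` counts the points
assigned to net points within 2 s_k of x; it lies between the numbers of points within s_k and
within 3 s_k of x. A level is bad if `near` is less than r at one of its net points.

Let r ≥ 2 and |P| ≥ r, let i be the first bad level and σ = 16 s_i the scale of level i - 4. The net
points of level i - 4 are the centers. Level i - 1 is good, so every point has at least r points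
within 4 s_{i-1} = σ / 2. A point within σ / 2 of a center belongs to that center, since net points
are more than σ apart. Hence the clusters have at least r points, and their radius is at most σ.
Conversely, level i is bad, so some point has fewer than r points within s_i, and every r-gather
clustering has radius more than s_i / 2 = σ / 32. So σ is also a valid answer to radius queries
(`clusteringOf_solCenter`). A bad level exists because 3 s_K is less than the least distance, and i
≥ 4 because s_3 is at least the diameter. If r = 1, every point is its own center.

For the running time, the net points of all levels form a tree in which a child lies within s_k of
its parent at level k. The nodes within 4 s_k of p include the parents of all nodes within 4 s_{k+1}
of p, and packing bounds both the number of these nodes and the number of children by 2 ^ (3d)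
(`length_le_packing`). A descent (`wp_nextLevel`) that also updates the counts (`wp_update`) costs
O(2 ^ (6d)) per level. Points are never deleted, so nothing is ever rebuilt, and each single
operation takes O(2 ^ (6d) log Δ) steps. The factors r, log log Δ and the second log Δ of the
theorem are at least 1 and are only slack.

Programs are verified with `wp`, total correctness with a step bound; `Inv` ties the memory to the
nets, and determinism of the machine turns the specifications into a run (`exists_run`). -/

namespace RGather

noncomputable section
open scoped Classical

/-! ### Greedy nets and the counts of points near a net point. -/

section Nets

variable {X : Type u} [MetricSpace X]

/-- The oldest point of the list `N` (newest first) within distance `t` of `q`. -/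
def oldest (t : ℝ) (N : List X) (q : X) : Option X :=
  N.reverse.find? fun y => dist y q ≤ t

/-- The greedy net of one scale and the list of the net points to which the points are assigned. -/
def levelStep (s : ℝ) (p : X) (V : List X × List X) : List X × List X :=
  match oldest s V.1 p with
  | some y => (V.1, y :: V.2)
  | none => (p :: V.1, p :: V.2)

/-- The greedy net of scale `s` of a list of points (newest first). -/
def level (s : ℝ) (D : List X) : List X × List X :=
  D.foldr (levelStep s) ([], [])

/-- The estimate of the number of points near `x`. -/
def near (s : ℝ) (A : List X) (x : X) : ℕ :=
  A.countP fun y => dist y x ≤ 2 * s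

/-- The number of net points with less than `r` points nearby. -/
def badCount (r : ℕ) (s : ℝ) (V : List X × List X) : ℕ :=
  V.1.countP fun x => near s V.2 x < r

theorem oldest_eq_some {t : ℝ} {N : List X} {q y : X} (h : oldest t N q = some y) :
    y ∈ N ∧ dist y q ≤ t := by
  have h1 := List.mem_of_find?_eq_some h
  have h2 := List.find?_some h
  exact ⟨by simpa using h1, by simpa using h2⟩

theorem oldest_eq_none {t : ℝ} {N : List X} {q : X} :
    oldest t N q = none ↔ ∀ y ∈ N, t < dist y q := by
  simp [oldest]

theorem level_cons (s : ℝ) (p : X) (D : List X) :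
    level s (p :: D) = levelStep s p (level s D) := rfl

theorem level_subset (s : ℝ) (D : List X) : ∀ x ∈ (level s D).1, x ∈ D := by
  induction D with
  | nil => simp [level]
  | cons p D ih =>
    rw [level_cons, levelStep]
    cases h : oldest s (level s D).1 p with
    | some y => intro x hx; exact List.mem_cons_of_mem _ (ih x hx)
    | none =>
      intro x hx
      rcases List.mem_cons.1 hx with rfl | hx
      · simp
      · exact List.mem_cons_of_mem _ (ih x hx)

theorem level_separated (s : ℝ) (D : List X) :
    (level s D).1.Pairwise fun x y => s < dist x y := by
  induction D with
  | nil => simp [level]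
  | cons p D ih =>
    rw [level_cons, levelStep]
    cases h : oldest s (level s D).1 p with
    | some y => exact ih
    | none =>
      refine List.pairwise_cons.2 ⟨fun y hy => ?_, ih⟩
      rw [dist_comm]
      exact oldest_eq_none.1 h y hy

/-- Matching points and assignments position by position allows the number of points with a property
to be compared with the number of assignments with another one. -/
theorem level_forall₂ {s : ℝ} (hs : 0 ≤ s) (D : List X) :
    List.Forall₂ (fun q y => y ∈ (level s D).1 ∧ dist y q ≤ s) D (level s D).2 := by
  induction D with
  | nil => simp [level]
  | cons p D ih =>
    rw [level_cons, levelStep]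
    cases h : oldest s (level s D).1 p with
    | some y => exact List.Forall₂.cons (oldest_eq_some h) ih
    | none =>
      refine List.Forall₂.cons (by simpa using hs) (ih.imp fun q y hy => ?_)
      exact ⟨List.mem_cons_of_mem _ hy.1, hy.2⟩

theorem exists_of_forall₂ {α β : Type*} {R : α → β → Prop} {l : List α} {l' : List β}
    (h : List.Forall₂ R l l') {a : α} (ha : a ∈ l) : ∃ b ∈ l', R a b := by
  induction h with
  | nil => simp at ha
  | cons hR _ ih =>
    rcases List.mem_cons.1 ha with rfl | ha
    · exact ⟨_, by simp, hR⟩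
    · obtain ⟨b, hb, hb'⟩ := ih ha
      exact ⟨b, by simp [hb], hb'⟩

theorem exists_of_forall₂' {α β : Type*} {R : α → β → Prop} {l : List α} {l' : List β}
    (h : List.Forall₂ R l l') {b : β} (hb : b ∈ l') : ∃ a ∈ l, R a b :=
  exists_of_forall₂ (R := fun b a => R a b) (List.Forall₂.flip h) hb

theorem countP_le_of_forall₂ {α β : Type*} {R : α → β → Prop} {l : List α} {l' : List β}
    (h : List.Forall₂ R l l') {P : α → Prop} {P' : β → Prop}
    (hP : ∀ a b, a ∈ l → R a b → P a → P' b) :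
    l.countP (fun a => P a) ≤ l'.countP (fun b => P' b) := by
  induction h with
  | nil => simp
  | @cons a b l l' hR _ ih =>
    have ih := ih fun a b ha => hP a b (List.mem_cons_of_mem _ ha)
    have := hP a b (by simp) hR
    simp only [List.countP_cons, decide_eq_true_eq]
    split_ifs <;> first | omega | tauto

theorem mem_level_of_mem_snd {s : ℝ} (hs : 0 ≤ s) {D : List X} {y : X}
    (hy : y ∈ (level s D).2) : y ∈ (level s D).1 := by
  obtain ⟨q, -, h⟩ := exists_of_forall₂' (level_forall₂ hs D) hy
  exact h.1

theorem exists_level_near {s : ℝ} (hs : 0 ≤ s) {D : List X} {q : X} (hq : q ∈ D) :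
    ∃ y ∈ (level s D).1, dist y q ≤ s := by
  obtain ⟨y, -, h⟩ := exists_of_forall₂ (level_forall₂ hs D) hq
  exact ⟨y, h⟩

/-- The number of points of a list in a closed ball. -/
def ballCount (D : List X) (x : X) (t : ℝ) : ℕ := D.countP fun q => dist q x ≤ t

theorem ballCount_mono {D : List X} {x y : X} {t t' : ℝ} (h : dist x y + t ≤ t') :
    ballCount D x t ≤ ballCount D y t' := by
  refine List.countP_mono_left fun q _ hq => ?_
  simp only [decide_eq_true_eq] at hq ⊢
  linarith [dist_triangle q x y]

/-- A counted point is within `s` of its net point, which is within `2 * s` of `x`. -/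
theorem near_le_ballCount {s : ℝ} (hs : 0 ≤ s) (D : List X) (x : X) :
    near s (level s D).2 x ≤ ballCount D x (3 * s) := by
  refine countP_le_of_forall₂ (List.Forall₂.flip (level_forall₂ hs D)) ?_
  intro y q _ h hy
  have := dist_triangle q y x
  rw [dist_comm q y] at this
  linarith [h.2]

/-- The net point of a point within `s` of `x` is within `s + s` of `x`, so the point is counted. -/
theorem ballCount_le_near {s : ℝ} (hs : 0 ≤ s) (D : List X) (x : X) :
    ballCount D x s ≤ near s (level s D).2 x := by
  refine countP_le_of_forall₂ (level_forall₂ hs D) ?_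
  intro q y _ h hq
  linarith [h.2, dist_triangle y q x]

/-- Some net point `y` is within `s` of `x`, and at least `r` points lie within `3 * s` of `y`. -/
theorem le_ballCount_of_badCount_eq_zero {r : ℕ} {s : ℝ} (hs : 0 ≤ s) {D : List X}
    (h : badCount r s (level s D) = 0) {x : X} (hx : x ∈ D) : r ≤ ballCount D x (4 * s) := by
  obtain ⟨y, hy, hyx⟩ := exists_level_near hs hx
  have h1 := List.countP_eq_zero.1 h y hy
  simp only [decide_eq_true_eq, not_lt] at h1
  exact h1.trans ((near_le_ballCount hs D y).trans (ballCount_mono (by linarith)))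

theorem exists_ballCount_lt_of_badCount_ne_zero {r : ℕ} {s : ℝ} (hs : 0 ≤ s) {D : List X}
    (h : badCount r s (level s D) ≠ 0) : ∃ x ∈ D, ballCount D x s < r := by
  obtain ⟨x, hx, hr⟩ := List.countP_pos_iff.1 (Nat.pos_of_ne_zero h)
  simp only [decide_eq_true_eq] at hr
  exact ⟨x, level_subset s D x hx, (ballCount_le_near hs D x).trans_lt hr⟩

/-- At such a scale `near` counts all points. This makes the topmost levels good. -/
theorem badCount_eq_zero_of_diam_le {r : ℕ} {s : ℝ} (hs : 0 ≤ s) {D : List X}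
    (hD : ∀ x ∈ D, ∀ y ∈ D, dist x y ≤ s) (hr : r ≤ D.length) :
    badCount r s (level s D) = 0 := by
  refine List.countP_eq_zero.2 fun x hx => ?_
  have hx := level_subset s D x hx
  have h1 := ballCount_le_near hs D x
  have h2 : ballCount D x s = D.length :=
    List.countP_eq_length.2 fun q hq => by simpa using hD q hq x hx
  simp only [decide_eq_true_eq, not_lt]
  omega

theorem ballCount_le_one {D : List X} (hD : D.Nodup) {x : X} {t : ℝ}
    (h : ∀ q ∈ D, dist q x ≤ t → q = x) : ballCount D x t ≤ 1 := by
  refine le_trans (List.countP_mono_left (q := fun q => q == x) fun q hq h' => ?_)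
    (List.nodup_iff_count_le_one.1 hD x)
  simpa using h q hq (by simpa using h')

/-- At such a scale `near` counts only the net point itself, and `1 < r`. This makes the finest
level bad. -/
theorem badCount_ne_zero_of_small {r : ℕ} (hr : 2 ≤ r) {s : ℝ} (hs : 0 ≤ s) {D : List X}
    (hD : D.Nodup) (hne : D ≠ []) (h : ∀ x ∈ D, ∀ y ∈ D, dist x y ≤ 3 * s → x = y) :
    badCount r s (level s D) ≠ 0 := by
  obtain ⟨q, hq⟩ := List.exists_mem_of_ne_nil D hne
  obtain ⟨y, hy, -⟩ := exists_level_near hs hq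
  refine (List.countP_pos_iff.2 ⟨y, hy, ?_⟩).ne'
  have hyD := level_subset s D y hy
  have h1 := near_le_ballCount hs D y
  have h2 := ballCount_le_one hD (x := y) (t := 3 * s) fun q hq => h q hq y hyD
  simp only [decide_eq_true_eq]
  omega

theorem ballCount_eq_card {D : List X} (hD : D.Nodup) (x : X) (t : ℝ) :
    ballCount D x t = (D.toFinset.filter fun q => dist q x ≤ t).card := by
  rw [ballCount, List.countP_eq_length_filter, ← List.toFinset_card_of_nodup (hD.filter _)]
  congr 1
  ext q
  simp

/-- The center of the cluster of `q`, for the net `N` of scale `s`. -/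
def centerAt (s : ℝ) (N : List X) (q : X) : X :=
  (oldest (s / 2) N q).getD ((oldest s N q).getD q)

/-- The net covers `q`, so the default value in `centerAt` is not reached. -/
theorem dist_centerAt {s : ℝ} (hs : 0 ≤ s) {D : List X} {q : X} (hq : q ∈ D) :
    centerAt s (level s D).1 q ∈ (level s D).1 ∧
      dist (centerAt s (level s D).1 q) q ≤ s := by
  obtain ⟨y, hy, hyq⟩ := exists_level_near hs hq
  rw [centerAt]
  cases h1 : oldest (s / 2) (level s D).1 q with
  | some z => exact ⟨(oldest_eq_some h1).1, (oldest_eq_some h1).2.trans (by linarith)⟩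
  | none =>
    cases h2 : oldest s (level s D).1 q with
    | some z => exact oldest_eq_some h2
    | none => exact absurd hyq (not_le.2 (oldest_eq_none.1 h2 y hy))

theorem level_eq_of_dist_le {s : ℝ} {D : List X} {x y : X} (hx : x ∈ (level s D).1)
    (hy : y ∈ (level s D).1) (h : dist x y ≤ s) : x = y := by
  by_contra hne
  have hsep := level_separated s D
  -- With the premise `x ≠ y` the relation also holds on the diagonal, so the pairwise statement
  -- extends to all pairs.
  have : Std.Symm fun x y : X => x ≠ y → s < dist x y :=
    ⟨fun x y h h' => by rw [dist_comm]; exact h h'.symm⟩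
  have h2 : ∀ x ∈ (level s D).1, ∀ y ∈ (level s D).1, x ≠ y → s < dist x y :=
    fun x hx y hy => List.Pairwise.forall_of_forall (R := fun x y : X => x ≠ y → s < dist x y)
      (by simp) (hsep.imp fun {a b : X} (h : s < dist a b) (_ : a ≠ b) => h) hx hy
  exact absurd h (not_le.2 (h2 x hx y hy hne))

/-- Two net points within `s / 2` of `q` would be within `s` of each other. Because `centerAt`
prefers the radius `s / 2`, the cluster of a net point contains the whole ball of that radius. -/
theorem centerAt_eq {s : ℝ} {D : List X} {q y : X}
    (hy : y ∈ (level s D).1) (h : dist q y ≤ s / 2) : centerAt s (level s D).1 q = y := by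
  rw [dist_comm] at h
  rw [centerAt]
  cases h1 : oldest (s / 2) (level s D).1 q with
  | some z =>
    obtain ⟨hz, hzq⟩ := oldest_eq_some h1
    refine level_eq_of_dist_le hz hy ?_
    rw [dist_comm] at h
    rw [Option.getD_some]
    linarith [dist_triangle z q y]
  | none => exact absurd h (not_le.2 (oldest_eq_none.1 h1 y hy))

end Nets

/-! ### Clusterings given by a center map, and the lower bound for the radius. -/

section ClusteringOfMap

variable {X : Type u} [MetricSpace X]

/-- The clustering in which `f q` is the center of the cluster of `q`. -/
def clusteringOf (l : List X) (f : X → X) : Clustering (pointSet l) where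
  num := (l.toFinset.image f).card
  cluster i := l.toFinset.filter fun q => f q = (l.toFinset.image f).equivFin.symm i
  center i := (l.toFinset.image f).equivFin.symm i
  disjoint i j hij := by
    refine Finset.disjoint_filter.2 fun q _ h1 h2 => hij ?_
    exact (l.toFinset.image f).equivFin.symm.injective (Subtype.ext (h1.symm.trans h2))
  cover x := by
    simp only [pointSet, Set.mem_ofPred_eq, Finset.mem_filter, List.mem_toFinset]
    refine ⟨fun hx => ⟨(l.toFinset.image f).equivFin ⟨f x, ?_⟩, hx, ?_⟩, fun ⟨_, h, _⟩ => h⟩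
    · exact Finset.mem_image_of_mem f (by simpa using hx)
    · simp

omit [MetricSpace X] in
theorem clusteringOf_center (l : List X) (f : X → X) {q : X} (hq : q ∈ l) :
    ∃ j, q ∈ (clusteringOf l f).cluster j ∧ (clusteringOf l f).center j = f q := by
  obtain ⟨j, hj⟩ := ((clusteringOf l f).cover q).1 hq
  exact ⟨j, hj, (Finset.mem_filter.1 hj).2.symm⟩

omit [MetricSpace X] in
theorem clusteringOf_isGather {l : List X} {f : X → X} {r : ℕ}
    (h : ∀ q ∈ l, r ≤ (l.toFinset.filter fun q' => f q' = f q).card) :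
    (clusteringOf l f).IsGather r := by
  intro i
  obtain ⟨q, hq, hqi⟩ := Finset.mem_image.1 ((l.toFinset.image f).equivFin.symm i).2
  have := h q (by simpa using hq)
  rw [hqi] at this
  exact this

theorem clusteringOf_radius_le {l : List X} {f : X → X} {s : ℝ≥0}
    (h : ∀ q ∈ l, dist q (f q) ≤ s) : (clusteringOf l f).radius ≤ s := by
  refine Finset.sup_le fun i _ => Finset.sup_le fun q hq => ?_
  obtain ⟨hq, hqi⟩ := Finset.mem_filter.1 hq
  have := h q (by simpa using hq)
  rw [hqi] at this
  exact_mod_cast this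

theorem Clustering.nndist_le_radius {P : Set X} (C : Clustering P) {i : Fin C.num} {p : X}
    (hp : p ∈ C.cluster i) : nndist p (C.center i) ≤ C.radius :=
  (Finset.le_sup (f := fun p => nndist p (C.center i)) hp).trans
    (Finset.le_sup (f := fun i => (C.cluster i).sup fun p => nndist p (C.center i))
      (Finset.mem_univ i))

/-- Two points of one cluster are at most two radii apart. If `t` were at least that, the ball
around `x` would contain its whole cluster and hence `r` points. -/
theorem Clustering.IsGather.lt_two_mul_radius {D : List X} (hD : D.Nodup) {P : Set X}
    (hP : ∀ x, x ∈ P ↔ x ∈ D) {C : Clustering P} {r : ℕ} (hC : C.IsGather r) {x : X}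
    (hx : x ∈ D) {t : ℝ} (h : ballCount D x t < r) : t < 2 * C.radius := by
  by_contra! hle
  obtain ⟨i, hi⟩ := (C.cover x).1 ((hP x).2 hx)
  refine absurd h (not_lt.2 ((hC i).trans ?_))
  rw [ballCount_eq_card hD]
  refine Finset.card_le_card fun q hq => ?_
  have h1 : dist q (C.center i) ≤ C.radius := by exact_mod_cast C.nndist_le_radius hq
  have h2 : dist x (C.center i) ≤ C.radius := by exact_mod_cast C.nndist_le_radius hi
  simp only [Finset.mem_filter, List.mem_toFinset]
  refine ⟨(hP q).1 ((C.cover q).2 ⟨i, hq⟩), ?_⟩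
  linarith [dist_triangle_right q x (C.center i)]

end ClusteringOfMap

/-! ### Packing in doubling spaces. -/

section Packing

variable {X : Type u} [MetricSpace X]

/-- Each halving of the diameter costs a factor `2 ^ d`; after `m` halvings the separation leaves at
most one point in each piece. -/
theorem DoublingDimLE.card_le {d : ℝ} (hX : DoublingDimLE X d) (m : ℕ) {R : ℝ} (hR : 0 < R)
    (F : Finset X) (hF : ∀ x ∈ F, ∀ y ∈ F, dist x y ≤ 2 ^ m * R)
    (hsep : ∀ x ∈ F, ∀ y ∈ F, dist x y ≤ R → x = y) : (F.card : ℝ) ≤ ((2 : ℝ) ^ d) ^ m := by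
  induction m generalizing F with
  | zero =>
    simp only [pow_zero]
    exact_mod_cast Finset.card_le_one.2 fun x hx y hy => hsep x hx y hy (by simpa using hF x hx y hy)
  | succ m ih =>
    obtain ⟨t, T, ht, hT, hTd⟩ := hX (2 ^ (m + 1) * R) (by positivity) (F : Set X) hF
    have h1 : F = Finset.univ.biUnion fun i => F.filter (· ∈ T i) := by
      ext x
      simp only [Finset.mem_biUnion, Finset.mem_univ, true_and, Finset.mem_filter]
      refine ⟨fun hx => ?_, fun ⟨_, h, _⟩ => h⟩
      have : x ∈ ⋃ i, T i := hT ▸ hx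
      obtain ⟨i, hi⟩ := Set.mem_iUnion.1 this
      exact ⟨i, hx, hi⟩
    have h2 : ∀ i, ((F.filter (· ∈ T i)).card : ℝ) ≤ ((2 : ℝ) ^ d) ^ m := fun i => by
      refine ih _ (fun x hx y hy => ?_) fun x hx y hy =>
        hsep x (Finset.mem_filter.1 hx).1 y (Finset.mem_filter.1 hy).1
      refine (hTd i x (Finset.mem_filter.1 hx).2 y (Finset.mem_filter.1 hy).2).trans (le_of_eq ?_)
      ring
    calc (F.card : ℝ) ≤ ((∑ i, (F.filter (· ∈ T i)).card : ℕ) : ℝ) := by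
          conv_lhs => rw [h1]
          exact_mod_cast Finset.card_biUnion_le
      _ ≤ ∑ _i : Fin t, ((2 : ℝ) ^ d) ^ m := by
          push_cast
          exact Finset.sum_le_sum fun i _ => h2 i
      _ = t * ((2 : ℝ) ^ d) ^ m := by simp
      _ ≤ (2 : ℝ) ^ d * ((2 : ℝ) ^ d) ^ m := by gcongr
      _ = _ := by ring

theorem DoublingDimLE.length_le {d : ℝ} (hX : DoublingDimLE X d) (m : ℕ) {R : ℝ} (hR : 0 < R)
    {L : List X} (hL : L.Nodup) (hF : ∀ x ∈ L, ∀ y ∈ L, dist x y ≤ 2 ^ m * R)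
    (hsep : ∀ x ∈ L, ∀ y ∈ L, dist x y ≤ R → x = y) :
    L.length ≤ ⌊((2 : ℝ) ^ d) ^ m⌋₊ := by
  refine Nat.le_floor ?_
  rw [← List.toFinset_card_of_nodup hL]
  exact hX.card_le m hR _ (by simpa using hF) (by simpa using hsep)

end Packing

/-! ### The scales, the maintained clustering and its approximation ratio. -/

section Solution

variable {X : Type u} [MetricSpace X]

theorem exists_le_two_pow (Δ : ℝ) : ∃ m : ℕ, Δ ≤ 2 ^ m :=
  (pow_unbounded_of_one_lt Δ one_lt_two).imp fun _ h => h.le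

/-- The least `m` with `Δ ≤ 2 ^ m`. -/
def doublings (Δ : ℝ) : ℕ := Nat.find (exists_le_two_pow Δ)

theorem le_two_pow_doublings (Δ : ℝ) : Δ ≤ 2 ^ doublings Δ := Nat.find_spec (exists_le_two_pow Δ)

theorem two_pow_lt_of_lt_doublings {Δ : ℝ} {i : ℕ} (h : i < doublings Δ) : 2 ^ i < Δ :=
  not_le.1 (Nat.find_min (exists_le_two_pow Δ) h)

/-- The distance of the first two points of a list (newest first). -/
def baseDist (D : List X) : ℝ :=
  match D.reverse with
  | p₀ :: p₁ :: _ => dist p₁ p₀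
  | _ => 0

/-- The largest scale. -/
def topScale (Δ : ℝ) (D : List X) : ℝ := 8 * (2 ^ doublings Δ * baseDist D)

/-- The number of the finest level. -/
def depth (Δ : ℝ) : ℕ := 2 * doublings Δ + 5

theorem baseDist_pair (p₁ p₀ : X) : baseDist [p₁, p₀] = dist p₁ p₀ := rfl

theorem baseDist_cons (p : X) {D : List X} (h : 2 ≤ D.length) :
    baseDist (p :: D) = baseDist D := by
  have h' : 2 ≤ D.reverse.length := by simpa using h
  simp only [baseDist, List.reverse_cons]
  match D.reverse, h' with
  | _ :: _ :: _, _ => rfl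

theorem exists_baseDist {D : List X} (hD : D.Nodup) (h : 2 ≤ D.length) :
    ∃ x ∈ D, ∃ y ∈ D, x ≠ y ∧ baseDist D = dist x y := by
  have h' : 2 ≤ D.reverse.length := by simpa using h
  have hn : D.reverse.Nodup := by simpa using hD
  have hm : ∀ x, x ∈ D ↔ x ∈ D.reverse := by simp
  simp only [baseDist, hm]
  match D.reverse, h', hn with
  | p₀ :: p₁ :: l, _, hn => exact ⟨p₁, by simp, p₀, by simp, by aesop, rfl⟩

/-- Let δ be the base distance and m = `doublings Δ`. All distances of different points lie between
δ / 2 ^ m and 2 ^ m δ. The scale S = 8 · 2 ^ m δ is 8 times the upper bound, and 3 S / 2 ^ (2m + 5)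
is 3/4 of the lower one. -/
theorem topScale_bounds {Δ : ℝ} {D : List X} (hD : D.Nodup) (h : 2 ≤ D.length)
    (hP : AspectRatioLE (pointSet D) Δ) :
    0 < topScale Δ D ∧ (∀ x ∈ D, ∀ y ∈ D, dist x y ≤ topScale Δ D / 2 ^ 3) ∧
      ∀ x ∈ D, ∀ y ∈ D, dist x y ≤ 3 * (topScale Δ D / 2 ^ depth Δ) → x = y := by
  obtain ⟨u, hu, v, hv, huv, hb⟩ := exists_baseDist hD h
  have hpos : 0 < dist u v := dist_pos.2 huv
  have hm := le_two_pow_doublings Δ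
  have hm0 : (0 : ℝ) < 2 ^ doublings Δ := by positivity
  rw [topScale, hb]
  refine ⟨by positivity, fun x hx y hy => ?_, fun x hx y hy hxy => ?_⟩
  · have h1 := hP x hx y hy u hu v hv huv
    have h2 : Δ * dist u v ≤ 2 ^ doublings Δ * dist u v := by gcongr
    linarith
  · by_contra hne
    have h1 := hP u hu v hv x hx y hy hne
    have h0 : 0 < dist x y := dist_pos.2 hne
    have h2 : Δ * dist x y ≤ 2 ^ doublings Δ * dist x y := by gcongr
    have h3 : 3 * (8 * (2 ^ doublings Δ * dist u v) / 2 ^ depth Δ) =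
        3 / 4 * (dist u v / 2 ^ doublings Δ) := by
      rw [depth, pow_add, pow_mul']
      field_simp
      norm_num
    have h4 : dist u v / 2 ^ doublings Δ ≤ dist x y := by
      rw [div_le_iff₀ hm0]
      linarith
    rw [h3] at hxy
    linarith

/-- The first level, from the top, that has a net point with few points nearby. -/
def firstBad (r : ℕ) (S : ℝ) (D : List X) : ℕ :=
  sInf {k | 1 ≤ k ∧ badCount r (S / 2 ^ k) (level (S / 2 ^ k) D) ≠ 0}

/-- The scale of the net of the centers. -/
def solScale (r : ℕ) (S : ℝ) (D : List X) : ℝ := S / 2 ^ (firstBad r S D - 4)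

/-- The center of the cluster of a point. -/
def solCenter (r : ℕ) (S : ℝ) (D : List X) (q : X) : X :=
  if r = 1 then q else centerAt (solScale r S D) (level (solScale r S D) D).1 q

theorem firstBad_spec {r K : ℕ} (hr : 2 ≤ r) {S : ℝ} (hS : 0 < S) (hK : 1 ≤ K) {D : List X}
    (hD : D.Nodup) (hne : D ≠ []) (h : ∀ x ∈ D, ∀ y ∈ D, dist x y ≤ 3 * (S / 2 ^ K) → x = y) :
    1 ≤ firstBad r S D ∧ firstBad r S D ≤ K ∧
      badCount r (S / 2 ^ firstBad r S D) (level (S / 2 ^ firstBad r S D) D) ≠ 0 ∧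
      ∀ k, 1 ≤ k → k < firstBad r S D → badCount r (S / 2 ^ k) (level (S / 2 ^ k) D) = 0 := by
  have h1 : K ∈ {k | 1 ≤ k ∧ badCount r (S / 2 ^ k) (level (S / 2 ^ k) D) ≠ 0} :=
    ⟨hK, badCount_ne_zero_of_small hr (by positivity) hD hne h⟩
  have h2 := Nat.sInf_mem ⟨K, h1⟩
  refine ⟨h2.1, Nat.sInf_le h1, h2.2, fun k hk hk' => ?_⟩
  by_contra hc
  exact Nat.notMem_of_lt_sInf hk' ⟨hk, hc⟩

/-- The heart of the approximation: the good level before the first bad one gives the cluster sizes,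
the bad level gives the lower bound, and the net four levels above the bad one gives the centers. -/
theorem clusteringOf_solCenter {r : ℕ} (hr : 2 ≤ r) {K : ℕ} {S : ℝ} (hS : 0 < S) (hK : 1 ≤ K)
    {l D : List X} (hl : ∀ x, x ∈ l ↔ x ∈ D) (hD : D.Nodup) (hlen : r ≤ D.length)
    (hdiam : ∀ x ∈ D, ∀ y ∈ D, dist x y ≤ S / 2 ^ 3)
    (hmin : ∀ x ∈ D, ∀ y ∈ D, dist x y ≤ 3 * (S / 2 ^ K) → x = y) :
    (clusteringOf l (solCenter r S D)).IsGather r ∧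
      ((clusteringOf l (solCenter r S D)).radius : ℝ) ≤ solScale r S D ∧
      ∀ C : Clustering (pointSet l), C.IsGather r → solScale r S D ≤ 32 * C.radius := by
  have hne : D ≠ [] := by
    rintro rfl
    simp at hlen
    omega
  obtain ⟨h1, -, hbad, hgood⟩ := firstBad_spec hr hS hK hD hne hmin
  -- The scales of the levels up to 3 are at least the diameter, so these levels are good.
  have hi : 4 ≤ firstBad r S D := by
    by_contra! hlt
    refine hbad (badCount_eq_zero_of_diam_le (by positivity) (fun x hx y hy => ?_) hlen)
    refine (hdiam x hx y hy).trans ?_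
    gcongr
    · norm_num
    · omega
  have hs : 0 < solScale r S D := by unfold solScale; positivity
  have e1 : 4 * (S / 2 ^ (firstBad r S D - 1)) = solScale r S D / 2 := by
    obtain ⟨j, hj⟩ := Nat.exists_eq_add_of_le hi
    rw [solScale, hj, show 4 + j - 1 = j + 3 by omega, show 4 + j - 4 = j by omega, pow_add]
    field_simp
    norm_num
  have e2 : 16 * (S / 2 ^ firstBad r S D) = solScale r S D := by
    obtain ⟨j, hj⟩ := Nat.exists_eq_add_of_le hi
    rw [solScale, hj, show 4 + j - 4 = j by omega, pow_add]
    field_simp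
    norm_num
  have hf : ∀ q, solCenter r S D q = centerAt (solScale r S D) (level (solScale r S D) D).1 q :=
    fun q => if_neg (by omega)
  refine ⟨clusteringOf_isGather fun q hq => ?_, ?_, fun C hC => ?_⟩
  · obtain ⟨hy, -⟩ := dist_centerAt hs.le ((hl q).1 hq)
    rw [← hf] at hy
    -- The center has `r` points within half the solution scale, and all of them are in its cluster.
    have hg := le_ballCount_of_badCount_eq_zero (by positivity)
      (hgood _ (by omega) (by omega : firstBad r S D - 1 < _)) (level_subset _ _ _ hy)
    refine hg.trans ?_
    rw [e1, ballCount_eq_card hD]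
    refine Finset.card_le_card fun x hx => ?_
    simp only [Finset.mem_filter, List.mem_toFinset] at hx ⊢
    refine ⟨(hl x).2 hx.1, ?_⟩
    rw [hf x]
    exact centerAt_eq hy hx.2
  · have : (clusteringOf l (solCenter r S D)).radius ≤ (⟨solScale r S D, hs.le⟩ : ℝ≥0) := by
      refine clusteringOf_radius_le fun q hq => ?_
      rw [hf, dist_comm]
      exact (dist_centerAt hs.le ((hl q).1 hq)).2
    exact_mod_cast this
  · obtain ⟨x, hx, hxr⟩ := exists_ballCount_lt_of_badCount_ne_zero (by positivity) hbad
    have := hC.lt_two_mul_radius (P := pointSet l) hD hl hx hxr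
    linarith

/-- The bound by every clustering passes to the infimum, which is over a nonempty set because of
`C`. -/
theorem Clustering.isApprox_of_forall_le {P : Set X} {C : Clustering P} {r : ℕ} {α t : ℝ}
    (hα : 0 < α) (hC : C.IsGather r) (h1 : (C.radius : ℝ) ≤ t)
    (h : ∀ C' : Clustering P, C'.IsGather r → t ≤ α * C'.radius) : C.IsApprox r α := by
  refine ⟨hC, h1.trans ?_⟩
  have : Real.toNNReal (t / α) ≤ optRadius r P := by
    refine le_csInf ⟨_, C, hC, rfl⟩ ?_
    rintro _ ⟨C', hC', rfl⟩
    exact Real.toNNReal_le_iff_le_coe.2 ((div_le_iff₀' hα).2 (h C' hC'))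
  exact (div_le_iff₀' hα).1 (Real.toNNReal_le_iff_le_coe.1 this)

/-- The points of a sequence of insertions, without repetitions and newest first. -/
def distinctPts (l : List X) : List X := l.reverse.dedup

omit [MetricSpace X] in
theorem mem_distinctPts {l : List X} {x : X} : x ∈ distinctPts l ↔ x ∈ l := by
  simp [distinctPts]

omit [MetricSpace X] in
theorem nodup_distinctPts (l : List X) : (distinctPts l).Nodup := List.nodup_dedup _

-- `List.dedup` keeps last occurrences, which are the first insertions after the reversal; a
-- repeated insertion therefore changes nothing.
omit [MetricSpace X] in
theorem distinctPts_append_of_mem {l : List X} {p : X} (h : p ∈ l) :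
    distinctPts (l ++ [p]) = distinctPts l := by
  simp [distinctPts, List.dedup_cons_of_mem, h]

omit [MetricSpace X] in
theorem distinctPts_append_of_notMem {l : List X} {p : X} (h : p ∉ l) :
    distinctPts (l ++ [p]) = p :: distinctPts l := by
  simp [distinctPts, List.dedup_cons_of_notMem, h]

omit [MetricSpace X] in
theorem pointSet_distinctPts (l : List X) : pointSet (distinctPts l) = pointSet l := by
  ext x
  exact mem_distinctPts

omit [MetricSpace X] in
theorem ncard_pointSet (l : List X) : (pointSet l).ncard = (distinctPts l).length := by
  rw [← pointSet_distinctPts, ← List.toFinset_card_of_nodup (nodup_distinctPts l),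
    ← Set.ncard_coe_finset]
  congr 1
  ext x
  simp [pointSet]

/-- The maintained solution. -/
def solution (r : ℕ) (Δ : ℝ) (l : List X) : Clustering (pointSet l) :=
  clusteringOf l (solCenter r (topScale Δ (distinctPts l)) (distinctPts l))

theorem solution_spec {r : ℕ} (hr : 2 ≤ r) {Δ : ℝ} {l : List X}
    (hP : AspectRatioLE (pointSet l) Δ) (hl : r ≤ (pointSet l).ncard) :
    (solution r Δ l).IsGather r ∧
      ((solution r Δ l).radius : ℝ) ≤
        solScale r (topScale Δ (distinctPts l)) (distinctPts l) ∧
      ∀ C : Clustering (pointSet l), C.IsGather r →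
        solScale r (topScale Δ (distinctPts l)) (distinctPts l) ≤ 32 * C.radius := by
  rw [ncard_pointSet] at hl
  rw [← pointSet_distinctPts] at hP
  obtain ⟨h1, h2, h3⟩ := topScale_bounds (nodup_distinctPts l) (by omega) hP
  exact clusteringOf_solCenter hr h1 (K := depth Δ) (by unfold depth; omega)
    (fun x => mem_distinctPts.symm) (nodup_distinctPts l) hl h2 h3

/-- For `r = 1` no level is bad, so this case does not fit the general construction. -/
theorem solution_one_spec (Δ : ℝ) (l : List X) :
    (solution 1 Δ l).IsGather 1 ∧ (solution 1 Δ l).radius = 0 := by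
  refine ⟨clusteringOf_isGather fun q hq => ?_, ?_⟩
  · exact Finset.card_pos.2 ⟨q, by simpa using hq⟩
  · refine le_antisymm (clusteringOf_radius_le fun q _ => ?_) zero_le
    simp [solCenter]

theorem solution_isApprox {r : ℕ} (hr : 1 ≤ r) {Δ : ℝ} {l : List X}
    (hP : AspectRatioLE (pointSet l) Δ) (hl : r ≤ (pointSet l).ncard) :
    (solution r Δ l).IsApprox r 32 := by
  rcases hr.eq_or_lt with rfl | hr
  · obtain ⟨h1, h2⟩ := solution_one_spec Δ l
    exact ⟨h1, by rw [h2]; positivity⟩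
  · obtain ⟨h1, h2, h3⟩ := solution_spec hr hP hl
    exact Clustering.isApprox_of_forall_le (by norm_num) h1 h2 h3

end Solution

/-! ### Program logic with step counts; lists in memory. -/

section Logic

variable {X : Type u} [MetricSpace X]

theorem Exec.dists_le {c : Cmd} {s s' : State X} {k q : ℕ} (h : Exec c s s' k q) : q ≤ k := by
  induction h with
  | @instr i _ _ _ => cases i <;> simp [Instr.distCount]
  | _ => omega

/-- Started in `s`, the program halts, and the final state and the number of steps satisfy `Q`. -/
def wp (c : Cmd) (Q : State X → ℕ → Prop) (s : State X) : Prop :=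
  ∃ s' k q, Exec c s s' k q ∧ Q s' k

variable {Q Q' : State X → ℕ → Prop} {s : State X}

theorem wp.mono {c : Cmd} (h : wp c Q s) (hQ : ∀ s' k, Q s' k → Q' s' k) : wp c Q' s := by
  obtain ⟨s', k, q, he, hq⟩ := h
  exact ⟨s', k, q, he, hQ s' k hq⟩

theorem wp_instr {i : Instr} : wp (.instr i) Q s ↔ ∃ s', i.step s = some s' ∧ Q s' 1 := by
  constructor
  · rintro ⟨s', k, q, he, hq⟩
    cases he with | instr h => exact ⟨s', h, hq⟩
  · rintro ⟨s', h, hq⟩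
    exact ⟨s', _, _, .instr h, hq⟩

theorem wp_seq {c₁ c₂ : Cmd} :
    wp (.seq c₁ c₂) Q s ↔ wp c₁ (fun s' k => wp c₂ (fun s'' k' => Q s'' (k + k')) s') s := by
  constructor
  · rintro ⟨s', k, q, he, hq⟩
    cases he with | seq h₁ h₂ => exact ⟨_, _, _, h₁, _, _, _, h₂, hq⟩
  · rintro ⟨_, _, _, h₁, _, _, _, h₂, hq⟩
    exact ⟨_, _, _, .seq h₁ h₂, hq⟩

theorem wp_ite {b : Cond} {c₁ c₂ : Cmd} (h₁ : b.Holds s → wp c₁ (fun s' k => Q s' (k + 1)) s)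
    (h₂ : ¬ b.Holds s → wp c₂ (fun s' k => Q s' (k + 1)) s) : wp (.ite b c₁ c₂) Q s := by
  by_cases hb : b.Holds s
  · obtain ⟨s', k, q, he, hq⟩ := h₁ hb
    exact ⟨_, _, _, .iteTrue hb he, hq⟩
  · obtain ⟨s', k, q, he, hq⟩ := h₂ hb
    exact ⟨_, _, _, .iteFalse hb he, hq⟩

/-- The list of items still to be processed, which is not part of the state, serves as loop variant
and bounds the number of rounds. -/
theorem wp_while_list {α : Type*} {b : Cond} {c : Cmd} (I : List α → State X → Prop) (B : ℕ)
    (hstep : ∀ a l s, I (a :: l) s → b.Holds s ∧ wp c (fun s' k => I l s' ∧ k ≤ B) s)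
    (hend : ∀ s, I [] s → ¬ b.Holds s) {l : List α} {s : State X} (h : I l s) :
    wp (.while b c) (fun s' k => I [] s' ∧ k ≤ l.length * (B + 1) + 1) s := by
  induction l generalizing s with
  | nil => exact ⟨s, 1, 0, .whileFalse (hend s h), h, by simp⟩
  | cons a l ih =>
    obtain ⟨hb, s', k, q, he, hI, hk⟩ := hstep a l s h
    obtain ⟨s'', k', q', he', hI', hk'⟩ := ih hI
    refine ⟨s'', _, _, .whileTrue hb he he', hI', ?_⟩
    rw [List.length_cons, Nat.succ_mul]
    omega

theorem wp_while {b : Cond} {c : Cmd} (I : ℕ → State X → Prop) (B : ℕ)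
    (hstep : ∀ n s, I (n + 1) s → b.Holds s ∧ wp c (fun s' k => I n s' ∧ k ≤ B) s)
    (hend : ∀ s, I 0 s → ¬ b.Holds s) {n : ℕ} {s : State X} (h : I n s) :
    wp (.while b c) (fun s' k => I 0 s' ∧ k ≤ n * (B + 1) + 1) s := by
  have := wp_while_list (fun (l : List Unit) => I l.length) B (b := b) (c := c)
    (fun a l s h => hstep _ s h) hend (l := List.replicate n ()) (s := s) (by simpa using h)
  simpa using this

/-- No effect. -/
def Cmd.skip : Cmd := .instr (.natCopy 20 20)

/-- A sequence of instructions. -/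
def Cmd.run : List Instr → Cmd
  | [] => .skip
  | i :: l => l.foldl (fun c j => .seq c (.instr j)) (.instr i)

theorem wp_skip (h : Q s 1) : wp .skip Q s := by
  refine wp_instr.2 ⟨s, ?_, h⟩
  simp [Instr.step]

/-- The state `s'` differs from `s` at most in the listed registers, in point register `20` and in
the queue. -/
structure Frame (mn mr : List ℕ) (s s' : State X) : Prop where
  nat : ∀ x ∉ mn, s'.nat x = s.nat x
  real : ∀ x ∉ mr, s'.real x = s.real x
  pt : ∀ x, x ≠ 20 → s'.pt x = s.pt x
  natArr : ∀ a, a ≠ 10 → s'.natArr a = s.natArr a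
  realArr : s'.realArr = s.realArr
  ptArr : s'.ptArr = s.ptArr

omit [MetricSpace X] in
theorem Frame.refl (mn mr : List ℕ) (s : State X) : Frame mn mr s s :=
  ⟨fun _ _ => rfl, fun _ _ => rfl, fun _ _ => rfl, fun _ _ => rfl, rfl, rfl⟩

omit [MetricSpace X] in
theorem Frame.trans {mn mr mn' mr' : List ℕ} {s s' s'' : State X} (h : Frame mn mr s s')
    (h' : Frame mn' mr' s' s'') (hn : mn' ⊆ mn := by decide) (hr : mr' ⊆ mr := by decide) :
    Frame mn mr s s'' where
  nat x hx := (h'.nat x fun h => hx (hn h)).trans (h.nat x hx)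
  real x hx := (h'.real x fun h => hx (hr h)).trans (h.real x hx)
  pt x hx := (h'.pt x hx).trans (h.pt x hx)
  natArr a ha := (h'.natArr a ha).trans (h.natArr a ha)
  realArr := h'.realArr.trans h.realArr
  ptArr := h'.ptArr.trans h.ptArr

omit [MetricSpace X] in
theorem Frame.mono {mn mr mn' mr' : List ℕ} {s s' : State X}
    (h' : Frame mn' mr' s s') (hn : mn' ⊆ mn := by decide) (hr : mr' ⊆ mr := by decide) :
    Frame mn mr s s' := (Frame.refl mn mr s).trans h' hn hr

/-- The list stands in the array from the given index on. -/
def Seg (f : ℕ → ℕ) (a : ℕ) (l : List ℕ) : Prop := ∀ i (h : i < l.length), f (a + i) = l[i]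

theorem Seg.nil (f : ℕ → ℕ) (a : ℕ) : Seg f a [] := by simp [Seg]

theorem Seg.congr {f g : ℕ → ℕ} {a : ℕ} {l : List ℕ} (h : Seg f a l)
    (hfg : ∀ i, a ≤ i → i < a + l.length → g i = f i) : Seg g a l := fun i hi => by
  rw [hfg _ (by omega) (by omega), h i hi]

theorem Seg.snoc {f : ℕ → ℕ} {a : ℕ} {l : List ℕ} (h : Seg f a l) (n : ℕ) :
    Seg (Function.update f (a + l.length) n) a (l ++ [n]) := by
  intro i hi
  simp only [List.length_append, List.length_cons, List.length_nil] at hi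
  rcases Nat.lt_or_ge i l.length with h' | h'
  · rw [Function.update_of_ne (by omega), h i h', List.getElem_append_left h']
  · obtain rfl : i = l.length := by omega
    simp

/-- The list is the content of a linked list with the given head. -/
def Linked (nxt : ℕ → ℕ) : ℕ → List ℕ → Prop
  | h, [] => h = 0
  | h, a :: l => h = a ∧ a ≠ 0 ∧ Linked nxt (nxt a) l

theorem Linked.congr {f g : ℕ → ℕ} {h : ℕ} {l : List ℕ} (hl : Linked f h l)
    (hfg : ∀ n ∈ l, g n = f n) : Linked g h l := by
  induction l generalizing h with
  | nil => exact hl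
  | cons a l ih =>
    refine ⟨hl.1, hl.2.1, ?_⟩
    rw [hfg a (by simp)]
    exact ih hl.2.2 fun n hn => hfg n (by simp [hn])

end Logic

/-! ### Programs for the search in the tree of net points. -/

section SearchPrograms

/-- Go through a linked list of nodes and append those near the point to the queue. -/
def childLoop : Cmd :=
  .while (.neg (.natEq 21 9)) <|
    .seq (.run [.ptLoad 20 0 21, .distance 21 20 0]) <|
    .seq (.ite (.realLt 20 21) .skip (.run [.natStore 10 16 21, .natSucc 16 16])) <|
    .run [.natLoad 21 1 21]

/-- From the nodes near the point at one level find those at the next level. -/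
def descend : Cmd :=
  -- Registers `15` and `16` delimit the queue. Register `17` keeps the end of the old level, and
  -- real register `20` becomes four times the current scale.
  .seq (.run [.natCopy 17 16, .realAdd 20 10 10, .realAdd 20 20 20]) <|
  .while (.natLt 15 17) <|
    .seq (.run [.natLoad 20 10 15, .natLoad 21 0 20]) <|
    .seq childLoop <|
    .run [.natSucc 15 15]

/-- Execute a program for all nodes in the queue. -/
def forQueue (c : Cmd) : Cmd :=
  .seq (.run [.natCopy 20 15]) <|
  .while (.natLt 20 16) <|
    .seq (.run [.natLoad 21 10 20]) <|
    .seq c <|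
    .run [.natSucc 20 20]

/-- Find the oldest node in the queue within a given distance. -/
def scan : Cmd :=
  -- Nodes are numbered from 1, so `0` stands for "no node".
  .seq (.run [.natConst 22 0]) <|
  forQueue <|
    .seq (.run [.ptLoad 20 0 21, .distance 21 20 0]) <|
    .ite (.realLt 20 21) .skip <|
    .ite (.natEq 22 9) (.run [.natCopy 22 21]) <|
    .ite (.natLt 21 22) (.run [.natCopy 22 21]) .skip

end SearchPrograms

/-! ### Correctness and cost of the search programs. -/

section SearchSpecs

variable {X : Type u} [MetricSpace X]

theorem wp_childLoop {s : State X} {loc : ℕ → X} {p : X} {cl out : List ℕ} {b : ℕ}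
    (h9 : s.nat 9 = 0) (hp : s.pt 0 = some p) (hcl : Linked (s.natArr 1) (s.nat 21) cl)
    (hloc : ∀ n ∈ cl, s.ptArr 0 n = some (loc n)) (hout : Seg (s.natArr 10) b out)
    (h16 : s.nat 16 = b + out.length) :
    wp childLoop (fun s' k =>
      (Seg (s'.natArr 10) b (out ++ cl.filter fun n => dist (loc n) p ≤ s.real 20) ∧
        s'.nat 16 = b + (out ++ cl.filter fun n => dist (loc n) p ≤ s.real 20).length ∧
        (∀ i < b, s'.natArr 10 i = s.natArr 10 i) ∧ Frame [16, 21] [21] s s') ∧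
      k ≤ cl.length * 8 + 1) s := by
  set P : ℕ → Bool := fun n => dist (loc n) p ≤ s.real 20 with hP
  -- The collected nodes `o` followed by the matches still to come are the same list in every round.
  refine (wp_while_list (fun rest t => ∃ o, o ++ rest.filter P = out ++ cl.filter P ∧
    (∀ n ∈ rest, n ∈ cl) ∧ Linked (t.natArr 1) (t.nat 21) rest ∧ Seg (t.natArr 10) b o ∧
    t.nat 16 = b + o.length ∧ (∀ i < b, t.natArr 10 i = s.natArr 10 i) ∧
    Frame [16, 21] [21] s t) 7 ?_ ?_ (l := cl)
    ⟨out, rfl, fun _ h => h, hcl, hout, h16, fun _ _ => rfl, .refl _ _ _⟩).mono ?_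
  · rintro a l t ⟨o, ho, hsub, ⟨h21, ha, hl⟩, hseg, ht, hlow, hF⟩
    have e1 : t.ptArr 0 a = some (loc a) := by rw [hF.ptArr]; exact hloc a (hsub a (by simp))
    have e2 : t.pt 0 = some p := by rw [hF.pt 0 (by decide)]; exact hp
    have e9 : t.nat 9 = 0 := by rw [hF.nat 9 (by decide)]; exact h9
    have e20 : t.real 20 = s.real 20 := hF.real 20 (by decide)
    refine ⟨by simp [Cond.Holds, h21, e9, ha], ?_⟩
    simp only [Cmd.run, List.foldl, wp_seq, wp_instr, Instr.step, h21, e1,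
      Option.some.injEq, exists_eq_left', Function.update_self, e2,
      Function.update_of_ne (show (0 : ℕ) ≠ 20 by decide)]
    refine wp_ite (fun hb => wp_skip ?_) fun hb => ?_
    · simp only [Cond.Holds, Function.update_self, e20,
        Function.update_of_ne (show (20 : ℕ) ≠ 21 by decide)] at hb
      refine ⟨⟨o, ?_, fun n hn => hsub n (by simp [hn]), ?_, hseg, ?_, hlow, ?_⟩, by norm_num⟩
      · rw [← ho, List.filter_cons_of_neg (by simpa [hP] using hb)]
      · simpa [h21] using hl
      · simpa using ht
      · refine hF.trans (mn' := [21]) (mr' := [21]) ⟨?_, ?_, ?_, ?_, rfl, rfl⟩ <;>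
          intro x hx <;> simp_all
    · simp only [Cond.Holds, Function.update_self, e20,
        Function.update_of_ne (show (20 : ℕ) ≠ 21 by decide), not_lt] at hb
      simp only [wp_seq, wp_instr, Instr.step, Option.some.injEq, exists_eq_left']
      refine ⟨⟨o ++ [a], ?_, fun n hn => hsub n (by simp [hn]), ?_, ?_, ?_, ?_, ?_⟩, by norm_num⟩
      · rw [← ho, List.filter_cons_of_pos (by simpa [hP] using hb)]
        simp
      · simpa [Function.update_apply, h21] using hl
      · simpa [Function.update_apply, h21, ht] using hseg.snoc a
      · simp [ht]; omega
      · intro i hi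
        rw [← hlow i hi]
        simp only [Function.update_self]
        rw [Function.update_of_ne (by omega)]
      · refine hF.trans (mn' := [16, 21]) (mr' := [21]) ⟨?_, ?_, ?_, ?_, rfl, rfl⟩ <;>
          intro x hx <;> simp_all
  · rintro t ⟨o, -, -, hl, -, -, -, hF⟩
    have e9 : t.nat 9 = 0 := by rw [hF.nat 9 (by decide)]; exact h9
    simpa [Cond.Holds, e9, Linked] using hl
  · rintro t k ⟨⟨o, ho, -, -, hseg, ht, hlow, hF⟩, hk⟩
    simp only [List.filter_nil, List.append_nil] at ho
    subst ho
    exact ⟨⟨hseg, ht, hlow, hF⟩, hk⟩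

/-- The old level is consumed from the front while the next one is appended behind it; the inner
loop writes only beyond the old end of the queue and so leaves the unread part intact. -/
theorem wp_descend {s : State X} {loc : ℕ → X} {p : X} {ql : List ℕ} {ch : ℕ → List ℕ} {M : ℕ}
    (h9 : s.nat 9 = 0) (hp : s.pt 0 = some p) (hql : Seg (s.natArr 10) (s.nat 15) ql)
    (h16 : s.nat 16 = s.nat 15 + ql.length)
    (hch : ∀ n ∈ ql, Linked (s.natArr 1) (s.natArr 0 n) (ch n) ∧ (ch n).length ≤ M ∧
      ∀ c ∈ ch n, s.ptArr 0 c = some (loc c)) :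
    wp descend (fun s' k =>
      (Seg (s'.natArr 10) (s'.nat 15)
          ((ql.flatMap ch).filter fun n => dist (loc n) p ≤ 4 * s.real 10) ∧
        s'.nat 16 = s'.nat 15 +
          ((ql.flatMap ch).filter fun n => dist (loc n) p ≤ 4 * s.real 10).length ∧
        Frame [15, 16, 17, 20, 21] [20, 21] s s') ∧
      k ≤ ql.length * (M * 8 + 5) + 4) s := by
  set P : ℕ → Bool := fun n => dist (loc n) p ≤ 4 * s.real 10 with hP
  rw [descend, wp_seq]
  simp only [Cmd.run, List.foldl, wp_seq, wp_instr, Instr.step, Option.some.injEq,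
    exists_eq_left', Function.update_self]
  refine (wp_while_list (fun rest t => ∃ o, o ++ (rest.flatMap ch).filter P =
    (ql.flatMap ch).filter P ∧ (∀ n ∈ rest, n ∈ ql) ∧ Seg (t.natArr 10) (t.nat 15) rest ∧
    t.nat 15 + rest.length = s.nat 16 ∧ Seg (t.natArr 10) (s.nat 16) o ∧
    t.nat 16 = s.nat 16 + o.length ∧ t.nat 17 = s.nat 16 ∧ t.real 20 = 4 * s.real 10 ∧
    Frame [15, 16, 17, 20, 21] [20, 21] s t) (M * 8 + 4) ?_ ?_ (l := ql)
    ⟨[], rfl, fun _ h => h, ?_, ?_, Seg.nil _ _, ?_, ?_, ?_, ?_⟩).mono ?_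
  · rintro a l t ⟨o, ho, hsub, hseg, hlen, hsego, ht, h17, hr, hF⟩
    have ha := hseg 0 (by simp)
    have hl : Seg (t.natArr 10) (t.nat 15 + 1) l := fun i hi => by
      have := hseg (i + 1) (by simpa using hi)
      rwa [List.getElem_cons_succ, ← Nat.add_assoc, Nat.add_right_comm] at this
    simp only [List.getElem_cons_zero, Nat.add_zero] at ha
    rw [List.length_cons] at hlen
    obtain ⟨hc1, hc2, hc3⟩ := hch a (hsub a (by simp))
    refine ⟨by simp only [Cond.Holds]; omega, ?_⟩
    simp only [wp_seq, wp_instr, Instr.step, Option.some.injEq, exists_eq_left',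
      Function.update_self, ha]
    refine (wp_childLoop (loc := loc) (p := p) (cl := ch a) (out := o) (b := s.nat 16)
      ?_ ?_ ?_ ?_ ?_ ?_).mono ?_
    · simpa using (hF.nat 9 (by decide)).trans h9
    · simpa using (hF.pt 0 (by decide)).trans hp
    · simpa [hF.natArr] using hc1
    · simpa [hF.ptArr] using hc3
    · exact hsego
    · simpa using ht
    · rintro u k ⟨⟨g1, g2, g3, gF⟩, hk⟩
      simp only [hr] at g1 g2
      have e15 : u.nat 15 = t.nat 15 := by rw [gF.nat 15 (by decide)]; simp
      refine ⟨⟨_, ?_, fun n hn => hsub n (by simp [hn]), ?_, ?_, g1, ?_, ?_, ?_, ?_⟩, ?_⟩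
      · rw [← ho, List.flatMap_cons, List.filter_append, List.append_assoc]
      · simp only [e15]
        exact hl.congr fun i _ hi => g3 i (by omega)
      · simp only [e15]
        omega
      · simpa using g2
      · simpa [h17] using gF.nat 17 (by decide)
      · simpa [hr] using gF.real 20 (by decide)
      · have h1 : Frame [15, 16, 17, 20, 21] [20, 21] t u := by
          refine Frame.trans (s' := _) ?_ gF
          refine ⟨?_, ?_, ?_, ?_, rfl, rfl⟩ <;> intro x hx <;> simp_all
        refine hF.trans (h1.trans (mn' := [15]) (mr' := []) ?_)
        refine ⟨?_, ?_, ?_, ?_, rfl, rfl⟩ <;> intro x hx <;> simp_all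
      · have := Nat.mul_le_mul_right 8 hc2
        omega
  · rintro t ⟨o, -, -, -, hlen, -, -, h17, -⟩
    simp only [List.length_nil] at hlen
    simp only [Cond.Holds]
    omega
  · simpa using hql
  · simpa using h16.symm
  · simp
  · simp
  · simp; ring
  · refine ⟨?_, ?_, ?_, ?_, rfl, rfl⟩ <;> intro x hx <;> simp_all
  · rintro t k ⟨⟨o, ho, -, -, hlen, hseg, ht, -, -, hF⟩, hk⟩
    simp only [List.flatMap_nil, List.filter_nil, List.append_nil] at ho
    simp only [List.length_nil, Nat.add_zero] at hlen
    subst ho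
    rw [hlen]
    change k ≤ ql.length * (M * 8 + 5) + 1 at hk
    exact ⟨⟨hseg, ht, hF⟩, by omega⟩

/-- The loop itself writes registers `20` and `21`, hence the stability condition `hinv`. -/
theorem wp_forQueue {c : Cmd} {ql : List ℕ} {s : State X} (I : List ℕ → State X → Prop) (B : ℕ)
    (hI : ∀ done t, I done t → Seg (t.natArr 10) (t.nat 15) ql ∧
      t.nat 16 = t.nat 15 + ql.length)
    (hinv : ∀ done t x n, x = 20 ∨ x = 21 → I done t →
      I done { t with nat := Function.update t.nat x n })
    (hstep : ∀ done n rest t, done ++ n :: rest = ql → I done t → t.nat 21 = n →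
      wp c (fun t' k => (I (done ++ [n]) t' ∧ t'.nat 20 = t.nat 20 ∧ t'.nat 15 = t.nat 15) ∧
        k ≤ B) t)
    (h : I [] s) :
    wp (forQueue c) (fun s' k => I ql s' ∧ k ≤ ql.length * (B + 3) + 2) s := by
  rw [forQueue, wp_seq]
  simp only [Cmd.run, List.foldl, wp_instr, Instr.step, Option.some.injEq,
    exists_eq_left']
  refine (wp_while_list (fun rest t => ∃ done, done ++ rest = ql ∧ I done t ∧
    t.nat 20 = t.nat 15 + done.length) (B + 2) ?_ ?_ (l := ql) ⟨[], rfl, ?_, ?_⟩).mono ?_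
  · rintro n rest t ⟨done, hd, hIt, h20⟩
    obtain ⟨hs, h16⟩ := hI _ _ hIt
    have hlen : ql.length = done.length + (rest.length + 1) := by rw [← hd]; simp
    refine ⟨by simp only [Cond.Holds]; omega, ?_⟩
    have hn : t.natArr 10 (t.nat 20) = n := by
      rw [h20, hs done.length (by omega)]
      simp [← hd]
    simp only [wp_seq, wp_instr, Instr.step, Option.some.injEq, exists_eq_left', hn]
    refine (hstep done n rest _ hd (hinv done t 21 n (Or.inr rfl) hIt) (by simp)).mono ?_
    rintro u k ⟨⟨hu, hu20, hu15⟩, hk⟩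
    refine ⟨⟨done ++ [n], by simpa using hd, hinv _ _ 20 _ (Or.inl rfl) hu, ?_⟩, by omega⟩
    simp only [Function.update_self, hu20, Function.update_of_ne (show 15 ≠ 20 by decide), hu15]
    simp [h20]
    omega
  · rintro t ⟨done, hd, hIt, h20⟩
    obtain ⟨hs, h16⟩ := hI _ _ hIt
    simp only [List.append_nil] at hd
    subst hd
    simp only [Cond.Holds]
    omega
  · exact hinv _ _ 20 _ (Or.inl rfl) h
  · simp
  · rintro t k ⟨⟨done, hd, hIt, -⟩, hk⟩
    simp only [List.append_nil] at hd
    subst hd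
    change k ≤ done.length * (B + 3) + 1 at hk
    exact ⟨hIt, by omega⟩

/-- `b` is the least element of the list with the property, or `0` if there is none. -/
def IsLeastIn (P : ℕ → Prop) (l : List ℕ) (b : ℕ) : Prop :=
  (b = 0 ∧ ∀ n ∈ l, ¬ P n) ∨ (b ∈ l ∧ P b ∧ ∀ n ∈ l, P n → b ≤ n)

theorem wp_scan {s : State X} {loc : ℕ → X} {p : X} {ql : List ℕ}
    (h9 : s.nat 9 = 0) (hp : s.pt 0 = some p) (hql : Seg (s.natArr 10) (s.nat 15) ql)
    (h16 : s.nat 16 = s.nat 15 + ql.length)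
    (hloc : ∀ n ∈ ql, n ≠ 0 ∧ s.ptArr 0 n = some (loc n)) :
    wp scan (fun s' k =>
      (IsLeastIn (fun n => dist (loc n) p ≤ s.real 20) ql (s'.nat 22) ∧
        s'.natArr 10 = s.natArr 10 ∧ Frame [20, 21, 22] [21] s s') ∧
      k ≤ ql.length * 9 + 3) s := by
  set P : ℕ → Prop := fun n => dist (loc n) p ≤ s.real 20 with hP
  rw [scan, wp_seq]
  simp only [Cmd.run, List.foldl, wp_instr, Instr.step, Option.some.injEq,
    exists_eq_left']
  refine (wp_forQueue (ql := ql) (fun done t => (∀ n ∈ done, n ∈ ql) ∧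
    IsLeastIn P done (t.nat 22) ∧
    t.natArr 10 = s.natArr 10 ∧ Frame [20, 21, 22] [21] s t) 6 ?_ ?_ ?_ ?_).mono ?_
  · rintro done t ⟨-, -, h10, hF⟩
    rw [h10, hF.nat 15 (by decide), hF.nat 16 (by decide)]
    exact ⟨hql, h16⟩
  · rintro done t x n hx ⟨h0, h1, h2, h3⟩
    refine ⟨h0, ?_, h2, h3.trans (mn' := [20, 21]) (mr' := []) ⟨?_, ?_, ?_, ?_, rfl, rfl⟩⟩
    · rcases hx with rfl | rfl <;> simpa using h1
    · intro y hy
      simp only [List.mem_cons, not_or] at hy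
      rcases hx with rfl | rfl <;> simp [hy]
    all_goals intro y _; rfl
  · rintro done n rest t hd ⟨hsub, h1, h2, hF⟩ h21
    have hnq : n ∈ ql := by rw [← hd]; simp
    obtain ⟨hn0, hn⟩ := hloc n hnq
    have hsub' : ∀ m ∈ done ++ [n], m ∈ ql := fun m hm => by
      rcases List.mem_append.1 hm with hm | hm
      · exact hsub m hm
      · rw [List.mem_singleton.1 hm]
        exact hnq
    have e1 : t.ptArr 0 n = some (loc n) := by rw [hF.ptArr]; exact hn
    have e2 : t.pt 0 = some p := by rw [hF.pt 0 (by decide)]; exact hp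
    have e9 : t.nat 9 = 0 := by rw [hF.nat 9 (by decide)]; exact h9
    have e20 : t.real 20 = s.real 20 := hF.real 20 (by decide)
    have hskip : ∀ b : ℕ, IsLeastIn P (done ++ [n]) b → b = t.nat 22 →
        IsLeastIn P (done ++ [n]) (t.nat 22) := fun b hb h => h ▸ hb
    simp only [wp_seq, wp_instr, Instr.step, h21, e1,
      Option.some.injEq, exists_eq_left', Function.update_self, e2,
      Function.update_of_ne (show (0 : ℕ) ≠ 20 by decide)]
    refine wp_ite (fun hb => wp_skip ?_) fun hb => ?_
    · simp only [Cond.Holds, Function.update_self, e20,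
        Function.update_of_ne (show (20 : ℕ) ≠ 21 by decide)] at hb
      refine ⟨⟨⟨hsub', ?_, h2, ?_⟩, rfl, rfl⟩, by norm_num⟩
      · have hnP : ¬ P n := not_le.2 hb
        rcases h1 with ⟨hz, h1⟩ | ⟨h1, h3, h4⟩
        · exact Or.inl ⟨hz, by simpa [or_imp, forall_and] using ⟨h1, hnP⟩⟩
        · refine Or.inr ⟨by simp [h1], h3, fun m hm hPm => ?_⟩
          rcases List.mem_append.1 hm with hm | hm
          · exact h4 m hm hPm
          · rw [List.mem_singleton.1 hm] at hPm
            exact absurd hPm hnP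
      · refine hF.trans (mn' := [21]) (mr' := [21]) ⟨?_, ?_, ?_, ?_, rfl, rfl⟩ <;>
          intro x hx <;> simp_all
    · simp only [Cond.Holds, Function.update_self, e20,
        Function.update_of_ne (show (20 : ℕ) ≠ 21 by decide), not_lt] at hb
      have hF' : Frame [20, 21, 22] [21] s { t with
            nat := Function.update t.nat 22 (t.nat 21)
            real := Function.update t.real 21 (dist (loc n) p)
            pt := Function.update t.pt 20 (some (loc n)) } := by
        refine hF.trans (mn' := [22]) (mr' := [21]) ⟨?_, ?_, ?_, ?_, rfl, rfl⟩ <;>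
          intro x hx <;> simp_all
      refine wp_ite (fun hb1 => ?_) fun hb1 => ?_
      · simp only [Cond.Holds, e9] at hb1
        simp only [wp_instr, Instr.step, Option.some.injEq, exists_eq_left']
        refine ⟨⟨⟨hsub', ?_, h2, hF'⟩, by simp, by simp⟩, by norm_num⟩
        simp only [Function.update_self, h21]
        refine Or.inr ⟨by simp, hb, fun m hm hPm => ?_⟩
        rcases h1 with ⟨-, h1⟩ | ⟨h1, -, -⟩
        · rcases List.mem_append.1 hm with hm | hm
          · exact absurd hPm (h1 m hm)
          · rw [List.mem_singleton.1 hm]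
        · exact absurd hb1 (hloc _ (hsub _ h1)).1
      · simp only [Cond.Holds, e9] at hb1
        have h1' := h1.resolve_left fun h => hb1 h.1
        refine wp_ite (fun hb2 => ?_) fun hb2 => wp_skip ?_
        · simp only [Cond.Holds, h21] at hb2
          simp only [wp_instr, Instr.step, Option.some.injEq, exists_eq_left']
          refine ⟨⟨⟨hsub', ?_, h2, hF'⟩, by simp, by simp⟩, by norm_num⟩
          simp only [Function.update_self, h21]
          refine Or.inr ⟨by simp, hb, fun m hm hPm => ?_⟩
          rcases List.mem_append.1 hm with hm | hm
          · exact hb2.le.trans (h1'.2.2 m hm hPm)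
          · rw [List.mem_singleton.1 hm]
        · simp only [Cond.Holds, h21, not_lt] at hb2
          refine ⟨⟨⟨hsub', ?_, h2, ?_⟩, rfl, rfl⟩, by norm_num⟩
          · refine Or.inr ⟨by simp [h1'.1], h1'.2.1, fun m hm hPm => ?_⟩
            rcases List.mem_append.1 hm with hm | hm
            · exact h1'.2.2 m hm hPm
            · rw [List.mem_singleton.1 hm]
              exact hb2
          · refine hF.trans (mn' := [21]) (mr' := [21]) ⟨?_, ?_, ?_, ?_, rfl, rfl⟩ <;>
              intro x hx <;> simp_all
  · refine ⟨by simp, Or.inl ⟨by simp, by simp⟩, rfl, ?_⟩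
    refine ⟨?_, ?_, ?_, ?_, rfl, rfl⟩ <;> intro x hx <;> simp_all
  · rintro t k ⟨⟨-, h1, h2, h3⟩, hk⟩
    exact ⟨⟨h1, h2, h3⟩, by omega⟩

end SearchSpecs
-- The invariants of the stored tree and of the counters of a level.
section StoreInvariants

variable {X : Type u} [MetricSpace X]

/-- The tree of the net points of all levels: `ids k` are the nodes of level `k`, newest first,
`loc n` is the point of the node `n`, and the arrays hold the first child, the next sibling and the
parent of a node. -/
structure Tree (S : ℝ) (K : ℕ) (ids : ℕ → List ℕ) (loc : ℕ → X) (nx : ℕ) (F N Q : ℕ → ℕ)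
    (pts : ℕ → Option X) : Prop where
  pos : ∀ k, ∀ n ∈ ids k, 0 < n ∧ n < nx
  root : ids 0 = [1]
  sorted : ∀ k, (ids k).Pairwise (· > ·)
  disj : ∀ j k n, n ∈ ids j → n ∈ ids k → j = k
  pt : ∀ k, ∀ n ∈ ids k, pts n = some (loc n)
  child : ∀ k < K, ∀ n ∈ ids k, Linked N (F n) ((ids (k + 1)).filter fun c => Q c = n)
  parent : ∀ k < K, ∀ c ∈ ids (k + 1), Q c ∈ ids k ∧ dist (loc c) (loc (Q c)) ≤ S / 2 ^ k

/-- The arrays hold the numbers of assigned points, the numbers of points nearby and the number of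
nodes with few points nearby, for the nodes `l` of one level. -/
structure LevelOK (r : ℕ) (σ : ℝ) (l : List ℕ) (loc : ℕ → X) (V : List X × List X)
    (cnt nr : ℕ → ℝ) (bd : ℕ) : Prop where
  net : l.map loc = V.1
  cnt : ∀ n ∈ l, cnt n = V.2.count (loc n)
  near : ∀ n ∈ l, nr n = near σ V.2 (loc n)
  bad : bd = badCount r σ V

theorem LevelOK.congr {r : ℕ} {σ : ℝ} {l : List ℕ} {loc loc' : ℕ → X} {V : List X × List X}
    {cnt nr cnt' nr' : ℕ → ℝ} {bd : ℕ} (h : LevelOK r σ l loc V cnt nr bd)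
    (hl : ∀ n ∈ l, loc' n = loc n) (hc : ∀ n ∈ l, cnt' n = cnt n) (hn : ∀ n ∈ l, nr' n = nr n) :
    LevelOK r σ l loc' V cnt' nr' bd where
  net := by rw [← h.net]; exact List.map_congr_left hl
  cnt n hn' := by rw [hc n hn', hl n hn', h.cnt n hn']
  near n hn' := by rw [hn n hn', hl n hn', h.near n hn']
  bad := h.bad

/-- The number `nx` exceeds all numbers in use, so updates at `nx` do not disturb old nodes. The new
child goes to the head of the list of its parent, which keeps child lists newest first, as in `ids`.
-/
theorem Tree.insert {S : ℝ} {K : ℕ} {ids : ℕ → List ℕ} {loc : ℕ → X} {nx : ℕ} {F N Q : ℕ → ℕ}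
    {pts : ℕ → Option X} (h : Tree S K ids loc nx F N Q pts) {j prev : ℕ} (hprev : prev ∈ ids j)
    {p : X} (hp : dist p (loc prev) ≤ S / 2 ^ j) :
    Tree S K (Function.update ids (j + 1) (nx :: ids (j + 1))) (Function.update loc nx p) (nx + 1)
      (Function.update (Function.update F prev nx) nx 0) (Function.update N nx (F prev))
      (Function.update Q nx prev) (Function.update pts nx (some p)) := by
  have hlt : ∀ k, ∀ n ∈ ids k, n ≠ nx := fun k n hn => ((h.pos k n hn).2).ne
  have hnx : 0 < nx := (h.pos j prev hprev).1.trans (h.pos j prev hprev).2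
  have hmem : ∀ k n, n ∈ Function.update ids (j + 1) (nx :: ids (j + 1)) k ↔
      (k = j + 1 ∧ n = nx) ∨ n ∈ ids k := by
    intro k n
    by_cases hk : k = j + 1
    · subst hk; simp
    · simp [hk]
  have hfil : ∀ k n, (ids k).filter (fun c => Function.update Q nx prev c = n) =
      (ids k).filter fun c => Q c = n := by
    intro k n
    refine List.filter_congr fun c hc => ?_
    rw [Function.update_of_ne (hlt k c hc)]
  have hlinked : ∀ k n a, Linked N a ((ids k).filter fun c => Q c = n) →
      Linked (Function.update N nx (F prev)) a ((ids k).filter fun c => Q c = n) := by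
    intro k n a ha
    refine ha.congr fun c hc => ?_
    rw [Function.update_of_ne (hlt k c (List.mem_of_mem_filter hc))]
  refine ⟨?_, ?_, ?_, ?_, ?_, ?_, ?_⟩
  · intro k n hn
    rcases (hmem k n).1 hn with ⟨-, rfl⟩ | hn
    · omega
    · have := h.pos k n hn
      omega
  · rw [Function.update_of_ne (by omega), h.root]
  · intro k
    by_cases hk : k = j + 1
    · subst hk
      rw [Function.update_self]
      exact List.pairwise_cons.2 ⟨fun n hn => (h.pos _ n hn).2, h.sorted _⟩
    · rw [Function.update_of_ne hk]
      exact h.sorted k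
  · intro i k n hi hk
    rcases (hmem i n).1 hi with ⟨hi, hin⟩ | hi' <;> rcases (hmem k n).1 hk with ⟨hk, hkn⟩ | hk'
    · rw [hi, hk]
    · exact absurd hin (hlt k n hk')
    · exact absurd hkn (hlt i n hi')
    · exact h.disj i k n hi' hk'
  · intro k n hn
    rcases (hmem k n).1 hn with ⟨-, rfl⟩ | hn
    · simp
    · rw [Function.update_of_ne (hlt k n hn), Function.update_of_ne (hlt k n hn), h.pt k n hn]
  · intro k hk n hn'
    rcases (hmem k n).1 hn' with ⟨rfl, rfl⟩ | hn
    -- The new node has no children, since the parents of the nodes below are old nodes.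
    · rw [Function.update_self, Function.update_of_ne (by omega), hfil, List.filter_eq_nil_iff.2]
      · rfl
      · intro c hc
        simpa using hlt _ _ (h.parent _ hk c hc).1
    · rw [Function.update_of_ne (hlt k n hn)]
      by_cases hkj : k = j
      · subst hkj
        rw [Function.update_self]
        by_cases hnp : n = prev
        · subst hnp
          rw [List.filter_cons_of_pos (by simp), Function.update_self, hfil]
          refine ⟨rfl, hnx.ne', ?_⟩
          rw [Function.update_self]
          exact hlinked _ _ _ (h.child k hk n hn)
        · rw [List.filter_cons_of_neg (by simpa using Ne.symm hnp), Function.update_of_ne hnp, hfil]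
          exact hlinked _ _ _ (h.child k hk n hn)
      · have hnp : n ≠ prev := by
          rintro rfl
          exact hkj (h.disj k j _ hn hprev)
        rw [Function.update_of_ne hnp, Function.update_of_ne (by omega : k + 1 ≠ j + 1), hfil]
        exact hlinked _ _ _ (h.child k hk n hn)
  · intro k hk c hc
    rcases (hmem (k + 1) c).1 hc with ⟨hkj, rfl⟩ | hc
    · obtain rfl : k = j := by omega
      rw [Function.update_self, Function.update_self, Function.update_of_ne (hlt k _ hprev)]
      exact ⟨(hmem _ _).2 (Or.inr hprev), hp⟩
    · obtain ⟨h1, h2⟩ := h.parent k hk c hc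
      rw [Function.update_of_ne (hlt _ c hc), Function.update_of_ne (hlt _ c hc),
        Function.update_of_ne (hlt _ _ h1)]
      exact ⟨(hmem _ _).2 (Or.inr h1), h2⟩

/-- An intermediate stage: `p` is in the net, but is not yet assigned, so its count is 0 and the
other estimates do not change. -/
theorem LevelOK.create {r : ℕ} {σ : ℝ} {l : List ℕ} {loc : ℕ → X} {V : List X × List X}
    {cnt nr : ℕ → ℝ} {bd : ℕ} (h : LevelOK r σ l loc V cnt nr bd) {nx : ℕ} (hnx : nx ∉ l) {p : X}
    (hp : p ∉ V.2) :
    LevelOK r σ (nx :: l) (Function.update loc nx p) (p :: V.1, V.2)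
      (Function.update cnt nx 0) (Function.update nr nx (RGather.near σ V.2 p))
      (if ((RGather.near σ V.2 p : ℕ) : ℝ) < r then bd + 1 else bd) := by
  have hne : ∀ n ∈ l, n ≠ nx := fun n hn h => hnx (h ▸ hn)
  refine ⟨?_, ?_, ?_, ?_⟩
  · rw [List.map_cons, Function.update_self, ← h.net]
    congr 1
    exact List.map_congr_left fun n hn => Function.update_of_ne (hne n hn) _ _
  · intro n hn
    rcases List.mem_cons.1 hn with rfl | hn
    · simp [List.count_eq_zero_of_not_mem hp]
    · rw [Function.update_of_ne (hne n hn), Function.update_of_ne (hne n hn), h.cnt n hn]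
  · intro n hn
    rcases List.mem_cons.1 hn with rfl | hn
    · simp
    · rw [Function.update_of_ne (hne n hn), Function.update_of_ne (hne n hn), h.near n hn]
  · rw [h.bad, badCount, badCount, List.countP_cons]
    simp only [Nat.cast_lt, decide_eq_true_eq]
    split_ifs <;> rfl

theorem near_cons (σ : ℝ) (y : X) (A : List X) (x : X) :
    near σ (y :: A) x = near σ A x + if dist x y ≤ 2 * σ then 1 else 0 := by
  simp [near, List.countP_cons, dist_comm]

/-- One more assignment to `b` raises the estimate by one exactly at the nodes within `2 * σ` of
`b`. -/
theorem LevelOK.bump {r : ℕ} {σ : ℝ} {l : List ℕ} {loc : ℕ → X} {V : List X × List X}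
    {cnt nr : ℕ → ℝ} {bd : ℕ} (h : LevelOK r σ l loc V cnt nr bd) {b : ℕ} (hb : b ∈ l)
    (hl : (l.map loc).Nodup) {nr' : ℕ → ℝ}
    (hnr : ∀ n ∈ l, nr' n = nr n + if dist (loc n) (loc b) ≤ 2 * σ then 1 else 0) :
    LevelOK r σ l loc (V.1, loc b :: V.2) (Function.update cnt b (cnt b + 1)) nr'
      (l.countP fun n => nr' n < r) := by
  have hnear : ∀ n ∈ l, nr' n = RGather.near σ (loc b :: V.2) (loc n) := by
    intro n hn
    rw [hnr n hn, h.near n hn, near_cons]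
    push_cast
    rfl
  refine ⟨h.net, ?_, hnear, ?_⟩
  · intro n hn
    by_cases hnb : n = b
    · subst hnb
      rw [Function.update_self, h.cnt n hn, List.count_cons_self]
      push_cast
      rfl
    · rw [Function.update_of_ne hnb, h.cnt n hn, List.count_cons_of_ne]
      exact fun he => hnb (List.inj_on_of_nodup_map hl hn hb he.symm)
  · rw [badCount, ← h.net, List.countP_map]
    refine List.countP_congr fun n hn => ?_
    simp [hnear n hn]

/-- The effect on the number of bad nodes of a change at one node, in additive form to avoid
truncated subtraction. -/
theorem countP_update {l : List ℕ} (hl : l.Nodup) {P P' : ℕ → Prop} {n : ℕ} (hn : n ∈ l)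
    (h : ∀ m ∈ l, m ≠ n → (P' m ↔ P m)) :
    l.countP (fun m => P' m) + (if P n then 1 else 0) =
      l.countP (fun m => P m) + if P' n then 1 else 0 := by
  induction l with
  | nil => simp at hn
  | cons a l ih =>
    obtain ⟨ha, hl'⟩ := List.nodup_cons.1 hl
    simp only [List.countP_cons, decide_eq_true_eq]
    rcases List.mem_cons.1 hn with rfl | hn
    · have : l.countP (fun m => P' m) = l.countP fun m => P m := by
        refine List.countP_congr fun m hm => ?_
        simpa using h m (by simp [hm]) fun e => ha (e ▸ hm)
      omega
    · have h1 := h a (by simp) fun e => ha (e ▸ hn)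
      have h2 := ih hl' hn fun m hm => h m (by simp [hm])
      simp only [h1]
      omega

omit [MetricSpace X] in
theorem sum_count_eq_countP (A L : List X) (hL : L.Nodup) :
    (L.map fun x => (A.count x : ℝ)).sum = A.countP fun y => y ∈ L := by
  induction L with
  | nil => simp
  | cons a L ih =>
    obtain ⟨ha, hL'⟩ := List.nodup_cons.1 hL
    rw [List.map_cons, List.sum_cons, ih hL']
    norm_cast
    clear ih
    induction A with
    | nil => simp
    | cons b A ih =>
      simp only [List.count_cons, List.countP_cons, beq_iff_eq, decide_eq_true_eq,
        List.mem_cons] at ih ⊢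
      rw [← ih]
      by_cases hb : b = a
      · subst hb
        simp [ha]
        omega
      · simp [hb]
        omega

/-- A search in the queue is a search in the whole level as long as the search radius does not
exceed the radius of the queue. -/
theorem IsLeastIn.of_near {P R : ℕ → Prop} {l ql : List ℕ} {b : ℕ} (h : IsLeastIn P ql b)
    (hql : ∀ n, n ∈ ql ↔ n ∈ l ∧ R n) (hPR : ∀ n, P n → R n) : IsLeastIn P l b := by
  rcases h with ⟨h0, h⟩ | ⟨h1, h2, h3⟩
  · exact Or.inl ⟨h0, fun n hn hP => h n ((hql n).2 ⟨hn, hPR n hP⟩) hP⟩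
  · exact Or.inr ⟨((hql b).1 h1).1, h2, fun n hn hP => h3 n ((hql n).2 ⟨hn, hPR n hP⟩) hP⟩

/-- Node numbers grow with time, so the least number belongs to the oldest node. -/
theorem IsLeastIn.oldest {t : ℝ} {p : X} {loc : ℕ → X} {l : List ℕ} {b : ℕ}
    (h : IsLeastIn (fun n => dist (loc n) p ≤ t) l b) (hl : l.Pairwise (· > ·))
    (hpos : ∀ n ∈ l, 0 < n) :
    (b = 0 ∧ oldest t (l.map loc) p = none) ∨
      (b ≠ 0 ∧ b ∈ l ∧ dist (loc b) p ≤ t ∧ RGather.oldest t (l.map loc) p = some (loc b)) := by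
  rcases h with ⟨h0, h⟩ | ⟨h1, h2, h3⟩
  · refine Or.inl ⟨h0, oldest_eq_none.2 fun y hy => ?_⟩
    obtain ⟨n, hn, rfl⟩ := List.mem_map.1 hy
    exact not_le.1 (h n hn)
  · refine Or.inr ⟨(hpos b h1).ne', h1, h2, ?_⟩
    obtain ⟨l₁, l₂, rfl⟩ := List.append_of_mem h1
    have hsort := (List.pairwise_cons.1 (List.pairwise_append.1 hl).2.1).1
    rw [RGather.oldest, List.find?_eq_some_iff_append]
    refine ⟨by simpa using h2, (l₂.map loc).reverse, (l₁.map loc).reverse, by simp, ?_⟩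
    intro y hy
    obtain ⟨n, hn, rfl⟩ := List.mem_map.1 (List.mem_reverse.1 hy)
    simp only [Bool.not_eq_true', decide_eq_false_iff_not]
    intro hn'
    exact absurd (h3 n (by simp [hn]) hn') (not_le.2 (hsort n hn))

/-- The queue holds the nodes of the list `l` that are near `p`. -/
structure NearQueue (σ : ℝ) (l : List ℕ) (loc : ℕ → X) (p : X) (s : State X) (ql : List ℕ) :
    Prop where
  seg : Seg (s.natArr 10) (s.nat 15) ql
  tail : s.nat 16 = s.nat 15 + ql.length
  nodup : ql.Nodup
  mem : ∀ n, n ∈ ql ↔ n ∈ l ∧ dist (loc n) p ≤ 4 * σ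

end StoreInvariants
-- Programs that add a point at one level.
section UpdatePrograms

/-- Make the point a new node below the node in register `11`. -/
def create : Cmd :=
  -- The estimate of the new node is the sum of the counts of the nodes within twice the scale.
  -- Counts are reals because only reals can be added in one step.
  .seq (.run [.realCopy 22 9, .realAdd 20 10 10]) <|
  .seq (forQueue <|
    .seq (.run [.ptLoad 20 0 21, .distance 21 20 0]) <|
    .ite (.realLt 20 21) .skip <|
    .run [.realLoad 23 0 21, .realAdd 22 22 23]) <|
  -- The parent, in array `3`, is never read by a program; it serves only the invariant.
  .seq (.run [.ptStore 0 3 0, .natLoad 23 0 11, .natStore 1 3 23, .natStore 0 11 3,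
    .natStore 0 3 9, .natStore 3 3 11, .realStore 0 3 9, .realStore 1 3 22, .natStore 10 16 3,
    .natSucc 16 16, .natCopy 22 3, .natSucc 3 3]) <|
  .ite (.realLt 22 8) (.run [.natSucc 25 25]) .skip

/-- Assign the point to the node in register `22`. -/
def assign : Cmd :=
  .seq (.run [.realLoad 22 0 22, .realAdd 22 22 7, .realStore 0 22 22, .ptLoad 21 0 22,
    .realAdd 20 10 10]) <|
  forQueue <|
    .seq (.run [.ptLoad 20 0 21, .distance 21 20 21]) <|
    .ite (.realLt 20 21) .skip <|
    .seq (.run [.realLoad 22 1 21, .realAdd 23 22 7, .realStore 1 21 23]) <|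
    -- The number of bad nodes drops exactly if the new estimate is at least `r` and the old one is
    -- not.
    .ite (.realLt 23 8) .skip <|
    .ite (.realLt 22 8) (.run [.natPred 25 25]) .skip

/-- Add a point at one level. -/
def update : Cmd :=
  .seq (.run [.realCopy 20 10]) <|
  .seq scan <|
  .seq (.run [.natLoad 25 2 10]) <|
  .seq (.ite (.natEq 22 9) create .skip) <|
  .seq assign <|
  .run [.natStore 2 10 25, .natCopy 11 22]

end UpdatePrograms

/-! ### Correctness and cost of node creation and assignment. -/

section UpdateSpecs

variable {X : Type u} [MetricSpace X]

/-- The state `s'` differs from `s` in the registers at most in the listed ones and in the point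
registers `20` and `21`. -/
structure Regs (mn mr : List ℕ) (s s' : State X) : Prop where
  nat : ∀ x ∉ mn, s'.nat x = s.nat x
  real : ∀ x ∉ mr, s'.real x = s.real x
  pt : ∀ x, x ≠ 20 → x ≠ 21 → s'.pt x = s.pt x

omit [MetricSpace X] in
theorem Regs.trans {mn mr mn' mr' : List ℕ} {s s' s'' : State X} (h : Regs mn mr s s')
    (h' : Regs mn' mr' s' s'') (hn : mn' ⊆ mn := by decide) (hr : mr' ⊆ mr := by decide) :
    Regs mn mr s s'' where
  nat x hx := (h'.nat x fun h => hx (hn h)).trans (h.nat x hx)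
  real x hx := (h'.real x fun h => hx (hr h)).trans (h.real x hx)
  pt x hx hx' := (h'.pt x hx hx').trans (h.pt x hx hx')

omit [MetricSpace X] in
theorem Regs.mono {mn mr mn' mr' : List ℕ} {s s' : State X} (h : Regs mn' mr' s s')
    (hn : mn' ⊆ mn := by decide) (hr : mr' ⊆ mr := by decide) : Regs mn mr s s' :=
  ⟨fun x hx => h.nat x fun h' => hx (hn h'), fun x hx => h.real x fun h' => hx (hr h'), h.pt⟩

omit [MetricSpace X] in
theorem Frame.regs {mn mr mn' mr' : List ℕ} {s s' : State X} (h : Frame mn' mr' s s')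
    (hn : mn' ⊆ mn := by decide) (hr : mr' ⊆ mr := by decide) : Regs mn mr s s' :=
  ⟨(h.mono hn hr).nat, (h.mono hn hr).real, fun x hx _ => h.pt x hx⟩

/-- The queue contains every node within `2 * σ` of `p`, and different nodes are different points,
so each assignment is counted once. -/
theorem sum_cnt {r : ℕ} {σ : ℝ} {l ql : List ℕ} {loc : ℕ → X} {V : List X × List X}
    {cnt nr : ℕ → ℝ} {bd : ℕ} (h : LevelOK r σ l loc V cnt nr bd) (hσ : 0 ≤ σ) {p : X}
    (hnd : ql.Nodup) (hql : ∀ n, n ∈ ql ↔ n ∈ l ∧ dist (loc n) p ≤ 4 * σ)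
    (hV : V.1.Nodup) (hA : ∀ y ∈ V.2, y ∈ V.1) :
    ((ql.filter fun n => dist (loc n) p ≤ 2 * σ).map cnt).sum = near σ V.2 p := by
  set L := ql.filter fun n => dist (loc n) p ≤ 2 * σ with hL
  have hLl : ∀ n ∈ L, n ∈ l := fun n hn => ((hql n).1 (List.mem_of_mem_filter hn)).1
  have h1 : L.map cnt = (L.map loc).map fun x => (V.2.count x : ℝ) := by
    rw [List.map_map]
    exact List.map_congr_left fun n hn => h.cnt n (hLl n hn)
  have h2 : (L.map loc).Nodup := by
    refine List.Nodup.map_on (fun m hm n hn hmn => ?_) (hnd.filter _)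
    exact List.inj_on_of_nodup_map (h.net ▸ hV) (hLl m hm) (hLl n hn) hmn
  rw [h1, sum_count_eq_countP _ _ h2, near]
  norm_cast
  refine List.countP_congr fun y hy => ?_
  simp only [List.mem_map, decide_eq_true_eq]
  constructor
  · rintro ⟨n, hn, rfl⟩
    simpa using (List.mem_filter.1 hn).2
  · intro hyp
    have := hA y hy
    rw [← h.net] at this
    obtain ⟨n, hn, rfl⟩ := List.mem_map.1 this
    refine ⟨n, List.mem_filter.2 ⟨(hql n).2 ⟨hn, by linarith⟩, by simpa using hyp⟩, rfl⟩

theorem wp_create {r : ℕ} {S : ℝ} {K : ℕ} {ids : ℕ → List ℕ} {loc : ℕ → X}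
    {V : List X × List X} {s : State X} {j : ℕ} {p : X} {ql : List ℕ} {σ : ℝ} (hσ : 0 ≤ σ)
    (hT : Tree S K ids loc (s.nat 3) (s.natArr 0) (s.natArr 1) (s.natArr 3) (s.ptArr 0))
    (hL : LevelOK r σ (ids (j + 1)) loc V (s.realArr 0) (s.realArr 1) (s.nat 25))
    (hQ : NearQueue σ (ids (j + 1)) loc p s ql)
    (h9 : s.nat 9 = 0) (hr8 : s.real 8 = r) (hr9 : s.real 9 = 0) (hr10 : s.real 10 = σ)
    (hp : s.pt 0 = some p) (hprev : s.nat 11 ∈ ids j) (hdist : dist p (loc (s.nat 11)) ≤ S / 2 ^ j)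
    (hV : V.1.Nodup) (hA : ∀ y ∈ V.2, y ∈ V.1) (hnone : oldest σ V.1 p = none) :
    wp create (fun s' k =>
      (Tree S K (Function.update ids (j + 1) (s.nat 3 :: ids (j + 1)))
          (Function.update loc (s.nat 3) p)
          (s'.nat 3) (s'.natArr 0) (s'.natArr 1) (s'.natArr 3) (s'.ptArr 0) ∧
        LevelOK r σ (s.nat 3 :: ids (j + 1)) (Function.update loc (s.nat 3) p) (p :: V.1, V.2)
          (s'.realArr 0) (s'.realArr 1) (s'.nat 25) ∧
        NearQueue σ (s.nat 3 :: ids (j + 1)) (Function.update loc (s.nat 3) p) p s'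
          (ql ++ [s.nat 3]) ∧
        s'.nat 22 = s.nat 3 ∧ (∀ n, n ≠ s.nat 3 → s'.realArr 0 n = s.realArr 0 n) ∧
        (∀ n, n ≠ s.nat 3 → s'.realArr 1 n = s.realArr 1 n) ∧ s'.natArr 2 = s.natArr 2 ∧
        Regs [3, 16, 20, 21, 22, 23, 25] [20, 21, 22, 23] s s') ∧
      k ≤ ql.length * 8 + 19) s := by
  have hlt : ∀ n ∈ ids (j + 1), n ≠ s.nat 3 := fun n hn => (hT.pos _ n hn).2.ne
  set P : ℕ → Bool := fun n => dist (loc n) p ≤ 2 * σ with hP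
  rw [create, wp_seq]
  simp only [Cmd.run, List.foldl, wp_seq, wp_instr, Instr.step, Option.some.injEq,
    exists_eq_left', Function.update_self]
  refine (wp_forQueue (ql := ql) (fun done t => t.natArr 10 = s.natArr 10 ∧
    t.real 22 = ((done.filter P).map (s.realArr 0)).sum ∧ t.real 20 = 2 * σ ∧
    Frame [20, 21] [20, 21, 22, 23] s t) 5 ?_ ?_ ?_ ?_).mono ?_
  · rintro done t ⟨h10, -, -, hF⟩
    rw [h10, hF.nat 15 (by decide), hF.nat 16 (by decide)]
    exact ⟨hQ.seg, hQ.tail⟩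
  · rintro done t x n hx ⟨h1, h2, h3, hF⟩
    refine ⟨h1, h2, h3, hF.trans (mn' := [20, 21]) (mr' := []) ⟨?_, ?_, ?_, ?_, rfl, rfl⟩⟩
    · intro y hy
      simp only [List.mem_cons, not_or] at hy
      rcases hx with rfl | rfl <;> simp [hy]
    all_goals intro y _; rfl
  · rintro done n rest t hd ⟨h1, h2, h3, hF⟩ h21
    have hn : n ∈ ids (j + 1) := ((hQ.mem n).1 (by rw [← hd]; simp)).1
    have e1 : t.ptArr 0 n = some (loc n) := by rw [hF.ptArr]; exact hT.pt _ n hn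
    have e2 : t.pt 0 = some p := by rw [hF.pt 0 (by decide)]; exact hp
    have e3 : t.realArr 0 n = s.realArr 0 n := by rw [hF.realArr]
    simp only [wp_seq, wp_instr, Instr.step, h21, e1,
      Option.some.injEq, exists_eq_left', Function.update_self, e2,
      Function.update_of_ne (show (0 : ℕ) ≠ 20 by decide)]
    refine wp_ite (fun hb => wp_skip ?_) fun hb => ?_
    · simp only [Cond.Holds, Function.update_self, h3,
        Function.update_of_ne (show (20 : ℕ) ≠ 21 by decide)] at hb
      refine ⟨⟨⟨h1, ?_, by simpa using h3, ?_⟩, rfl, rfl⟩, by norm_num⟩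
      · rw [List.filter_append, List.filter_cons_of_neg (by simpa [hP] using hb)]
        simpa using h2
      · refine hF.trans (mn' := []) (mr' := [21]) ⟨?_, ?_, ?_, ?_, rfl, rfl⟩ <;>
          intro x hx <;> simp_all
    · simp only [Cond.Holds, Function.update_self, h3,
        Function.update_of_ne (show (20 : ℕ) ≠ 21 by decide), not_lt] at hb
      simp only [wp_instr, wp_seq, Instr.step, Option.some.injEq, exists_eq_left']
      refine ⟨⟨⟨h1, ?_, by simpa using h3, ?_⟩, by simp, by simp⟩, by norm_num⟩
      · rw [List.filter_append, List.filter_cons_of_pos (by simpa [hP] using hb)]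
        simp [h2, e3, h21]
      · refine hF.trans (mn' := []) (mr' := [21, 22, 23]) ⟨?_, ?_, ?_, ?_, rfl, rfl⟩ <;>
          intro x hx <;> simp_all
  · refine ⟨rfl, by simp [hr9], by simp [hr10]; ring, ?_⟩
    refine ⟨?_, ?_, ?_, ?_, rfl, rfl⟩ <;> intro x hx <;> simp_all
  · rintro t k ⟨⟨h1, h2, -, hF⟩, hk⟩
    rw [sum_cnt hL hσ hQ.nodup hQ.mem hV hA] at h2
    have a0 := hF.natArr 0 (by decide)
    have a1 := hF.natArr 1 (by decide)
    have a2 := hF.natArr 2 (by decide)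
    have a3 := hF.natArr 3 (by decide)
    have ap := hF.ptArr
    have ar := hF.realArr
    have n3 := hF.nat 3 (by decide)
    have n9 := (hF.nat 9 (by decide)).trans h9
    have n11 := hF.nat 11 (by decide)
    have n15 := hF.nat 15 (by decide)
    have n16 := hF.nat 16 (by decide)
    have n25 := hF.nat 25 (by decide)
    have r8 := (hF.real 8 (by decide)).trans hr8
    have r9 := (hF.real 9 (by decide)).trans hr9
    have pt0 := (hF.pt 0 (by decide)).trans hp
    -- Otherwise `p` would be a net point at distance 0 from itself and would have been found.
    have hp' : p ∉ V.2 := fun hm => by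
      have := oldest_eq_none.1 hnone p (hA p hm)
      rw [dist_self] at this
      linarith
    have hT' := hT.insert hprev hdist
    have hL' := hL.create (fun h => hlt _ h rfl) hp'
    have hQ1 : Seg (Function.update (s.natArr 10) (s.nat 16) (s.nat 3)) (s.nat 15)
        (ql ++ [s.nat 3]) := by
      rw [hQ.tail]
      exact hQ.seg.snoc _
    have hQ2 : (ql ++ [s.nat 3]).Nodup := by
      refine List.nodup_append.2 ⟨hQ.nodup, by simp, fun a ha b hb => ?_⟩
      rw [List.mem_singleton.1 hb]
      exact hlt a ((hQ.mem a).1 ha).1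
    have hQ3 : ∀ n, n ∈ ql ++ [s.nat 3] ↔ n ∈ s.nat 3 :: ids (j + 1) ∧
        dist (Function.update loc (s.nat 3) p n) p ≤ 4 * σ := by
      intro n
      by_cases hn : n = s.nat 3
      · simpa [hn] using hσ
      · simp [hn, hQ.mem n]
    have hQ4 : s.nat 16 + 1 = s.nat 15 + (ql ++ [s.nat 3]).length := by
      simp [hQ.tail, Nat.add_assoc]
    refine wp_ite (fun hb => ?_) fun hb => wp_skip ?_
    · simp only [Cond.Holds, h2, r8] at hb
      rw [if_pos hb] at hL'
      simp only [wp_instr, Instr.step, Option.some.injEq, exists_eq_left']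
      refine ⟨⟨?_, ?_, ⟨?_, ?_, hQ2, hQ3⟩, ?_, ?_, ?_, ?_, ?_⟩, by omega⟩
      · simpa [a0, a1, a3, ap, n3, n9, n11, pt0] using hT'
      · simpa [ar, n3, n25, h2, r9] using hL'
      · simpa [h1, n3, n15, n16] using hQ1
      · simpa [n15, n16] using hQ4
      · simp [n3]
      · intro n hn; simp [ar, n3, hn]
      · intro n hn; simp [ar, n3, hn]
      · simpa using a2
      · refine hF.regs.trans (s' := t) (mn' := [3, 16, 22, 23, 25]) (mr' := []) ⟨?_, ?_, ?_⟩ <;>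
          intro x hx <;> simp_all
    · simp only [Cond.Holds, h2, r8] at hb
      rw [if_neg hb] at hL'
      refine ⟨⟨?_, ?_, ⟨?_, ?_, hQ2, hQ3⟩, ?_, ?_, ?_, ?_, ?_⟩, by omega⟩
      · simpa [a0, a1, a3, ap, n3, n9, n11, pt0] using hT'
      · simpa [ar, n3, n25, h2, r9] using hL'
      · simpa [h1, n3, n15, n16] using hQ1
      · simpa [n15, n16] using hQ4
      · simp [n3]
      · intro n hn; simp [ar, n3, hn]
      · intro n hn; simp [ar, n3, hn]
      · simpa using a2
      · refine hF.regs.trans (s' := t) (mn' := [3, 16, 22, 23, 25]) (mr' := []) ⟨?_, ?_, ?_⟩ <;>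
          intro x hx <;> simp_all

theorem wp_assign {r : ℕ} {l : List ℕ} {loc : ℕ → X}
    {V : List X × List X} {s : State X} {p : X} {ql : List ℕ} {σ : ℝ}
    (hL : LevelOK r σ l loc V (s.realArr 0) (s.realArr 1) (s.nat 25))
    (hQ : NearQueue σ l loc p s ql) (hpt : ∀ n ∈ l, s.ptArr 0 n = some (loc n))
    (hr7 : s.real 7 = 1) (hr8 : s.real 8 = r) (hr10 : s.real 10 = σ)
    (hb : s.nat 22 ∈ l) (hdist : dist (loc (s.nat 22)) p ≤ σ)
    (hl : l.Nodup) (hV : V.1.Nodup) :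
    wp assign (fun s' k =>
      (LevelOK r σ l loc (V.1, loc (s.nat 22) :: V.2)
          (s'.realArr 0) (s'.realArr 1) (s'.nat 25) ∧
        NearQueue σ l loc p s' ql ∧
        (∀ n, n ≠ s.nat 22 → s'.realArr 0 n = s.realArr 0 n) ∧
        (∀ n, n ∉ l → s'.realArr 1 n = s.realArr 1 n) ∧
        s'.natArr = s.natArr ∧ s'.ptArr = s.ptArr ∧
        Regs [20, 21, 25] [20, 21, 22, 23] s s') ∧
      k ≤ ql.length * 12 + 7) s := by
  set b := s.nat 22 with hbdef
  have hql : ∀ n ∈ ql, n ∈ l := fun n hn => ((hQ.mem n).1 hn).1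
  rw [assign, wp_seq]
  simp only [Cmd.run, List.foldl, wp_seq, wp_instr, Instr.step, Option.some.injEq,
    exists_eq_left', Function.update_self]
  refine (wp_forQueue (ql := ql) (fun done t => t.natArr = s.natArr ∧ t.ptArr = s.ptArr ∧
    t.pt 21 = some (loc b) ∧ t.real 20 = 2 * σ ∧
    t.realArr 0 = Function.update (s.realArr 0) b (s.realArr 0 b + 1) ∧
    (∀ n, t.realArr 1 n = s.realArr 1 n +
      if n ∈ done ∧ dist (loc n) (loc b) ≤ 2 * σ then 1 else 0) ∧
    t.nat 25 = l.countP (fun n => t.realArr 1 n < r) ∧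
    Regs [20, 21, 25] [20, 21, 22, 23] s t) 9 ?_ ?_ ?_ ?_).mono ?_
  · rintro done t ⟨h1, -, -, -, -, -, -, hF⟩
    rw [h1, hF.nat 15 (by decide), hF.nat 16 (by decide)]
    exact ⟨hQ.seg, hQ.tail⟩
  · rintro done t x n hx ⟨h1, h2, h3, h4, h5, h6, h7, hF⟩
    refine ⟨h1, h2, h3, h4, h5, h6, ?_, hF.trans (mn' := [20, 21]) (mr' := []) ⟨?_, ?_, ?_⟩⟩
    · rcases hx with rfl | rfl <;> simpa using h7
    · intro y hy
      simp only [List.mem_cons, not_or] at hy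
      rcases hx with rfl | rfl <;> simp [hy]
    all_goals intros; rfl
  · rintro done n rest t hd ⟨h1, h2, h3, h4, h5, h6, h7, hF⟩ h21
    have hnq : n ∈ ql := by rw [← hd]; simp
    have hnl := hql n hnq
    have hnd : n ∉ done := fun hm => by
      have := hQ.nodup
      rw [← hd] at this
      exact (List.nodup_append.1 this).2.2 n hm n (by simp) rfl
    have e1 : t.ptArr 0 n = some (loc n) := by rw [h2]; exact hpt n hnl
    have e7 : t.real 7 = 1 := (hF.real 7 (by decide)).trans hr7
    have e8 : t.real 8 = r := (hF.real 8 (by decide)).trans hr8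
    simp only [wp_seq, wp_instr, Instr.step, h21, e1,
      Option.some.injEq, exists_eq_left', Function.update_self, h3,
      Function.update_of_ne (show (21 : ℕ) ≠ 20 by decide)]
    refine wp_ite (fun hc => wp_skip ?_) fun hc => ?_
    · simp only [Cond.Holds, Function.update_self, h4,
        Function.update_of_ne (show (20 : ℕ) ≠ 21 by decide)] at hc
      refine ⟨⟨⟨h1, h2, by simpa using h3, by simpa using h4, h5, ?_, h7, ?_⟩, rfl, rfl⟩,
        by norm_num⟩
      · intro m
        rw [h6 m]
        congr 1
        refine if_congr ?_ rfl rfl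
        simp only [List.mem_append, List.mem_singleton]
        constructor
        · exact fun h => ⟨Or.inl h.1, h.2⟩
        · rintro ⟨h | rfl, h'⟩
          · exact ⟨h, h'⟩
          · exact absurd h' (not_le.2 hc)
      · refine hF.trans (mn' := []) (mr' := [21]) ⟨?_, ?_, ?_⟩ <;> intro x hx <;> simp_all
    · simp only [Cond.Holds, Function.update_self, h4,
        Function.update_of_ne (show (20 : ℕ) ≠ 21 by decide), not_lt] at hc
      simp only [wp_seq, wp_instr, Instr.step, Option.some.injEq, exists_eq_left', h21,
        Function.update_self]
      have hupd : ∀ m, Function.update (t.realArr 1) n (t.realArr 1 n + 1) m =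
          s.realArr 1 m + if m ∈ done ++ [n] ∧ dist (loc m) (loc b) ≤ 2 * σ then 1 else 0 := by
        intro m
        by_cases hm : m = n
        · subst hm
          rw [Function.update_self, h6, if_neg fun h => hnd h.1,
            if_pos ⟨by simp, hc⟩]
          ring
        · rw [Function.update_of_ne hm, h6]
          simp [hm]
      -- Only the estimate of `n` changes; the three branches below are the cases "still bad", "no
      -- longer bad" and "good before".
      have hcount := countP_update hl (P := fun m => t.realArr 1 m < r)
        (P' := fun m => Function.update (t.realArr 1) n (t.realArr 1 n + 1) m < r) hnl
        fun m _ hm => by rw [Function.update_of_ne hm]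
      simp only [Function.update_self] at hcount
      have hR : ∀ (f : ℕ → ℕ) (A : ℕ → ℕ → ℝ) (x y z : ℝ),
          (∀ w ∉ [20, 21, 25], f w = t.nat w) → Regs [20, 21, 25] [20, 21, 22, 23] s
            { t with
              nat := f
              real := Function.update (Function.update (Function.update t.real 21 x) 22 y) 23 z
              pt := Function.update t.pt 20 (some (loc n))
              realArr := A } := by
        intro f A x y z hf
        refine hF.trans (mn' := [20, 21, 25]) (mr' := [21, 22, 23]) ⟨hf, ?_, ?_⟩ <;>
          intro w hw <;> simp_all
      refine wp_ite (fun hc1 => wp_skip ?_) fun hc1 => ?_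
      · simp [Cond.Holds, e7, e8] at hc1
        refine ⟨⟨⟨h1, h2, by simpa using h3, by simpa using h4, by simpa using h5, ?_, ?_,
          hR _ _ _ _ _ fun _ _ => rfl⟩, by simp, by simp⟩, by norm_num⟩
        · simpa [e7] using hupd
        · simp only [Function.update_self, e7, Function.update_of_ne (show (7 : ℕ) ≠ 22 by decide),
            Function.update_of_ne (show (7 : ℕ) ≠ 21 by decide)]
          rw [h7]
          rw [if_pos (by linarith), if_pos hc1] at hcount
          omega
      · simp [Cond.Holds, e7, e8] at hc1
        refine wp_ite (fun hc2 => ?_) fun hc2 => wp_skip ?_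
        · simp [Cond.Holds, e8] at hc2
          simp only [wp_instr, Instr.step, Option.some.injEq, exists_eq_left']
          refine ⟨⟨⟨h1, h2, by simpa using h3, by simpa using h4, by simpa using h5, ?_, ?_,
            hR _ _ _ _ _ fun w hw => ?_⟩, by simp, by simp⟩, by norm_num⟩
          · simpa [e7] using hupd
          · simp only [Function.update_self, e7,
              Function.update_of_ne (show (7 : ℕ) ≠ 22 by decide),
              Function.update_of_ne (show (7 : ℕ) ≠ 21 by decide)]
            rw [h7]
            rw [if_pos hc2, if_neg (by linarith)] at hcount
            omega
          · simp only [List.mem_cons, not_or] at hw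
            simp [hw]
        · simp [Cond.Holds, e8] at hc2
          refine ⟨⟨⟨h1, h2, by simpa using h3, by simpa using h4, by simpa using h5, ?_, ?_,
            hR _ _ _ _ _ fun _ _ => rfl⟩, by simp, by simp⟩, by norm_num⟩
          · simpa [e7] using hupd
          · simp only [Function.update_self, e7,
              Function.update_of_ne (show (7 : ℕ) ≠ 22 by decide),
              Function.update_of_ne (show (7 : ℕ) ≠ 21 by decide)]
            rw [h7]
            rw [if_neg (by linarith), if_neg (by linarith)] at hcount
            omega
  · have e := hpt b hb
    refine ⟨rfl, rfl, by simpa [hbdef] using e, by simp [hr10]; ring, by simp [hr7, hbdef], by simp,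
      ?_, ?_⟩
    · rw [hL.bad, badCount, ← hL.net, List.countP_map]
      refine List.countP_congr fun n hn => ?_
      simp [hL.near n hn]
    · refine ⟨?_, ?_, ?_⟩ <;> intro x hx <;> simp_all
  · rintro t k ⟨⟨h1, h2, -, -, h5, h6, h7, hF⟩, hk⟩
    -- A node within `2 * σ` of the net point of `p` is within `3 * σ` of `p`, so the queue misses
    -- none of the nodes to be raised.
    have hup := hL.bump hb (by rw [hL.net]; exact hV) (nr' := t.realArr 1) fun n hn => by
      rw [h6 n]
      congr 1
      refine if_congr ⟨fun h => h.2, fun h => ⟨(hQ.mem n).2 ⟨hn, ?_⟩, h⟩⟩ rfl rfl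
      have := dist_nonneg.trans hdist
      linarith [dist_triangle (loc n) (loc b) p]
    refine ⟨⟨?_, ⟨?_, ?_, hQ.nodup, hQ.mem⟩, ?_, ?_, h1, h2, hF⟩, by omega⟩
    · rw [h5, h7]
      exact hup
    · rw [h1, hF.nat 15 (by decide)]
      exact hQ.seg
    · rw [hF.nat 15 (by decide), hF.nat 16 (by decide)]
      exact hQ.tail
    · intro n hn
      rw [h5, Function.update_of_ne hn]
    · intro n hn
      rw [h6, if_neg fun h => hn (hql n h.1), add_zero]

/-- The arrays hold the data structure of the points that are in the levels `V`. -/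
structure Store (r : ℕ) (S : ℝ) (K : ℕ) (ids : ℕ → List ℕ) (loc : ℕ → X)
    (V : ℕ → List X × List X) (s : State X) : Prop where
  tree : Tree S K ids loc (s.nat 3) (s.natArr 0) (s.natArr 1) (s.natArr 3) (s.ptArr 0)
  level : ∀ k, 1 ≤ k → k ≤ K →
    LevelOK r (S / 2 ^ k) (ids k) loc (V k) (s.realArr 0) (s.realArr 1) (s.natArr 2 k)

end UpdateSpecs
-- One step of the greedy net in memory.
section LevelSpecs

variable {X : Type u} [MetricSpace X]

theorem wp_update {r : ℕ} {S : ℝ} {K : ℕ} {ids : ℕ → List ℕ} {loc : ℕ → X}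
    {V : ℕ → List X × List X} {s : State X} {j : ℕ} {p : X} {ql : List ℕ} (hS : 0 ≤ S)
    (hj : j + 1 ≤ K) (hst : Store r S K ids loc V s)
    (hQ : NearQueue (S / 2 ^ (j + 1)) (ids (j + 1)) loc p s ql)
    (h9 : s.nat 9 = 0) (hr7 : s.real 7 = 1) (hr8 : s.real 8 = r) (hr9 : s.real 9 = 0)
    (h10 : s.nat 10 = j + 1) (hr10 : s.real 10 = S / 2 ^ (j + 1))
    (hp : s.pt 0 = some p) (hprev : s.nat 11 ∈ ids j) (hdist : dist p (loc (s.nat 11)) ≤ S / 2 ^ j)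
    (hV : (V (j + 1)).1.Nodup) (hA : ∀ y ∈ (V (j + 1)).2, y ∈ (V (j + 1)).1) :
    wp update (fun s' k =>
      (∃ ids' loc' ql', Store r S K ids' loc'
          (Function.update V (j + 1) (levelStep (S / 2 ^ (j + 1)) p (V (j + 1)))) s' ∧
        NearQueue (S / 2 ^ (j + 1)) (ids' (j + 1)) loc' p s' ql' ∧
        s'.nat 11 ∈ ids' (j + 1) ∧ dist p (loc' (s'.nat 11)) ≤ S / 2 ^ (j + 1) ∧
        loc' 1 = loc 1 ∧
        Regs [3, 11, 16, 20, 21, 22, 23, 25] [20, 21, 22, 23] s s') ∧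
      k ≤ ql.length * 29 + 60) s := by
  set σ := S / 2 ^ (j + 1) with hσdef
  have hσ : 0 ≤ σ := by positivity
  have hL := hst.level (j + 1) (by omega) hj
  have hT := hst.tree
  have hpos : ∀ n ∈ ids (j + 1), 0 < n := fun n hn => (hT.pos _ n hn).1
  have h1pos : 1 < s.nat 3 := (hT.pos 0 1 (by simp [hT.root])).2
  rw [update, wp_seq]
  simp only [Cmd.run, List.foldl, wp_seq, wp_instr, Instr.step, Option.some.injEq,
    exists_eq_left', Function.update_self]
  refine (wp_scan (loc := loc) (p := p) (ql := ql) ?_ ?_ ?_ ?_ ?_).mono ?_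
  · exact h9
  · exact hp
  · exact hQ.seg
  · exact hQ.tail
  · exact fun n hn => ⟨(hpos n ((hQ.mem n).1 hn).1).ne', hT.pt _ n ((hQ.mem n).1 hn).1⟩
  rintro t k₁ ⟨⟨hleast, htq, hF⟩, hk₁⟩
  simp only [Function.update_self, hr10] at hleast
  have hold := (hleast.of_near hQ.mem fun n hn => by linarith).oldest (hT.sorted _) hpos
  rw [hL.net] at hold
  have e10 : t.nat 10 = j + 1 := (hF.nat 10 (by decide)).trans h10
  have a0 : t.natArr 0 = s.natArr 0 := hF.natArr 0 (by decide)
  have a1 : t.natArr 1 = s.natArr 1 := hF.natArr 1 (by decide)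
  have a2 : t.natArr 2 = s.natArr 2 := hF.natArr 2 (by decide)
  have a3 : t.natArr 3 = s.natArr 3 := hF.natArr 3 (by decide)
  have ar : t.realArr = s.realArr := hF.realArr
  have ap : t.ptArr = s.ptArr := hF.ptArr
  have e3 : t.nat 3 = s.nat 3 := hF.nat 3 (by decide)
  have e9 : t.nat 9 = 0 := (hF.nat 9 (by decide)).trans h9
  have e11 : t.nat 11 = s.nat 11 := hF.nat 11 (by decide)
  have e15 : t.nat 15 = s.nat 15 := hF.nat 15 (by decide)
  have e16 : t.nat 16 = s.nat 16 := hF.nat 16 (by decide)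
  have hR : Regs [3, 16, 20, 21, 22, 23, 25] [20, 21, 22, 23] s { t with
      nat := Function.update t.nat 25 (s.natArr 2 (j + 1)) } := by
    have h1 : Frame [20, 21, 22] [20, 21] s t := by
      refine Frame.trans (s' := _) ?_ hF
      refine ⟨?_, ?_, ?_, ?_, rfl, rfl⟩ <;> intro x hx <;> simp_all
    refine h1.regs.trans (s' := t) (mn' := [25]) (mr' := []) ⟨?_, ?_, ?_⟩ <;>
      intro x hx <;> simp_all
  -- After either branch register `22` holds the net point of `p`; the net is already the new one,
  -- the assignments are still the old ones.
  have hmid : wp (.ite (.natEq 22 9) create .skip) (fun t' k =>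
      (∃ ids' loc' ql', Tree S K ids' loc' (t'.nat 3) (t'.natArr 0) (t'.natArr 1) (t'.natArr 3)
          (t'.ptArr 0) ∧
        LevelOK r σ (ids' (j + 1)) loc' ((levelStep σ p (V (j + 1))).1, (V (j + 1)).2)
          (t'.realArr 0) (t'.realArr 1) (t'.nat 25) ∧
        NearQueue σ (ids' (j + 1)) loc' p t' ql' ∧ ql'.length ≤ ql.length + 1 ∧
        t'.nat 22 ∈ ids' (j + 1) ∧ dist (loc' (t'.nat 22)) p ≤ σ ∧
        (levelStep σ p (V (j + 1))).2 = loc' (t'.nat 22) :: (V (j + 1)).2 ∧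
        (levelStep σ p (V (j + 1))).1.Nodup ∧
        (∀ i, i ≠ j + 1 → ids' i = ids i) ∧
        (∀ n, n < s.nat 3 → loc' n = loc n ∧ t'.realArr 0 n = s.realArr 0 n ∧
          t'.realArr 1 n = s.realArr 1 n) ∧
        t'.natArr 2 = s.natArr 2 ∧ Regs [3, 16, 20, 21, 22, 23, 25] [20, 21, 22, 23] s t') ∧
      k ≤ ql.length * 8 + 20) { t with nat := Function.update t.nat 25 (s.natArr 2 (j + 1)) } := by
    refine wp_ite (fun hb => ?_) fun hb => wp_skip ?_
    · simp only [Cond.Holds, Function.update_of_ne (show (22 : ℕ) ≠ 25 by decide),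
        Function.update_of_ne (show (9 : ℕ) ≠ 25 by decide), e9] at hb
      obtain ⟨-, hnone⟩ | ⟨hne, -⟩ := hold
      swap
      · exact absurd hb hne
      refine (wp_create (r := r) (S := S) (K := K) (ids := ids) (loc := loc) (V := V (j + 1))
        (j := j) (p := p) (ql := ql) hσ ?_ ?_ ⟨?_, ?_, hQ.nodup, hQ.mem⟩ ?_ ?_ ?_ ?_ ?_ ?_ ?_ hV hA
        hnone).mono ?_
      · simpa [a0, a1, a3, ap, e3] using hT
      · simpa [ar] using hL
      · simpa [htq, e15] using hQ.seg
      · simpa [e15, e16] using hQ.tail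
      · simpa using e9
      · exact (hR.real 8 (by decide)).trans hr8
      · exact (hR.real 9 (by decide)).trans hr9
      · exact (hR.real 10 (by decide)).trans hr10
      · exact (hR.pt 0 (by decide) (by decide)).trans hp
      · simpa [e11] using hprev
      · simpa [e11] using hdist
      · rintro u k ⟨⟨g1, g2, g3, g4, g5, g6, g7, gR⟩, hk⟩
        simp only [Function.update_of_ne (show (3 : ℕ) ≠ 25 by decide), e3] at g1 g2 g3 g4 g5 g6
        have hstep : levelStep σ p (V (j + 1)) = (p :: (V (j + 1)).1, p :: (V (j + 1)).2) := by
          rw [levelStep, hnone]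
        rw [hstep]
        refine ⟨⟨_, _, ql ++ [s.nat 3], g1, ?_, ?_, by simp, ?_, ?_, ?_, ?_, ?_, ?_, ?_, hR.trans gR⟩, by omega⟩
        · simpa using g2
        · simpa using g3
        · simp [g4]
        · simpa [g4] using hσ
        · simp [g4]
        · refine List.nodup_cons.2 ⟨fun hm => ?_, hV⟩
          have := oldest_eq_none.1 hnone p hm
          rw [dist_self] at this
          linarith
        · intro i hi
          simp [hi]
        · intro n hn
          refine ⟨Function.update_of_ne hn.ne _ _, ?_, ?_⟩
          · rw [g5 n hn.ne, ar]
          · rw [g6 n hn.ne, ar]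
        · rw [g7, a2]
    · simp only [Cond.Holds, Function.update_of_ne (show (22 : ℕ) ≠ 25 by decide),
        Function.update_of_ne (show (9 : ℕ) ≠ 25 by decide), e9] at hb
      obtain ⟨h0, -⟩ | ⟨-, hbl, hbd, hsome⟩ := hold
      · exact absurd h0 hb
      have hstep : levelStep σ p (V (j + 1)) =
          ((V (j + 1)).1, loc (t.nat 22) :: (V (j + 1)).2) := by
        rw [levelStep, hsome]
      rw [hstep]
      refine ⟨⟨ids, loc, ql, ?_, ?_, ⟨?_, ?_, hQ.nodup, hQ.mem⟩, by omega, ?_, ?_, ?_, hV,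
        fun _ _ => rfl, fun n _ => ⟨rfl, ?_, ?_⟩, a2, hR⟩, by omega⟩
      · simpa [a0, a1, a3, ap, e3] using hT
      · simpa [ar] using hL
      · simpa [htq, e15] using hQ.seg
      · simpa [e15, e16] using hQ.tail
      · simpa using hbl
      · simpa using hbd
      · simp
      · simp [ar]
      · simp [ar]
  simp only [e10, a2]
  refine hmid.mono ?_
  rintro u k₂ ⟨⟨ids', loc', ql', g1, g2, g3, g4, g5, g6, g7, g8, g9, g10, g11, gR⟩, hk₂⟩
  refine (wp_assign (r := r) g2 g3 (fun n hn => g1.pt _ n hn)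
    ((gR.real 7 (by decide)).trans hr7) ((gR.real 8 (by decide)).trans hr8)
    ((gR.real 10 (by decide)).trans hr10) g5 g6
    ((g1.sorted _).imp fun h => h.ne') g8).mono ?_
  rintro v k₃ ⟨⟨f1, f2, f3, f4, f5, f6, fR⟩, hk₃⟩
  have w22 : v.nat 22 = u.nat 22 := fR.nat 22 (by decide)
  have w10 : v.nat 10 = j + 1 :=
    (fR.nat 10 (by decide)).trans ((gR.nat 10 (by decide)).trans h10)
  have w3 : v.nat 3 = u.nat 3 := fR.nat 3 (by decide)
  refine ⟨⟨ids', loc', ql', ⟨?_, ?_⟩, ⟨?_, ?_, f2.nodup, f2.mem⟩, ?_, ?_, ?_, ?_⟩, ?_⟩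
  · simpa [w3, f5, f6] using g1
  · intro i hi hi'
    by_cases hij : i = j + 1
    · subst hij
      simp only [Function.update_self, w10]
      rw [← g7] at f1
      exact f1
    · have hlt : ∀ n ∈ ids i, n < s.nat 3 := fun n hn => (hT.pos i n hn).2
      -- Different levels have different nodes, so the counters of the other levels are untouched.
      have hnot : ∀ n ∈ ids i, n ∉ ids' (j + 1) := fun n hn hn' =>
        hij (g1.disj i (j + 1) n (by rw [g9 i hij]; exact hn) hn')
      simp only [Function.update_of_ne hij, w10, Function.update_self, f5, g11, g9 i hij]
      refine (hst.level i hi hi').congr (fun n hn => (g10 n (hlt n hn)).1) (fun n hn => ?_)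
        fun n hn => ?_
      · rw [f3 n fun h => hnot n hn (h ▸ g5), (g10 n (hlt n hn)).2.1]
      · rw [f4 n (hnot n hn), (g10 n (hlt n hn)).2.2]
  · simpa using f2.seg
  · simpa using f2.tail
  · simpa [w22] using g5
  · rw [dist_comm]
    simpa [w22] using g6
  · exact (g10 1 h1pos).1
  · have h1 : Regs [3, 11, 16, 20, 21, 22, 23, 25] [20, 21, 22, 23] s v := gR.mono.trans fR
    refine h1.trans (s' := v) (mn' := [11]) (mr' := []) ⟨?_, ?_, ?_⟩ <;> intro x hx <;> simp_all
  · omega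

end LevelSpecs
-- Programs that descend through all levels.
section LoopPrograms

/-- Put the root into the queue. -/
def start : Cmd :=
  .run [.natConst 10 0, .realCopy 10 2, .natConst 11 1, .natConst 15 0, .natConst 16 1,
    .natStore 10 15 11]

/-- Go to the next level. -/
def nextLevel : Cmd :=
  .seq (.run [.natSucc 10 10, .realHalf 10 10]) descend

/-- Find the nodes near the point at the level in register `12`. -/
def locate : Cmd :=
  .seq start <| .while (.natLt 10 12) nextLevel

/-- Add the point to the data structure. -/
def insertCore : Cmd :=
  .seq start <| .while (.natLt 10 2) (.seq nextLevel update)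

end LoopPrograms

/-! ### Correctness and cost of the descent. -/

section LoopSpecs

variable {X : Type u} [MetricSpace X]

/-- The nodes of one level are far from each other. -/
def Sparse (S : ℝ) (K : ℕ) (ids : ℕ → List ℕ) (loc : ℕ → X) : Prop :=
  ∀ k ≤ K, ((ids k).map loc).Pairwise fun x y => S / 2 ^ k < dist x y

/-- A bound for the number of nodes in a small ball. -/
def packing (d : ℝ) : ℕ := ⌊((2 : ℝ) ^ d) ^ 3⌋₊

/-- Three halvings lead from `8 * σ` to the separation `σ`, hence the exponent 3 in `packing`. -/
theorem length_le_packing {d : ℝ} (hX : DoublingDimLE X d) {σ : ℝ} (hσ : 0 < σ)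
    {l ql : List ℕ} {loc : ℕ → X} (hl : (l.map loc).Pairwise fun x y => σ < dist x y)
    (hnd : ql.Nodup) (hql : ∀ n ∈ ql, n ∈ l)
    (hdist : ∀ m ∈ ql, ∀ n ∈ ql, dist (loc m) (loc n) ≤ 8 * σ) : ql.length ≤ packing d := by
  have hN : (l.map loc).Nodup := hl.imp fun {a b} h => by
    rintro rfl
    rw [dist_self] at h
    linarith
  have : Std.Symm fun x y : X => x ≠ y → σ < dist x y :=
    ⟨fun x y h h' => by rw [dist_comm]; exact h h'.symm⟩
  have hsep : ∀ x ∈ l.map loc, ∀ y ∈ l.map loc, x ≠ y → σ < dist x y :=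
    fun x hx y hy => List.Pairwise.forall_of_forall (R := fun x y : X => x ≠ y → σ < dist x y)
      (by simp) (hl.imp fun {a b : X} (h : σ < dist a b) (_ : a ≠ b) => h) hx hy
  have hinj := List.inj_on_of_nodup_map hN
  have h1 : (ql.map loc).Nodup :=
    List.Nodup.map_on (fun m hm n hn hmn => hinj (hql m hm) (hql n hn) hmn) hnd
  have h2 : ∀ x ∈ ql.map loc, x ∈ l.map loc := fun x hx => by
    obtain ⟨n, hn, rfl⟩ := List.mem_map.1 hx
    exact List.mem_map_of_mem (hql n hn)
  have := hX.length_le 3 hσ h1 (fun x hx y hy => ?_) fun x hx y hy hxy => ?_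
  · simpa [packing] using this
  · obtain ⟨m, hm, rfl⟩ := List.mem_map.1 hx
    obtain ⟨n, hn, rfl⟩ := List.mem_map.1 hy
    exact (hdist m hm n hn).trans (by linarith)
  · by_contra hne
    exact absurd hxy (not_le.2 (hsep x (h2 x hx) y (h2 y hy) hne))

theorem NearQueue.length_le {d : ℝ} (hX : DoublingDimLE X d) {σ : ℝ} (hσ : 0 < σ)
    {l ql : List ℕ} {loc : ℕ → X} {p : X} {s : State X} (h : NearQueue σ l loc p s ql)
    (hl : (l.map loc).Pairwise fun x y => σ < dist x y) : ql.length ≤ packing d := by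
  refine length_le_packing hX hσ hl h.nodup (fun n hn => ((h.mem n).1 hn).1) fun m hm n hn => ?_
  linarith [dist_triangle_right (loc m) (loc n) p, ((h.mem m).1 hm).2, ((h.mem n).1 hn).2]

/-- Packing bounds the queue, whose nodes lie in a ball of four scales, and every child list, whose
nodes lie within one scale of the parent, that is, two scales of their own level. -/
theorem wp_nextLevel {d : ℝ} (hX : DoublingDimLE X d) {S : ℝ} (hS : 0 < S) {K : ℕ}
    {ids : ℕ → List ℕ} {loc : ℕ → X} {s : State X} {k : ℕ} {p : X} {ql : List ℕ}
    (hT : Tree S K ids loc (s.nat 3) (s.natArr 0) (s.natArr 1) (s.natArr 3) (s.ptArr 0))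
    (hsp : Sparse S K ids loc) (hk : k < K)
    (hQ : NearQueue (S / 2 ^ k) (ids k) loc p s ql)
    (h9 : s.nat 9 = 0) (h10 : s.nat 10 = k) (hr10 : s.real 10 = S / 2 ^ k)
    (hp : s.pt 0 = some p) :
    wp nextLevel (fun s' n =>
      (∃ ql', NearQueue (S / 2 ^ (k + 1)) (ids (k + 1)) loc p s' ql' ∧ s'.nat 10 = k + 1 ∧
        s'.real 10 = S / 2 ^ (k + 1) ∧ Frame [10, 15, 16, 17, 20, 21] [10, 20, 21] s s') ∧
      n ≤ packing d * (packing d * 8 + 5) + 6) s := by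
  have hσ : 0 < S / 2 ^ k := by positivity
  have hhalf : S / 2 ^ k / 2 = S / 2 ^ (k + 1) := by rw [pow_succ, div_div]
  have hσ' : 0 < S / 2 ^ (k + 1) := by positivity
  have hlen := hQ.length_le hX hσ (hsp k hk.le)
  set ch : ℕ → List ℕ := fun n => (ids (k + 1)).filter fun c => s.natArr 3 c = n with hch
  have hchmem : ∀ n c, c ∈ ch n ↔ c ∈ ids (k + 1) ∧ s.natArr 3 c = n := by simp [hch]
  have hnd : (ids (k + 1)).Nodup := (hT.sorted _).imp fun h => h.ne'
  have hchlen : ∀ n, (ch n).length ≤ packing d := by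
    intro n
    refine length_le_packing hX hσ' (hsp (k + 1) hk) (hnd.filter _)
      (fun c hc => ((hchmem n c).1 hc).1) fun c hc c' hc' => ?_
    obtain ⟨h1, h2⟩ := (hchmem n c).1 hc
    obtain ⟨h1', h2'⟩ := (hchmem n c').1 hc'
    have e := (hT.parent k hk c h1).2
    have e' := (hT.parent k hk c' h1').2
    rw [h2] at e
    rw [h2'] at e'
    linarith [dist_triangle_right (loc c) (loc c') (loc n)]
  rw [nextLevel, wp_seq]
  simp only [Cmd.run, List.foldl, wp_seq, wp_instr, Instr.step, Option.some.injEq,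
    exists_eq_left', h10, hr10, hhalf]
  refine (wp_descend (loc := loc) (p := p) (ql := ql) (ch := ch) (M := packing d)
    ?_ ?_ ?_ ?_ fun n hn => ⟨?_, hchlen n, fun c hc => ?_⟩).mono ?_
  · simpa using h9
  · exact hp
  · simpa using hQ.seg
  · simpa using hQ.tail
  · exact hT.child k hk n ((hQ.mem n).1 hn).1
  · exact hT.pt _ c ((hchmem n c).1 hc).1
  · rintro t n ⟨⟨h1, h2, hF⟩, hn⟩
    simp only [Function.update_self] at h1 h2
    refine ⟨⟨_, ⟨h1, h2, ?_, ?_⟩, ?_, ?_, ?_⟩, ?_⟩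
    · refine List.Nodup.filter _ (List.nodup_flatMap.2 ⟨fun n _ => hnd.filter _, ?_⟩)
      refine hQ.nodup.imp fun {a b} hab => List.disjoint_left.2 fun c hc hc' => hab ?_
      rw [← ((hchmem a c).1 hc).2, ((hchmem b c).1 hc').2]
    · intro c
      simp only [List.mem_filter, List.mem_flatMap, decide_eq_true_eq]
      constructor
      · rintro ⟨⟨m, -, hc⟩, hcp⟩
        exact ⟨((hchmem m c).1 hc).1, hcp⟩
      · rintro ⟨hc, hcp⟩
        obtain ⟨g1, g2⟩ := hT.parent k hk c hc
        -- Four scales of the next level are two of this one; the parent is one scale further, so it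
        -- is within three scales of `p` and in the queue.
        refine ⟨⟨_, (hQ.mem _).2 ⟨g1, ?_⟩, (hchmem _ c).2 ⟨hc, rfl⟩⟩, hcp⟩
        rw [dist_comm] at g2
        linarith [dist_triangle (loc (s.natArr 3 c)) (loc c) p]
    · exact (hF.nat 10 (by decide)).trans (by simp)
    · exact (hF.real 10 (by decide)).trans (by simp)
    · refine Frame.trans (s' := _) ?_ hF
      refine ⟨?_, ?_, ?_, ?_, rfl, rfl⟩ <;> intro x hx <;> simp_all
    · have := Nat.mul_le_mul_right (packing d * 8 + 5) hlen
      omega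

theorem wp_start {S : ℝ} {ids : ℕ → List ℕ} {loc : ℕ → X} {s : State X} {p : X} (hS : 0 < S)
    (hroot : ids 0 = [1]) (h2 : s.real 2 = S) (hp : dist (loc 1) p ≤ S) :
    wp start (fun t n =>
      (NearQueue (S / 2 ^ 0) (ids 0) loc p t [1] ∧ t.nat 10 = 0 ∧ t.nat 11 = 1 ∧
        t.real 10 = S / 2 ^ 0 ∧ Frame [10, 11, 15, 16] [10] s t) ∧ n = 6) s := by
  simp only [start, Cmd.run, List.foldl, wp_seq, wp_instr, Instr.step, Option.some.injEq,
    exists_eq_left', and_true]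
  refine ⟨⟨?_, ?_, by simp, ?_⟩, ?_, ?_, ?_, ?_⟩
  · intro i hi
    simp at hi
    simp [hi]
  · simp
  · intro n
    simp only [hroot, List.mem_singleton]
    refine ⟨?_, fun h => h.1⟩
    rintro rfl
    exact ⟨rfl, by linarith [show S / 2 ^ 0 = S by simp]⟩
  · simp
  · simp
  · simp [h2]
  · refine ⟨?_, ?_, ?_, ?_, rfl, rfl⟩ <;> intro x hx <;> simp_all

theorem wp_locate {d : ℝ} (hX : DoublingDimLE X d) {S : ℝ} (hS : 0 < S) {K : ℕ}
    {ids : ℕ → List ℕ} {loc : ℕ → X} {s : State X} {p : X} {j : ℕ}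
    (hT : Tree S K ids loc (s.nat 3) (s.natArr 0) (s.natArr 1) (s.natArr 3) (s.ptArr 0))
    (hsp : Sparse S K ids loc) (hj : j ≤ K) (h9 : s.nat 9 = 0) (h12 : s.nat 12 = j)
    (h2 : s.real 2 = S) (hp : s.pt 0 = some p) (hdist : dist (loc 1) p ≤ S) :
    wp locate (fun t n =>
      (∃ ql, NearQueue (S / 2 ^ j) (ids j) loc p t ql ∧ t.real 10 = S / 2 ^ j ∧
        Frame [10, 11, 15, 16, 17, 20, 21] [10, 20, 21] s t) ∧
      n ≤ j * (packing d * (packing d * 8 + 5) + 7) + 7) s := by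
  rw [locate, wp_seq]
  refine (wp_start hS hT.root h2 hdist).mono ?_
  rintro t _ ⟨⟨hQ, h10, -, hr10, hF⟩, rfl⟩
  refine (wp_while (fun n t => ∃ k ql, k + n = j ∧ NearQueue (S / 2 ^ k) (ids k) loc p t ql ∧
    t.nat 10 = k ∧ t.real 10 = S / 2 ^ k ∧
    Frame [10, 11, 15, 16, 17, 20, 21] [10, 20, 21] s t)
    (packing d * (packing d * 8 + 5) + 6) ?_ ?_ (n := j)
    ⟨0, [1], by omega, hQ, h10, hr10, hF.mono⟩).mono ?_
  · rintro n t ⟨k, ql, hkn, hQ, h10, hr10, hF⟩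
    have e12 := (hF.nat 12 (by decide)).trans h12
    refine ⟨by simp only [Cond.Holds]; omega, ?_⟩
    refine (wp_nextLevel hX hS (K := K) (loc := loc) (p := p) ?_ hsp (by omega) hQ
      ((hF.nat 9 (by decide)).trans h9) h10 hr10 ((hF.pt 0 (by decide)).trans hp)).mono ?_
    · rw [hF.nat 3 (by decide), hF.natArr 0 (by decide), hF.natArr 1 (by decide),
        hF.natArr 3 (by decide), hF.ptArr]
      exact hT
    · rintro u m ⟨⟨ql', g1, g2, g3, g4⟩, hm⟩
      exact ⟨⟨k + 1, ql', by omega, g1, g2, g3, hF.trans g4⟩, hm⟩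
  · rintro t ⟨k, ql, hkn, hQ, h10, hr10, hF⟩
    have e12 := (hF.nat 12 (by decide)).trans h12
    simp only [Cond.Holds]
    omega
  · rintro u m ⟨⟨k, ql, hkn, hQ, h10, hr10, hF⟩, hm⟩
    obtain rfl : k = j := by omega
    refine ⟨⟨ql, hQ, hr10, hF⟩, ?_⟩
    change m ≤ k * (packing d * (packing d * 8 + 5) + 7) + 1 at hm
    omega

/-- The list `D` may depend on the level because in the middle of an insertion only the upper levels
contain the new point. -/
theorem Store.sparse {r : ℕ} {S : ℝ} {K : ℕ} {ids : ℕ → List ℕ} {loc : ℕ → X}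
    {D : ℕ → List X} {s : State X}
    (h : Store r S K ids loc (fun k => RGather.level (S / 2 ^ k) (D k)) s) : Sparse S K ids loc := by
  intro k hk
  rcases Nat.eq_zero_or_pos k with rfl | h0
  · simp [h.tree.root]
  · rw [(h.level k h0 hk).net]
    exact level_separated _ _

theorem Store.congr {r : ℕ} {S : ℝ} {K : ℕ} {ids : ℕ → List ℕ} {loc : ℕ → X}
    {V V' : ℕ → List X × List X} {s s' : State X} (h : Store r S K ids loc V s)
    (hV : ∀ k, 1 ≤ k → k ≤ K → V' k = V k) (h3 : s'.nat 3 = s.nat 3)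
    (hn : ∀ a, a ≠ 10 → s'.natArr a = s.natArr a) (hr : s'.realArr = s.realArr)
    (hp : s'.ptArr = s.ptArr) : Store r S K ids loc V' s' where
  tree := by
    rw [h3, hn 0 (by decide), hn 1 (by decide), hn 3 (by decide), hp]
    exact h.tree
  level k hk hk' := by
    rw [hV k hk hk', hn 2 (by decide), hr]
    exact h.level k hk hk'

/-- A bound for the number of steps at one level. -/
def levelCost (d : ℝ) : ℕ := packing d * (packing d * 8 + 34) + 67

theorem wp_insertCore {d : ℝ} (hX : DoublingDimLE X d) {r : ℕ} {S : ℝ} (hS : 0 < S) {K : ℕ}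
    {ids : ℕ → List ℕ} {loc : ℕ → X} {s : State X} {p : X} {D : List X}
    (hst : Store r S K ids loc (fun k => level (S / 2 ^ k) D) s)
    (h9 : s.nat 9 = 0) (h2 : s.nat 2 = K) (hr7 : s.real 7 = 1) (hr8 : s.real 8 = r)
    (hr9 : s.real 9 = 0) (hr2 : s.real 2 = S) (hp : s.pt 0 = some p)
    (hdist : dist (loc 1) p ≤ S) :
    wp insertCore (fun t n =>
      (∃ ids' loc', Store r S K ids' loc' (fun k => level (S / 2 ^ k) (p :: D)) t ∧
        loc' 1 = loc 1 ∧
        Regs [3, 10, 11, 15, 16, 17, 20, 21, 22, 23, 25] [10, 20, 21, 22, 23] s t) ∧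
      n ≤ K * levelCost d + 7) s := by
  rw [insertCore, wp_seq]
  refine (wp_start hS hst.tree.root hr2 hdist).mono ?_
  rintro t _ ⟨⟨hQ, h10, h11, hr10, hF⟩, rfl⟩
  -- The levels up to `k` contain the new point, the others do not yet. Register `11` holds a node
  -- of level `k` covering it, the parent in case a node is created at the next level.
  refine (wp_while (fun n t => ∃ k ids' loc' ql, k + n = K ∧
    Store r S K ids' loc' (fun i => level (S / 2 ^ i) (if i ≤ k then p :: D else D)) t ∧
    NearQueue (S / 2 ^ k) (ids' k) loc' p t ql ∧
    t.nat 10 = k ∧ t.real 10 = S / 2 ^ k ∧ t.nat 11 ∈ ids' k ∧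
    dist p (loc' (t.nat 11)) ≤ S / 2 ^ k ∧ loc' 1 = loc 1 ∧
    Regs [3, 10, 11, 15, 16, 17, 20, 21, 22, 23, 25] [10, 20, 21, 22, 23] s t)
    (packing d * (packing d * 8 + 34) + 66) ?_ ?_ (n := K)
    ⟨0, ids, loc, [1], by omega, ?_, hQ, h10, hr10, ?_, ?_, rfl, hF.regs⟩).mono ?_
  · rintro n t ⟨k, ids', loc', ql, hkn, hst', hQ, h10, hr10, h11, hd11, hloc, hR⟩
    have e2 := (hR.nat 2 (by decide)).trans h2
    refine ⟨by simp only [Cond.Holds]; omega, ?_⟩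
    rw [wp_seq]
    refine (wp_nextLevel hX hS hst'.tree hst'.sparse (by omega) hQ
      ((hR.nat 9 (by decide)).trans h9) h10 hr10
      ((hR.pt 0 (by decide) (by decide)).trans hp)).mono ?_
    rintro u m ⟨⟨ql', g1, g2, g3, gF⟩, hm⟩
    have hRu : Regs [3, 10, 11, 15, 16, 17, 20, 21, 22, 23, 25] [10, 20, 21, 22, 23] s u :=
      hR.trans (gF.regs (mn := [10, 15, 16, 17, 20, 21]) (mr := [10, 20, 21]))
    have hstu : Store r S K ids' loc'
        (fun i => level (S / 2 ^ i) (if i ≤ k then p :: D else D)) u :=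
      hst'.congr (fun _ _ _ => rfl) (gF.nat 3 (by decide)) gF.natArr gF.realArr gF.ptArr
    have hlen := g1.length_le hX (by positivity) (hstu.sparse (k + 1) (by omega))
    refine (wp_update hS.le (by omega) hstu g1 ((hRu.nat 9 (by decide)).trans h9)
      ((hRu.real 7 (by decide)).trans hr7) ((hRu.real 8 (by decide)).trans hr8)
      ((hRu.real 9 (by decide)).trans hr9) g2 g3
      ((hRu.pt 0 (by decide) (by decide)).trans hp) ?_ ?_ ?_ ?_).mono ?_
    · rw [gF.nat 11 (by decide)]
      exact h11
    · rw [gF.nat 11 (by decide)]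
      exact hd11
    · refine (level_separated _ _).imp fun {a b} h => ?_
      rintro rfl
      rw [dist_self] at h
      exact absurd h (not_lt.2 (by positivity))
    · exact fun y hy => mem_level_of_mem_snd (by positivity) hy
    · rintro v m' ⟨⟨ids'', loc'', ql'', f1, f2, f3, f4, f5, f6⟩, hm'⟩
      refine ⟨⟨k + 1, ids'', loc'', ql'', by omega, ?_, f2, (f6.nat 10 (by decide)).trans g2,
        (f6.real 10 (by decide)).trans g3, f3, f4, f5.trans hloc, hRu.trans f6⟩, ?_⟩
      · refine f1.congr (fun i _ _ => ?_) rfl (fun _ _ => rfl) rfl rfl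
        by_cases hi : i = k + 1
        · subst hi
          simp [level_cons]
        · simp only [Function.update_of_ne hi]
          congr 1
          refine if_congr ?_ rfl rfl
          omega
      · have e : packing d * (packing d * 8 + 34) =
            packing d * (packing d * 8 + 5) + packing d * 29 := by ring
        omega
  · rintro t ⟨k, ids', loc', ql, hkn, -, -, h10, -, -, -, -, hR⟩
    have e2 := (hR.nat 2 (by decide)).trans h2
    simp only [Cond.Holds]
    omega
  · refine hst.congr (fun i hi _ => ?_) (hF.nat 3 (by decide)) hF.natArr hF.realArr hF.ptArr
    rw [if_neg (by omega)]
  · rw [h11, hst.tree.root]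
    simp
  · rw [h11, dist_comm]
    simpa using hdist
  · rintro u m ⟨⟨k, ids', loc', ql, hkn, hst', -, -, -, -, -, hloc, hR⟩, hm⟩
    refine ⟨⟨ids', loc', ?_, hloc, hR⟩, ?_⟩
    · refine hst'.congr (fun i _ hi => ?_) rfl (fun _ _ => rfl) rfl rfl
      rw [if_pos (by omega)]
    · change m ≤ K * levelCost d + 1 at hm
      omega

end LoopSpecs
-- The programs of the three operations.
section Operations

/-- The scales of the levels are computed, and the first point is added. -/
def init : Cmd :=
  -- Starting at 5 and adding 2 for every doubling makes register `2` equal to `depth Δ`; real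
  -- register `2` becomes `topScale` after three further doublings.
  .seq (.run [.realOfNat 7 8, .realOfNat 8 0, .realCopy 2 20, .realCopy 21 7, .natConst 2 5]) <|
  .seq (.while (.realLt 21 1)
    (.run [.realAdd 21 21 21, .realAdd 2 2 2, .natSucc 2 2, .natSucc 2 2])) <|
  .seq (.run [.realAdd 2 2 2, .realAdd 2 2 2, .realAdd 2 2 2, .natConst 11 1, .ptStore 0 11 1,
    .natConst 3 2, .natConst 1 2, .ptCopy 2 0, .ptCopy 0 1]) <|
  .seq insertCore <|
  .run [.ptCopy 0 2]

/-- Add the point unless it has been added before. -/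
def insertNew : Cmd :=
  .seq (.run [.natCopy 12 2]) <|
  .seq locate <|
  .seq (.run [.realCopy 20 9]) <|
  .seq scan <|
  .ite (.natEq 22 9) insertCore .skip

/-- The program for an insertion. -/
def insertPoint : Cmd :=
  .seq (.run [.natConst 8 1]) <|
  .ite (.natEq 1 9) (.run [.ptCopy 1 0, .realCopy 1 0, .natCopy 1 8]) <|
  .seq (.ite (.natEq 1 8) (.seq (.run [.distance 20 0 1]) (.ite (.realLt 9 20) init .skip))
    .skip) <|
  .ite (.natEq 1 8) .skip insertNew

/-- Find the center of the point if there are at least two points and `r` is not `1`. -/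
def findCenter : Cmd :=
  .seq (.run [.natConst 10 1, .natLoad 12 2 10]) <|
  .seq (.while (.natEq 12 9) (.run [.natSucc 10 10, .natLoad 12 2 10])) <|
  -- The solution level is four above the first bad one.
  .seq (.run [.natPred 12 10, .natPred 12 12, .natPred 12 12, .natPred 12 12]) <|
  .seq locate <|
  .seq (.run [.realCopy 0 10, .realHalf 20 10]) <|
  .seq scan <|
  .seq (.ite (.natEq 22 9) (.seq (.run [.realCopy 20 10]) scan) .skip) <|
  .run [.ptLoad 0 0 22]

/-- The program for a query with a point. -/
def queryPoint : Cmd :=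
  .seq (.run [.natConst 8 1]) <|
  .ite (.natEq 1 9) .skip <|
  .ite (.natEq 0 8) (.run [.realCopy 0 9]) <|
  .ite (.natEq 1 8) .skip findCenter

/-- The algorithm. -/
def algorithm : Algorithm where
  insert := insertPoint
  -- A radius query is a point query for the first inserted point.
  queryRadius := .seq (.run [.ptCopy 0 1]) queryPoint
  queryCenter := queryPoint

end Operations

/-! ### The state with at least two points, and the search for a center. -/

section OperationSpecs

variable {X : Type u} [MetricSpace X]

theorem level_eq_singleton {s : ℝ} (D : List X) (p₀ : X)
    (h : ∀ x ∈ D, dist p₀ x ≤ s) : (level s (D ++ [p₀])).1 = [p₀] := by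
  induction D with
  | nil => simp [level, levelStep, oldest]
  | cons p D ih =>
    rw [List.cons_append, level_cons, levelStep, ih fun x hx => h x (by simp [hx])]
    have : oldest s [p₀] p = some p₀ := by simp [oldest, h p (by simp)]
    rw [this]

/-- The state when there are points at several places. -/
structure Active (r : ℕ) (S : ℝ) (K : ℕ) (D : List X) (p₀ : X) (ids : ℕ → List ℕ) (loc : ℕ → X)
    (s : State X) : Prop where
  nat0 : s.nat 0 = r
  nat1 : s.nat 1 = 2
  nat2 : s.nat 2 = K
  nat9 : s.nat 9 = 0
  real2 : s.real 2 = S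
  real7 : s.real 7 = 1
  real8 : s.real 8 = r
  real9 : s.real 9 = 0
  pt1 : s.pt 1 = some p₀
  loc1 : loc 1 = p₀
  last : ∃ D', D = D' ++ [p₀]
  store : Store r S K ids loc (fun k => level (S / 2 ^ k) D) s

/-- The exempt registers are the constant 1, set anew by each insertion and point query, and the
answer. -/
theorem Active.frame {r : ℕ} {S : ℝ} {K : ℕ} {D : List X} {p₀ : X} {ids : ℕ → List ℕ}
    {loc : ℕ → X} {s s' : State X} (h : Active r S K D p₀ ids loc s)
    (hn : ∀ x < 10, x ≠ 8 → s'.nat x = s.nat x)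
    (hr : ∀ x < 10, x ≠ 0 → s'.real x = s.real x)
    (hp : s'.pt 1 = s.pt 1) (hna : ∀ a, a ≠ 10 → s'.natArr a = s.natArr a)
    (hra : s'.realArr = s.realArr) (hpa : s'.ptArr = s.ptArr) :
    Active r S K D p₀ ids loc s' where
  nat0 := (hn 0 (by decide) (by decide)).trans h.nat0
  nat1 := (hn 1 (by decide) (by decide)).trans h.nat1
  nat2 := (hn 2 (by decide) (by decide)).trans h.nat2
  nat9 := (hn 9 (by decide) (by decide)).trans h.nat9
  real2 := (hr 2 (by decide) (by decide)).trans h.real2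
  real7 := (hr 7 (by decide) (by decide)).trans h.real7
  real8 := (hr 8 (by decide) (by decide)).trans h.real8
  real9 := (hr 9 (by decide) (by decide)).trans h.real9
  pt1 := hp.trans h.pt1
  loc1 := h.loc1
  last := h.last
  store := h.store.congr (fun _ _ _ => rfl) (hn 3 (by decide) (by decide)) hna hra hpa

theorem Active.mem {r : ℕ} {S : ℝ} {K : ℕ} {D : List X} {p₀ : X} {ids : ℕ → List ℕ}
    {loc : ℕ → X} {s : State X} (h : Active r S K D p₀ ids loc s) : p₀ ∈ D := by
  obtain ⟨D', rfl⟩ := h.last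
  simp

/-- Level 0 has no counters and is not covered by `Store.level`. Its net is the oldest point alone
because the scale is at least the diameter. -/
theorem Active.net {r : ℕ} {S : ℝ} {K : ℕ} {D : List X} {p₀ : X} {ids : ℕ → List ℕ}
    {loc : ℕ → X} {s : State X} (h : Active r S K D p₀ ids loc s)
    (hdiam : ∀ x ∈ D, ∀ y ∈ D, dist x y ≤ S) {j : ℕ} (hj : j ≤ K) :
    (ids j).map loc = (level (S / 2 ^ j) D).1 := by
  rcases Nat.eq_zero_or_pos j with rfl | h0
  · obtain ⟨D', rfl⟩ := h.last
    rw [h.store.tree.root, pow_zero, div_one,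
      level_eq_singleton D' p₀ (fun x hx => hdiam _ (by simp) _ (by simp [hx]))]
    simp [h.loc1]
  · exact (h.store.level j h0 hj).net

theorem wp_scan_near {σ t : ℝ} {S : ℝ} {K : ℕ} {ids : ℕ → List ℕ} {loc : ℕ → X} {s : State X}
    {p : X} {ql : List ℕ} {j : ℕ} {d : ℝ} (hX : DoublingDimLE X d) (hσ : 0 < σ)
    (hl : ((ids j).map loc).Pairwise fun x y => σ < dist x y)
    (hT : Tree S K ids loc (s.nat 3) (s.natArr 0) (s.natArr 1) (s.natArr 3) (s.ptArr 0))
    (hQ : NearQueue σ (ids j) loc p s ql) (h9 : s.nat 9 = 0) (hp : s.pt 0 = some p)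
    (h20 : s.real 20 = t) (ht : t ≤ 4 * σ) :
    wp scan (fun s' k =>
      (((s'.nat 22 = 0 ∧ oldest t ((ids j).map loc) p = none) ∨
        (s'.nat 22 ≠ 0 ∧ s'.ptArr 0 (s'.nat 22) = some (loc (s'.nat 22)) ∧
          oldest t ((ids j).map loc) p = some (loc (s'.nat 22)))) ∧
        NearQueue σ (ids j) loc p s' ql ∧ Frame [20, 21, 22] [21] s s') ∧
      k ≤ packing d * 9 + 3) s := by
  have hpos : ∀ n ∈ ids j, 0 < n := fun n hn => (hT.pos _ n hn).1
  have hmem := hQ.mem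
  refine (wp_scan (loc := loc) (p := p) (ql := ql) h9 hp hQ.seg hQ.tail fun n hn =>
    ⟨(hpos n ((hmem n).1 hn).1).ne', hT.pt _ n ((hmem n).1 hn).1⟩).mono ?_
  rintro u k ⟨⟨h1, h2, hF⟩, hk⟩
  rw [h20] at h1
  have hold := (h1.of_near hmem fun n hn => hn.trans ht).oldest (hT.sorted _) hpos
  have hlen := hQ.length_le hX hσ hl
  refine ⟨⟨hold.imp_right fun h => ⟨h.1, ?_, h.2.2.2⟩, ⟨?_, ?_, hQ.nodup, hmem⟩, hF⟩, by omega⟩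
  · rw [hF.ptArr]
    exact hT.pt _ _ h.2.1
  · rw [h2, hF.nat 15 (by decide)]
    exact hQ.seg
  · rw [hF.nat 15 (by decide), hF.nat 16 (by decide)]
    exact hQ.tail

/-- A bound for the number of steps of every operation. -/
def opCost (d Δ : ℝ) : ℕ := 4 * ((depth Δ + 1) * levelCost d)

theorem levelCost_ge (d : ℝ) : 34 * packing d + 67 ≤ levelCost d := by
  have : packing d * (packing d * 8 + 34) = 8 * (packing d * packing d) + 34 * packing d := by ring
  unfold levelCost
  omega

/-- With fewer than `r` points the first bad level may be above level 4; the truncated subtraction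
then yields level 0, and the program still halts within the bound. -/
theorem wp_findCenter {d : ℝ} (hX : DoublingDimLE X d) {r : ℕ} (hr : 2 ≤ r) {S : ℝ} (hS : 0 < S)
    {K : ℕ} (hK : 1 ≤ K) {D : List X} {p₀ : X} {ids : ℕ → List ℕ} {loc : ℕ → X} {s : State X}
    (h : Active r S K D p₀ ids loc s) (hD : D.Nodup)
    (hdiam : ∀ x ∈ D, ∀ y ∈ D, dist x y ≤ S)
    (hmin : ∀ x ∈ D, ∀ y ∈ D, dist x y ≤ 3 * (S / 2 ^ K) → x = y)
    {q : X} (hq : q ∈ D) (hp : s.pt 0 = some q) :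
    wp findCenter (fun t n => (Active r S K D p₀ ids loc t ∧ t.real 0 = solScale r S D ∧
      t.pt 0 = some (solCenter r S D q)) ∧
      n ≤ K * (packing d * (packing d * 8 + 5) + 10) + packing d * 18 + 30) s := by
  have hne : D ≠ [] := List.ne_nil_of_mem hq
  obtain ⟨f1, f2, f3, f4⟩ := firstBad_spec hr hS hK hD hne hmin
  set i := firstBad r S D with hi
  have hbad : ∀ k, 1 ≤ k → k ≤ K → s.natArr 2 k = badCount r (S / 2 ^ k) (level (S / 2 ^ k) D) :=
    fun k hk hk' => (h.store.level k hk hk').bad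
  rw [findCenter, wp_seq]
  simp only [Cmd.run, List.foldl, wp_seq, wp_instr, Instr.step, Option.some.injEq,
    exists_eq_left', Function.update_self]
  refine (wp_while (fun n t => ∃ k, k + n = i ∧ 1 ≤ k ∧ t.nat 10 = k ∧ t.nat 12 = s.natArr 2 k ∧
    Frame [10, 12] [] s t) 2 ?_ ?_ (n := i - 1) ⟨1, ?_, ?_, ?_, ?_, ?_⟩).mono ?_
  · rintro n t ⟨k, hk, hk1, e10, e12, hF⟩
    have e9 := (hF.nat 9 (by decide)).trans h.nat9
    refine ⟨?_, ?_⟩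
    · simp only [Cond.Holds, e12, e9]
      rw [hbad k hk1 (by omega)]
      exact f4 k hk1 (by omega)
    · simp only [wp_seq, wp_instr, Instr.step, Option.some.injEq, exists_eq_left', e10,
        Function.update_self, hF.natArr 2 (by decide)]
      refine ⟨⟨k + 1, by omega, by omega, by simp, by simp, ?_⟩, by norm_num⟩
      refine hF.trans (mn' := [10, 12]) (mr' := []) ⟨?_, ?_, ?_, ?_, rfl, rfl⟩ <;>
        intro x hx <;> simp_all
  · rintro t ⟨k, hk, hk1, e10, e12, hF⟩
    have e9 := (hF.nat 9 (by decide)).trans h.nat9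
    simp only [Cond.Holds, e12, e9]
    obtain rfl : k = i := by omega
    rw [hbad _ hk1 f2]
    exact f3
  · omega
  · exact le_rfl
  · simp
  · simp
  · refine ⟨?_, ?_, ?_, ?_, rfl, rfl⟩ <;> intro x hx <;> simp_all
  rintro t k₁ ⟨⟨k, hk, hk1, e10, e12, hF⟩, hk₁⟩
  obtain rfl : k = i := by omega
  have hsub : i - 1 - 1 - 1 - 1 = i - 4 := by omega
  simp only [e10, hsub]
  have hj : i - 4 ≤ K := by omega
  have hF1 : Frame [10, 12] [] s { t with
      nat := Function.update (Function.update (Function.update (Function.update t.nat 12 (i - 1))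
        12 (i - 1 - 1)) 12 (i - 1 - 1 - 1)) 12 (i - 4) } := by
    refine hF.trans (mn' := [12]) (mr' := []) ⟨?_, ?_, ?_, ?_, rfl, rfl⟩ <;>
      intro x hx <;> simp_all
  generalize hu : ({ t with
      nat := Function.update (Function.update (Function.update (Function.update t.nat 12 (i - 1))
        12 (i - 1 - 1)) 12 (i - 1 - 1 - 1)) 12 (i - 4) } : State X) = u at hF1 ⊢
  have hu12 : u.nat 12 = i - 4 := by simp [← hu]
  have htree : ∀ v : State X, v.nat 3 = s.nat 3 → (∀ a, a ≠ 10 → v.natArr a = s.natArr a) →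
      v.ptArr = s.ptArr →
      Tree S K ids loc (v.nat 3) (v.natArr 0) (v.natArr 1) (v.natArr 3) (v.ptArr 0) := by
    intro v h3 ha hpa
    rw [h3, ha 0 (by decide), ha 1 (by decide), ha 3 (by decide), hpa]
    exact h.store.tree
  have hloc1 : dist (loc 1) q ≤ S := by
    rw [h.loc1]
    exact hdiam _ h.mem _ hq
  have hσ : 0 < S / 2 ^ (i - 4) := by positivity
  refine (wp_locate hX hS (htree u (hF1.nat 3 (by decide)) hF1.natArr hF1.ptArr) h.store.sparse hj
    ((hF1.nat 9 (by decide)).trans h.nat9) hu12 ((hF1.real 2 (by decide)).trans h.real2)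
    ((hF1.pt 0 (by decide)).trans hp) hloc1).mono ?_
  rintro v k₂ ⟨⟨ql, hQ, hr10, hF2⟩, hk₂⟩
  clear hu hu12 e10 e12 hF
  have hFv : Frame [10, 11, 12, 15, 16, 17, 20, 21, 22] [0, 10, 20, 21] s v :=
    (hF1.mono (mn := [10, 11, 12, 15, 16, 17, 20, 21, 22]) (mr := [0, 10, 20, 21])).trans hF2
  have hnet := h.net hdiam hj
  have hsp := h.store.sparse (i - 4) hj
  have hsol : solCenter r S D q = centerAt (S / 2 ^ (i - 4)) ((ids (i - 4)).map loc) q := by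
    rw [hnet]
    exact if_neg (by omega)
  have hF3 : Frame [10, 11, 12, 15, 16, 17, 20, 21, 22] [0, 10, 20, 21] s { v with
      real := Function.update (Function.update v.real 0 (v.real 10)) 20 (v.real 10 / 2) } := by
    refine hFv.trans (mn' := []) (mr' := [0, 20]) ⟨?_, ?_, ?_, ?_, rfl, rfl⟩ <;>
      intro x hx <;> simp_all
  simp only [Function.update_of_ne (show (10 : ℕ) ≠ 0 by decide)]
  refine (wp_scan_near (S := S) (K := K) (t := S / 2 ^ (i - 4) / 2) (ql := ql) (p := q) hX hσ hsp
    ?_ ?_ ?_ ?_ ?_ ?_).mono ?_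
  · exact htree _ (hFv.nat 3 (by decide)) hFv.natArr hFv.ptArr
  · exact ⟨hQ.seg, hQ.tail, hQ.nodup, hQ.mem⟩
  · exact (hFv.nat 9 (by decide)).trans h.nat9
  · exact (hFv.pt 0 (by decide)).trans hp
  · simp [hr10]
  · linarith
  rintro w k₃ ⟨⟨hw, hQw, hFw⟩, hk₃⟩
  have hF4 := hF3.trans hFw
  have hw0 : w.real 0 = S / 2 ^ (i - 4) := by
    rw [hFw.real 0 (by decide)]
    simp [hr10]
  have hw10 : w.real 10 = S / 2 ^ (i - 4) := by
    rw [hFw.real 10 (by decide)]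
    simp [hr10]
  have hmid : wp (.ite (.natEq 22 9) (.seq (.instr (.realCopy 20 10)) scan) .skip) (fun z n =>
      (Frame [10, 11, 12, 15, 16, 17, 20, 21, 22] [0, 10, 20, 21] s z ∧
        z.real 0 = S / 2 ^ (i - 4) ∧ z.ptArr 0 (z.nat 22) = some (solCenter r S D q)) ∧
      n ≤ packing d * 9 + 6) w := by
    have e9 := (hF4.nat 9 (by decide)).trans h.nat9
    refine wp_ite (fun hb => ?_) fun hb => wp_skip ?_
    · simp only [Cond.Holds, e9] at hb
      obtain ⟨-, hnone⟩ | ⟨hne', -⟩ := hw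
      swap
      · exact absurd hb hne'
      simp only [wp_seq, wp_instr, Instr.step, Option.some.injEq, exists_eq_left']
      refine (wp_scan_near (S := S) (K := K) (t := S / 2 ^ (i - 4)) (ql := ql) (p := q) hX hσ hsp
        ?_ ?_ ?_ ?_ ?_ ?_).mono ?_
      · exact htree _ (hF4.nat 3 (by decide)) hF4.natArr hF4.ptArr
      · exact ⟨hQw.seg, hQw.tail, hQw.nodup, hQw.mem⟩
      · exact e9
      · exact (hF4.pt 0 (by decide)).trans hp
      · simp [hw10]
      · linarith
      rintro z k ⟨⟨hz, -, hFz⟩, hk⟩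
      refine ⟨⟨?_, ?_, ?_⟩, by omega⟩
      · refine Frame.trans (s' := _) ?_ hFz
        refine hF4.trans (mn' := []) (mr' := [20]) ⟨?_, ?_, ?_, ?_, rfl, rfl⟩ <;>
          intro x hx <;> simp_all
      · rw [hFz.real 0 (by decide)]
        simpa using hw0
      · obtain ⟨-, hnone'⟩ | ⟨-, hz1, hz2⟩ := hz
        · obtain ⟨y, hy, hyq⟩ := exists_level_near hσ.le hq
          rw [hnet] at hnone'
          exact absurd hyq (not_le.2 (oldest_eq_none.1 hnone' y hy))
        · rw [hz1, hsol, centerAt, hnone, hz2]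
          rfl
    · simp only [Cond.Holds, e9] at hb
      obtain ⟨h0, -⟩ | ⟨-, hw1, hw2⟩ := hw
      · exact absurd h0 hb
      · refine ⟨⟨hF4, hw0, ?_⟩, by omega⟩
        rw [hw1, hsol, centerAt, hw2]
        rfl
  refine hmid.mono ?_
  rintro z k₄ ⟨⟨hFz, hz0, hz⟩, hk₄⟩
  refine ⟨⟨h.frame ?_ ?_ ?_ ?_ hFz.realArr hFz.ptArr, hz0, ?_⟩, ?_⟩
  · intro x hx _
    exact hFz.nat x (by simp; omega)
  · intro x hx hx'
    exact hFz.real x (by simp; omega)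
  · simpa using hFz.pt 1 (by decide)
  · exact fun a ha => hFz.natArr a ha
  · simpa using hz
  · have e1 : K * (packing d * (packing d * 8 + 5) + 10) =
        K * (packing d * (packing d * 8 + 5) + 7) + K * 3 := by ring
    have e2 := Nat.mul_le_mul_right (packing d * (packing d * 8 + 5) + 7) hj
    omega

end OperationSpecs
-- Insertion of a point.
section InsertSpecs

variable {X : Type u} [MetricSpace X]

/-- At the finest scale every point is a net point, so a search with radius 0 decides whether `p` is
new. -/
theorem wp_insertNew {d : ℝ} (hX : DoublingDimLE X d) {r : ℕ} {S : ℝ} (hS : 0 < S)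
    {K : ℕ} {D : List X} {p₀ : X} {ids : ℕ → List ℕ} {loc : ℕ → X} {s : State X}
    (h : Active r S K D p₀ ids loc s) {p : X}
    (hdiam : ∀ x ∈ p :: D, ∀ y ∈ p :: D, dist x y ≤ S)
    (hmin : ∀ x ∈ p :: D, ∀ y ∈ p :: D, dist x y ≤ 3 * (S / 2 ^ K) → x = y)
    (hp : s.pt 0 = some p) :
    wp insertNew (fun t n =>
      (∃ ids' loc', Active r S K (if p ∈ D then D else p :: D) p₀ ids' loc' t) ∧
      n ≤ 2 * (K * levelCost d) + packing d * 9 + 30) s := by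
  have hT := h.store.tree
  have hσ : 0 < S / 2 ^ K := by positivity
  have hp₀ : p₀ ∈ p :: D := List.mem_cons_of_mem _ h.mem
  have hloc1 : dist (loc 1) p ≤ S := by
    rw [h.loc1]
    exact hdiam _ hp₀ _ (by simp)
  have hnet := h.net (fun x hx y hy => hdiam x (by simp [hx]) y (by simp [hy])) le_rfl
  rw [insertNew, wp_seq]
  simp only [Cmd.run, List.foldl, wp_seq, wp_instr, Instr.step, Option.some.injEq,
    exists_eq_left', h.nat2]
  refine (wp_locate (j := K) (p := p) hX hS ?_ h.store.sparse le_rfl ?_ ?_ ?_ ?_ hloc1).mono ?_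
  · simpa using hT
  · simpa using h.nat9
  · simp
  · simpa using h.real2
  · exact hp
  rintro t k₁ ⟨⟨ql, hQ, hr10, hF⟩, hk₁⟩
  have hF1 : Frame [10, 11, 12, 15, 16, 17, 20, 21, 22] [10, 20, 21] s t := by
    refine Frame.trans (s' := _) ?_ hF
    refine ⟨?_, ?_, ?_, ?_, rfl, rfl⟩ <;> intro x hx <;> simp_all
  have hF2 : Frame [10, 11, 12, 15, 16, 17, 20, 21, 22] [10, 20, 21] s { t with
      real := Function.update t.real 20 (t.real 9) } := by
    refine hF1.trans (mn' := []) (mr' := [20]) ⟨?_, ?_, ?_, ?_, rfl, rfl⟩ <;>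
      intro x hx <;> simp_all
  refine (wp_scan_near (S := S) (K := K) (t := 0) (ql := ql) (p := p) hX hσ
    (h.store.sparse K le_rfl) ?_ ?_ ?_ ?_ ?_ ?_).mono ?_
  · simpa [hF1.nat 3 (by decide), hF1.natArr, hF1.ptArr] using hT
  · exact ⟨hQ.seg, hQ.tail, hQ.nodup, hQ.mem⟩
  · exact (hF1.nat 9 (by decide)).trans h.nat9
  · exact (hF1.pt 0 (by decide)).trans hp
  · simpa using (hF1.real 9 (by decide)).trans h.real9
  · linarith
  rintro u k₂ ⟨⟨hu, -, hF3⟩, hk₂⟩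
  have hF4 := hF2.trans hF3
  have hu' : Active r S K D p₀ ids loc u := by
    refine h.frame ?_ ?_ (hF4.pt 1 (by decide)) hF4.natArr hF4.realArr hF4.ptArr
    · intro x hx _
      exact hF4.nat x (by simp; omega)
    · intro x hx hx'
      exact hF4.real x (by simp; omega)
  have hcost : K * (packing d * (packing d * 8 + 5) + 7) ≤ K * levelCost d := by
    refine Nat.mul_le_mul_left _ ?_
    have : packing d * (packing d * 8 + 34) =
      packing d * (packing d * 8 + 5) + packing d * 29 := by ring
    unfold levelCost
    omega
  rw [hnet] at hu
  refine wp_ite (fun hb => ?_) fun hb => wp_skip ?_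
  · simp only [Cond.Holds, hu'.nat9] at hb
    obtain ⟨-, hnone⟩ | ⟨hne, -⟩ := hu
    swap
    · exact absurd hb hne
    have hpD : p ∉ D := fun hpD => by
      obtain ⟨y, hy, hyp⟩ := exists_level_near hσ.le hpD
      -- The net point covering an old `p` at the finest scale can only be `p` itself.
      obtain rfl := hmin y (List.mem_cons_of_mem _ (level_subset _ _ _ hy)) p (by simp)
        (by linarith)
      have := oldest_eq_none.1 hnone y hy
      simp at this
    rw [if_neg hpD]
    refine (wp_insertCore hX hS hu'.store hu'.nat9 hu'.nat2 hu'.real7 hu'.real8 hu'.real9 hu'.real2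
      ((hF4.pt 0 (by decide)).trans hp) hloc1).mono ?_
    rintro v k ⟨⟨ids', loc', g1, g2, gR⟩, hk⟩
    refine ⟨⟨ids', loc', ?_⟩, by omega⟩
    obtain ⟨D', hD'⟩ := hu'.last
    exact {
      nat0 := (gR.nat 0 (by decide)).trans hu'.nat0
      nat1 := (gR.nat 1 (by decide)).trans hu'.nat1
      nat2 := (gR.nat 2 (by decide)).trans hu'.nat2
      nat9 := (gR.nat 9 (by decide)).trans hu'.nat9
      real2 := (gR.real 2 (by decide)).trans hu'.real2
      real7 := (gR.real 7 (by decide)).trans hu'.real7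
      real8 := (gR.real 8 (by decide)).trans hu'.real8
      real9 := (gR.real 9 (by decide)).trans hu'.real9
      pt1 := (gR.pt 1 (by decide) (by decide)).trans hu'.pt1
      loc1 := g2.trans hu'.loc1
      last := ⟨p :: D', by rw [hD', List.cons_append]⟩
      store := g1 }
  · simp only [Cond.Holds, hu'.nat9] at hb
    obtain ⟨h0, -⟩ | ⟨-, -, hsome⟩ := hu
    · exact absurd h0 hb
    have hpD : p ∈ D := by
      obtain ⟨hy, hyp⟩ := oldest_eq_some hsome
      have := dist_le_zero.1 hyp
      rw [this] at hy
      exact level_subset _ _ _ hy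
    rw [if_pos hpD]
    exact ⟨⟨ids, loc, hu'⟩, by omega⟩

theorem tree_init (S : ℝ) (K : ℕ) (p₀ : X) {F N Q : ℕ → ℕ} (hF : F 1 = 0) {pts : ℕ → Option X}
    (hpts : pts 1 = some p₀) :
    Tree S K (fun k => if k = 0 then [1] else []) (fun _ => p₀) 2 F N Q pts where
  pos k n hn := by
    split_ifs at hn <;> simp at hn
    omega
  root := rfl
  sorted k := by split_ifs <;> simp
  disj j k n hj hk := by
    split_ifs at hj hk <;> simp_all
  pt k n hn := by
    split_ifs at hn <;> simp at hn
    rw [hn, hpts]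
  child k _ n hn := by
    split_ifs at hn <;> simp at hn
    simp [hn, hF, Linked]
  parent k _ c hc := by simp at hc

/-- The scales are known only now that there is a second point. The first point becomes the root and
is inserted into all levels; the second point is only kept for the insertion that follows. -/
theorem wp_init {d : ℝ} (hX : DoublingDimLE X d) {r : ℕ} {Δ : ℝ} {p p₀ : X} (hne : p ≠ p₀)
    {s : State X} (h0 : s.nat 0 = r) (h8 : s.nat 8 = 1) (h9 : s.nat 9 = 0) (hr1 : s.real 1 = Δ)
    (hr9 : s.real 9 = 0) (hr20 : s.real 20 = dist p p₀) (hp0 : s.pt 0 = some p)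
    (hp1 : s.pt 1 = some p₀) (ha : ∀ a n, s.natArr a n = 0) :
    wp init (fun t n =>
      (∃ ids loc, Active r (topScale Δ [p, p₀]) (depth Δ) [p₀] p₀ ids loc t ∧ t.pt 0 = some p ∧
        t.nat 8 = 1) ∧
      n ≤ depth Δ * levelCost d + 5 * doublings Δ + 30) s := by
  have hpos : 0 < dist p p₀ := dist_pos.2 hne
  have hS : 0 < topScale Δ [p, p₀] := by
    rw [topScale, baseDist_pair]
    positivity
  rw [init, wp_seq]
  simp only [Cmd.run, List.foldl, wp_seq, wp_instr, Instr.step, Option.some.injEq,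
    exists_eq_left']
  refine (wp_while (fun n t => ∃ i, i + n = doublings Δ ∧ t.real 21 = 2 ^ i ∧
    t.real 2 = 2 ^ i * dist p p₀ ∧ t.nat 2 = 2 * i + 5 ∧ t.real 7 = 1 ∧ t.real 8 = r ∧
    Frame [2] [2, 7, 8, 21] s t) 4 ?_ ?_ (n := doublings Δ)
    ⟨0, by omega, ?_, ?_, ?_, ?_, ?_, ?_⟩).mono ?_
  · rintro n t ⟨i, hi, e21, e2, en2, e7, e8, hF⟩
    refine ⟨?_, ?_⟩
    · simp only [Cond.Holds, e21, hF.real 1 (by decide), hr1]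
      exact two_pow_lt_of_lt_doublings (by omega)
    · simp only [wp_seq, wp_instr, Instr.step, Option.some.injEq, exists_eq_left']
      refine ⟨⟨i + 1, by omega, ?_, ?_, ?_, ?_, ?_, ?_⟩, by norm_num⟩
      · simp [e21, pow_succ]; ring
      · simp [e2, pow_succ]; ring
      · simp [en2]; ring
      · simpa using e7
      · simpa using e8
      · refine hF.trans (mn' := [2]) (mr' := [2, 21]) ⟨?_, ?_, ?_, ?_, rfl, rfl⟩ <;>
          intro x hx <;> simp_all
  · rintro t ⟨i, hi, e21, -, -, -, -, hF⟩
    simp only [Cond.Holds, e21, hF.real 1 (by decide), hr1, not_lt]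
    obtain rfl : i = doublings Δ := by omega
    exact le_two_pow_doublings Δ
  · simp [h8]
  · simp [hr20]
  · simp
  · simp [h8]
  · simp [h0]
  · refine ⟨?_, ?_, ?_, ?_, rfl, rfl⟩ <;> intro x hx <;> simp_all
  rintro t k₁ ⟨⟨i, hi, -, e2, en2, e7, e8, hF⟩, hk₁⟩
  obtain rfl : i = doublings Δ := by omega
  have e0 := (hF.nat 0 (by decide)).trans h0
  have e9 := (hF.nat 9 (by decide)).trans h9
  have er9 := (hF.real 9 (by decide)).trans hr9
  have ept0 := (hF.pt 0 (by decide)).trans hp0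
  have ept1 := (hF.pt 1 (by decide)).trans hp1
  refine (wp_insertCore (r := r) (S := topScale Δ [p, p₀]) (K := depth Δ) (p := p₀) (D := [])
    (ids := fun k => if k = 0 then [1] else []) (loc := fun _ => p₀) hX hS ⟨?_, ?_⟩
    ?_ ?_ ?_ ?_ ?_ ?_ ?_ ?_).mono ?_
  · simp only [Function.update_self, Function.update_of_ne (show (3 : ℕ) ≠ 1 by decide)]
    refine tree_init _ _ p₀ ?_ ?_
    · rw [hF.natArr 0 (by decide)]
      exact ha 0 1
    · simp [ept1]
  · intro k hk _
    rw [if_neg (by omega)]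
    refine ⟨by simp [level], by simp, by simp, ?_⟩
    rw [hF.natArr 2 (by decide)]
    simpa [badCount, level] using ha 2 k
  · simpa using e9
  · simp [en2, depth]
  · simpa using e7
  · simpa using e8
  · simpa using er9
  · simp [e2, topScale, baseDist_pair]; ring
  · simp [ept1]
  · simpa using hS.le
  rintro u k₂ ⟨⟨ids', loc', g1, g2, gR⟩, hk₂⟩
  refine ⟨⟨ids', loc', ⟨?_, ?_, ?_, ?_, ?_, ?_, ?_, ?_, ?_, g2, ⟨[], rfl⟩, ?_⟩, ?_, ?_⟩, by omega⟩
  · simpa [e0] using gR.nat 0 (by decide)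
  · simpa using gR.nat 1 (by decide)
  · simpa [en2, depth] using gR.nat 2 (by decide)
  · simpa [e9] using gR.nat 9 (by decide)
  · rw [gR.real 2 (by decide)]
    simp [e2, topScale, baseDist_pair]
    ring
  · simpa [e7] using gR.real 7 (by decide)
  · simpa [e8] using gR.real 8 (by decide)
  · simpa [er9] using gR.real 9 (by decide)
  · simpa [ept1] using gR.pt 1 (by decide) (by decide)
  · exact g1.congr (fun _ _ _ => rfl) rfl (fun _ _ => rfl) rfl rfl
  · simpa [ept0] using gR.pt 2 (by decide) (by decide)
  · simpa [hF.nat 8 (by decide), h8] using gR.nat 8 (by decide)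

end InsertSpecs
-- The invariant between operations.
section Invariant

variable {X : Type u} [MetricSpace X]

/-- The state between the operations, for the list `D` of the distinct points, newest first. -/
structure Inv (r : ℕ) (Δ : ℝ) (D : List X) (s : State X) : Prop where
  nat0 : s.nat 0 = r
  nat9 : s.nat 9 = 0
  real9 : s.real 9 = 0
  cases : (D = [] ∧ s.nat 1 = 0 ∧ s.real 0 = Δ ∧ ∀ a n, s.natArr a n = 0) ∨
    (∃ p₀, D = [p₀] ∧ s.nat 1 = 1 ∧ s.real 1 = Δ ∧ s.pt 1 = some p₀ ∧ ∀ a n, s.natArr a n = 0) ∨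
    ∃ p₀ ids loc, 2 ≤ D.length ∧ Active r (topScale Δ D) (depth Δ) D p₀ ids loc s

theorem Active.inv {r : ℕ} {Δ : ℝ} {D : List X} {p₀ : X} {ids : ℕ → List ℕ} {loc : ℕ → X}
    {s : State X} (h : Active r (topScale Δ D) (depth Δ) D p₀ ids loc s) (hD : 2 ≤ D.length) :
    Inv r Δ D s :=
  ⟨h.nat0, h.nat9, h.real9, Or.inr (Or.inr ⟨p₀, ids, loc, hD, h⟩)⟩

theorem inv_initial (r : ℕ) (Δ : ℝ) : Inv r Δ ([] : List X) (State.initial r Δ) :=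
  ⟨by simp [State.initial], by simp [State.initial], by simp [State.initial],
    Or.inl ⟨rfl, by simp [State.initial], by simp [State.initial], by simp [State.initial]⟩⟩

theorem cost_le_opCost (d Δ : ℝ) :
    3 * (depth Δ * levelCost d) + packing d * 18 + 5 * doublings Δ + 100 ≤ opCost d Δ := by
  have h1 := levelCost_ge d
  have h2 : depth Δ * 67 ≤ depth Δ * levelCost d := Nat.mul_le_mul_left _ (by omega)
  have h3 : (depth Δ + 1) * levelCost d = depth Δ * levelCost d + levelCost d := by ring
  have h4 : depth Δ = 2 * doublings Δ + 5 := rfl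
  unfold opCost
  omega

theorem wp_insertPoint {d : ℝ} (hX : DoublingDimLE X d) {r : ℕ} {Δ : ℝ} {D : List X}
    {s : State X} (h : Inv r Δ D s) (hD : D.Nodup) {p : X}
    (hP : AspectRatioLE (pointSet (p :: D)) Δ) (hp : s.pt 0 = some p) :
    wp insertPoint (fun t n => Inv r Δ (if p ∈ D then D else p :: D) t ∧ n ≤ opCost d Δ) s := by
  have hcost := cost_le_opCost d Δ
  have hDnd : (if p ∈ D then D else p :: D).Nodup := by
    split_ifs with hpD
    · exact hD
    · exact List.nodup_cons.2 ⟨hpD, hD⟩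
  have hDmem : ∀ x, x ∈ (if p ∈ D then D else p :: D) ↔ x ∈ p :: D := by
    intro x
    split_ifs with hpD
    · simp only [List.mem_cons]
      exact ⟨Or.inr, fun h => h.elim (fun e => e ▸ hpD) id⟩
    · rfl
  have hP' : AspectRatioLE (pointSet (if p ∈ D then D else p :: D)) Δ := by
    have : pointSet (if p ∈ D then D else p :: D) = pointSet (p :: D) := Set.ext hDmem
    rw [this]
    exact hP
  have hbounds : 2 ≤ (if p ∈ D then D else p :: D).length →
      0 < topScale Δ (if p ∈ D then D else p :: D) ∧
      (∀ x ∈ p :: D, ∀ y ∈ p :: D, dist x y ≤ topScale Δ (if p ∈ D then D else p :: D)) ∧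
      ∀ x ∈ p :: D, ∀ y ∈ p :: D,
        dist x y ≤ 3 * (topScale Δ (if p ∈ D then D else p :: D) / 2 ^ depth Δ) → x = y := by
    intro hlen
    obtain ⟨b1, b2, b3⟩ := topScale_bounds hDnd hlen hP'
    refine ⟨b1, fun x hx y hy => ?_, fun x hx y hy =>
      b3 x ((hDmem x).2 hx) y ((hDmem y).2 hy)⟩
    have := b2 x ((hDmem x).2 hx) y ((hDmem y).2 hy)
    linarith
  rw [insertPoint, wp_seq]
  simp only [Cmd.run, List.foldl, wp_instr, Instr.step, Option.some.injEq,
    exists_eq_left']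
  have h9 := h.nat9
  obtain ⟨hD0, h1, hr0, ha⟩ | ⟨p₀, hD1, h1, hr1, hp1, ha⟩ | ⟨p₀, ids, loc, hlen, hA⟩ := h.cases
  · refine wp_ite (fun hb => ?_) fun hb => ?_
    · simp only [wp_seq, wp_instr, Instr.step, Option.some.injEq, exists_eq_left']
      subst hD0
      refine ⟨⟨?_, ?_, ?_, Or.inr (Or.inl ⟨p, by simp, ?_, ?_, ?_, ha⟩)⟩, by omega⟩
      · simpa using h.nat0
      · simpa using h9
      · simpa using h.real9
      · simp
      · simpa using hr0
      · simpa using hp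
    · exact absurd (by simp [Cond.Holds, h1, h9]) hb
  · refine wp_ite (fun hb => ?_) fun _ => ?_
    · simp [Cond.Holds, h1, h9] at hb
    rw [wp_seq]
    refine wp_ite (fun _ => ?_) fun hb => ?_
    swap
    · exact absurd (by simp [Cond.Holds, h1]) hb
    simp only [wp_seq, wp_instr, Instr.step, hp, hp1, Option.some.injEq, exists_eq_left']
    refine wp_ite (fun hb => ?_) fun hb => wp_skip ?_
    · simp [Cond.Holds, h.real9] at hb
      have hpD : p ∉ D := by simpa [hD1] using hb
      refine (wp_init (p := p) (p₀ := p₀) (r := r) (Δ := Δ) hX hb ?_ ?_ ?_ ?_ ?_ ?_ ?_ ?_ ?_).mono ?_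
      · simpa using h.nat0
      · simp
      · simpa using h9
      · simpa using hr1
      · simpa using h.real9
      · simp
      · exact hp
      · exact hp1
      · exact ha
      rintro t k ⟨⟨ids, loc, hA, ht0, ht8⟩, hk⟩
      refine wp_ite (fun hc => ?_) fun _ => ?_
      · simp [Cond.Holds, hA.nat1, ht8] at hc
      rw [if_neg hpD] at hbounds ⊢
      subst hD1
      obtain ⟨b1, b2, b3⟩ := hbounds (by simp)
      refine (wp_insertNew hX b1 hA b2 b3 ht0).mono ?_
      rintro u m ⟨⟨ids', loc', hA'⟩, hm⟩
      rw [if_neg hpD] at hA'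
      exact ⟨hA'.inv (by simp), by omega⟩
    · simp [Cond.Holds, h.real9] at hb
      subst hb hD1
      refine wp_ite (fun _ => wp_skip ?_) fun hc => ?_
      · rw [if_pos (by simp)]
        refine ⟨⟨?_, ?_, ?_, Or.inr (Or.inl ⟨_, rfl, ?_, ?_, hp1, ha⟩)⟩, by omega⟩
        · simpa using h.nat0
        · simpa using h9
        · simpa using h.real9
        · simpa using h1
        · simpa using hr1
      · exact absurd (by simp [Cond.Holds, h1]) hc
  · refine wp_ite (fun hb => ?_) fun _ => ?_
    · simp [Cond.Holds, hA.nat1, h9] at hb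
    rw [wp_seq]
    refine wp_ite (fun hb => ?_) fun _ => wp_skip ?_
    · simp [Cond.Holds, hA.nat1] at hb
    refine wp_ite (fun hb => ?_) fun _ => ?_
    · simp [Cond.Holds, hA.nat1] at hb
    have hlen' : 2 ≤ (if p ∈ D then D else p :: D).length := by
      split_ifs
      · exact hlen
      · simp only [List.length_cons]
        omega
    -- The scales depend only on the two oldest different points and are never changed again.
    have htop : topScale Δ (if p ∈ D then D else p :: D) = topScale Δ D := by
      split_ifs
      · rfl
      · rw [topScale, topScale, baseDist_cons p hlen]
    rw [htop] at hbounds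
    obtain ⟨b1, b2, b3⟩ := hbounds hlen'
    refine (wp_insertNew hX b1 (hA.frame ?_ ?_ ?_ ?_ ?_ ?_) b2 b3 ?_).mono ?_
    · intro x hx hx'
      simp [hx']
    · exact fun _ _ _ => rfl
    · rfl
    · exact fun _ _ => rfl
    · rfl
    · rfl
    · exact hp
    · rintro u m ⟨⟨ids', loc', hA'⟩, hm⟩
      rw [← htop] at hA'
      exact ⟨hA'.inv hlen', by omega⟩

/-- The spare step in the bound pays for the copy that precedes it in a radius query. -/
theorem wp_queryPoint {d : ℝ} (hX : DoublingDimLE X d) {r : ℕ} (hr : 1 ≤ r) {Δ : ℝ} {D : List X}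
    {s : State X} (h : Inv r Δ D s) (hD : D.Nodup) (hP : AspectRatioLE (pointSet D) Δ)
    (hp : D ≠ [] → ∃ q ∈ D, s.pt 0 = some q) :
    wp queryPoint (fun t n => (Inv r Δ D t ∧
      (r = 1 → D ≠ [] → t.real 0 = 0 ∧ t.pt 0 = s.pt 0) ∧
      (2 ≤ r → r ≤ D.length → t.real 0 = solScale r (topScale Δ D) D ∧
        ∀ q, s.pt 0 = some q → t.pt 0 = some (solCenter r (topScale Δ D) D q))) ∧
      n + 1 ≤ opCost d Δ) s := by
  have hcost := cost_le_opCost d Δ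
  have h9 := h.nat9
  have h0 := h.nat0
  rw [queryPoint, wp_seq]
  simp only [Cmd.run, List.foldl, wp_instr, Instr.step, Option.some.injEq,
    exists_eq_left']
  obtain ⟨hD0, h1, hr0, ha⟩ | ⟨p₀, hD1, h1, hr1, hp1, ha⟩ | ⟨p₀, ids, loc, hlen, hA⟩ := h.cases
  · refine wp_ite (fun hb => wp_skip ?_) fun hb => ?_
    · subst hD0
      refine ⟨⟨⟨?_, ?_, ?_, Or.inl ⟨rfl, ?_, ?_, ha⟩⟩, fun _ h => absurd rfl h, ?_⟩, by omega⟩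
      · simpa using h.nat0
      · simpa using h9
      · simpa using h.real9
      · simpa using h1
      · simpa using hr0
      · intro hr2 hr3
        simp at hr3
        omega
    · exact absurd (by simp [Cond.Holds, h1, h9]) hb
  · refine wp_ite (fun hb => ?_) fun _ => ?_
    · simp [Cond.Holds, h1, h9] at hb
    refine wp_ite (fun hb => ?_) fun hb => ?_
    · simp [Cond.Holds, h0] at hb
      simp only [wp_instr, Instr.step, Option.some.injEq, exists_eq_left']
      refine ⟨⟨⟨?_, ?_, ?_, Or.inr (Or.inl ⟨p₀, hD1, ?_, ?_, hp1, ha⟩)⟩, fun _ _ => ⟨?_, by simp⟩,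
        fun hr2 => by omega⟩, by omega⟩
      · simpa using h.nat0
      · simpa using h9
      · simpa using h.real9
      · simpa using h1
      · simpa using hr1
      · simpa using h.real9
    · simp [Cond.Holds, h0] at hb
      refine wp_ite (fun _ => wp_skip ?_) fun hc => ?_
      · refine ⟨⟨⟨?_, ?_, ?_, Or.inr (Or.inl ⟨p₀, hD1, ?_, hr1, hp1, ha⟩)⟩,
          fun hr1 => absurd hr1 hb, fun hr2 hr3 => ?_⟩, by omega⟩
        · simpa using h.nat0
        · simpa using h9
        · simpa using h.real9
        · simpa using h1
        · simp [hD1] at hr3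
          omega
      · exact absurd (by simp [Cond.Holds, h1]) hc
  · refine wp_ite (fun hb => ?_) fun _ => ?_
    · simp [Cond.Holds, hA.nat1, h9] at hb
    refine wp_ite (fun hb => ?_) fun hb => ?_
    · simp [Cond.Holds, h0] at hb
      simp only [wp_instr, Instr.step, Option.some.injEq, exists_eq_left']
      refine ⟨⟨(hA.frame ?_ ?_ ?_ ?_ ?_ ?_).inv hlen, fun _ _ => ⟨?_, by simp⟩,
        fun hr2 => by omega⟩, by omega⟩
      · intro x hx hx'
        simp [hx']
      · intro x hx hx'
        simp [hx']
      · rfl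
      · exact fun _ _ => rfl
      · rfl
      · rfl
      · simpa using h.real9
    · simp [Cond.Holds, h0] at hb
      refine wp_ite (fun hc => ?_) fun _ => ?_
      · simp [Cond.Holds, hA.nat1] at hc
      obtain ⟨b1, b2, b3⟩ := topScale_bounds hD hlen hP
      obtain ⟨q, hq, hpq⟩ := hp (List.ne_nil_of_mem hA.mem)
      refine (wp_findCenter hX (by omega : 2 ≤ r) b1 (by unfold depth; omega : 1 ≤ depth Δ)
        (hA.frame ?_ ?_ ?_ ?_ ?_ ?_) hD (fun x hx y hy => ?_) b3 hq ?_).mono ?_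
      · intro x hx hx'
        simp [hx']
      · exact fun _ _ _ => rfl
      · rfl
      · exact fun _ _ => rfl
      · rfl
      · rfl
      · have := b2 x hx y hy
        linarith
      · exact hpq
      · rintro t k ⟨⟨g1, g2, g3⟩, hk⟩
        refine ⟨⟨g1.inv hlen, fun h => absurd h hb, fun _ _ => ⟨g2, fun q' hq' => ?_⟩⟩, ?_⟩
        · rw [hpq] at hq'
          rw [g3, Option.some.inj hq']
        · have : depth Δ * (packing d * (packing d * 8 + 5) + 10) ≤ depth Δ * levelCost d := by
            refine Nat.mul_le_mul_left _ ?_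
            have : packing d * (packing d * 8 + 34) =
              packing d * (packing d * 8 + 5) + packing d * 29 := by ring
            unfold levelCost
            omega
          omega

/-- The properties of the result of an operation. -/
structure OpSpec (d : ℝ) (r : ℕ) (Δ : ℝ) (l : List X) (o : Op X) (t : State X) (n : ℕ) :
    Prop where
  inv : Inv r Δ (distinctPts (l ++ history [o])) t
  cost : n ≤ opCost d Δ
  radius : (∀ p, o ≠ .insert p) → r ≤ (pointSet l).ncard →
    ((solution r Δ l).radius : ℝ) ≤ t.real 0 ∧ t.real 0 ≤ 32 * (solution r Δ l).radius
  center : ∀ p, o = .queryCenter p → r ≤ (pointSet l).ncard →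
    ∃ j, p ∈ (solution r Δ l).cluster j ∧ t.pt 0 = some ((solution r Δ l).center j)

theorem opSpec_of_query {d : ℝ} {r : ℕ} (hr : 1 ≤ r) {Δ : ℝ} {l : List X}
    (hP : AspectRatioLE (pointSet l) Δ) {o : Op X} (ho : ∀ p, o ≠ .insert p) {s t : State X}
    {n : ℕ} (hn : n ≤ opCost d Δ) (hinv : Inv r Δ (distinctPts l) t)
    (h1 : r = 1 → distinctPts l ≠ [] → t.real 0 = 0 ∧ t.pt 0 = s.pt 0)
    (h2 : 2 ≤ r → r ≤ (distinctPts l).length →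
      t.real 0 = solScale r (topScale Δ (distinctPts l)) (distinctPts l) ∧
        ∀ q, s.pt 0 = some q →
          t.pt 0 = some (solCenter r (topScale Δ (distinctPts l)) (distinctPts l) q))
    (hq : ∀ p, o = .queryCenter p → p ∈ l ∧ s.pt 0 = some p) : OpSpec d r Δ l o t n where
  inv := by
    have : history [o] = [] := by
      cases o with
      | insert p => exact absurd rfl (ho p)
      | queryRadius => rfl
      | queryCenter p => rfl
    rw [this, List.append_nil]
    exact hinv
  cost := hn
  radius _ hl := by
    rcases hr.eq_or_lt with rfl | hr
    · have hne : distinctPts l ≠ [] := fun e => by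
        rw [ncard_pointSet, e] at hl
        simp at hl
      rw [(solution_one_spec Δ l).2, (h1 rfl hne).1]
      simp
    · obtain ⟨g1, g2, g3⟩ := solution_spec hr hP hl
      rw [(h2 hr (by rwa [ncard_pointSet] at hl)).1]
      -- The lower bound for all clusterings, applied to the solution itself, bounds the answer from
      -- above.
      exact ⟨g2, g3 _ g1⟩
  center p hp hl := by
    obtain ⟨hpl, hps⟩ := hq p hp
    obtain ⟨j, hj, hj'⟩ := clusteringOf_center l
      (solCenter r (topScale Δ (distinctPts l)) (distinctPts l)) hpl
    refine ⟨j, hj, ?_⟩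
    change t.pt 0 = some ((clusteringOf l
      (solCenter r (topScale Δ (distinctPts l)) (distinctPts l))).center j)
    rw [hj']
    rcases hr.eq_or_lt with rfl | hr
    · rw [(h1 rfl (List.ne_nil_of_mem (mem_distinctPts.2 hpl))).2, hps, solCenter, if_pos rfl]
    · exact (h2 hr (by rwa [ncard_pointSet] at hl)).2 p hps

theorem Inv.load {r : ℕ} {Δ : ℝ} {D : List X} {s : State X} (h : Inv r Δ D s) (v : Option X) :
    Inv r Δ D { s with pt := Function.update s.pt 0 v } where
  nat0 := h.nat0
  nat9 := h.nat9
  real9 := h.real9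
  cases := by
    refine h.cases.imp id (Or.imp ?_ ?_)
    · rintro ⟨p₀, h1, h2, h3, h4, h5⟩
      exact ⟨p₀, h1, h2, h3, by simpa using h4, h5⟩
    · rintro ⟨p₀, ids, loc, hlen, hA⟩
      exact ⟨p₀, ids, loc, hlen, hA.frame (fun _ _ _ => rfl) (fun _ _ _ => rfl) (by simp)
        (fun _ _ => rfl) rfl rfl⟩

theorem wp_op {d : ℝ} (hX : DoublingDimLE X d) {r : ℕ} (hr : 1 ≤ r) {Δ : ℝ} {l : List X}
    {s : State X} (h : Inv r Δ (distinctPts l) s) (o : Op X)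
    (hP : AspectRatioLE (pointSet (l ++ history [o])) Δ)
    (ho : ∀ p, o = .queryCenter p → p ∈ l) :
    wp (algorithm.code o) (OpSpec d r Δ l o) (s.load o) := by
  have hnd := nodup_distinctPts l
  cases o with
  | insert p =>
    have hset : pointSet (l ++ history [Op.insert p]) = pointSet (p :: distinctPts l) := by
      ext x
      simp [pointSet, history, mem_distinctPts, or_comm]
    rw [hset] at hP
    refine (wp_insertPoint hX (h.load (some p)) hnd hP (by simp)).mono fun t n ht => ?_
    refine ⟨?_, ht.2, fun hc => absurd rfl (hc p), fun q hq => by simp at hq⟩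
    have : distinctPts (l ++ history [Op.insert p]) =
        if p ∈ distinctPts l then distinctPts l else p :: distinctPts l := by
      rw [show history [Op.insert p] = [p] from rfl]
      split_ifs with hp
      · exact distinctPts_append_of_mem (mem_distinctPts.1 hp)
      · exact distinctPts_append_of_notMem fun hp' => hp (mem_distinctPts.2 hp')
    rw [this]
    exact ht.1
  | queryRadius =>
    have hP' : AspectRatioLE (pointSet l) Δ := by simpa [history] using hP
    change wp (.seq (.run [.ptCopy 0 1]) queryPoint) _ s
    simp only [Cmd.run, List.foldl, wp_seq, wp_instr, Instr.step, Option.some.injEq,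
      exists_eq_left']
    refine (wp_queryPoint (d := d) hX hr (h.load (s.pt 1)) hnd
      (by rwa [pointSet_distinctPts]) ?_).mono ?_
    · intro hne
      obtain ⟨hD0, -⟩ | ⟨p₀, hD1, -, -, hp1, -⟩ | ⟨p₀, ids, loc, hlen, hA⟩ := h.cases
      · exact absurd hD0 hne
      · exact ⟨p₀, by simp [hD1], by simpa using hp1⟩
      · exact ⟨p₀, hA.mem, by simpa using hA.pt1⟩
    · rintro t n ⟨⟨g1, g2, g3⟩, hn⟩
      exact opSpec_of_query hr hP' (fun p => by simp) (by omega) g1 g2 g3 fun p hp => by simp at hp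
  | queryCenter p =>
    have hP' : AspectRatioLE (pointSet l) Δ := by simpa [history] using hP
    have hp := ho p rfl
    refine (wp_queryPoint (d := d) hX hr (h.load (some p)) hnd
      (by rwa [pointSet_distinctPts]) fun _ => ⟨p, mem_distinctPts.2 hp, by simp⟩).mono ?_
    rintro t n ⟨⟨g1, g2, g3⟩, hn⟩
    refine opSpec_of_query hr hP' (fun p => by simp) (by omega) g1 g2 g3 fun q hq => ?_
    cases hq
    exact ⟨hp, by simp⟩

end Invariant

/-! ### Assembling the run, and the numerical cost bound. -/

section Runs

variable {X : Type u} [MetricSpace X]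

omit [MetricSpace X] in
theorem history_append (l l' : List (Op X)) : history (l ++ l') = history l ++ history l' := by
  induction l with
  | nil => rfl
  | cons o l ih => cases o <;> simp [history, ih]

omit [MetricSpace X] in
theorem insertCount_eq_sum (ops : List (Op X)) :
    (insertCount ops : ℝ) = ∑ i : Fin ops.length, if ∃ p, ops[i] = .insert p then 1 else 0 := by
  induction ops with
  | nil => simp [insertCount, history]
  | cons o ops ih =>
    have h : (insertCount (o :: ops) : ℝ) =
        (if ∃ p, o = .insert p then 1 else 0) + insertCount ops := by
      cases o <;> simp [insertCount, history, add_comm]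
    rw [h, ih]
    exact (Fin.sum_univ_succ fun i : Fin (ops.length + 1) =>
      if ∃ p, (o :: ops)[i] = .insert p then (1 : ℝ) else 0).symm

/-- The result of one operation, the number of steps and the number of distance computations. -/
def stepOf (alg : Algorithm) (o : Op X) (s : State X) : State X × ℕ × ℕ :=
  if h : ∃ x : State X × ℕ × ℕ, Exec (alg.code o) (s.load o) x.1 x.2.1 x.2.2 then h.choose
  else (s, 0, 0)

/-- By determinism the chosen execution is the one that satisfies the specification. -/
theorem stepOf_spec {alg : Algorithm} {o : Op X} {s : State X} {Q : State X → ℕ → Prop}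
    (h : wp (alg.code o) Q (s.load o)) :
    Exec (alg.code o) (s.load o) (stepOf alg o s).1 (stepOf alg o s).2.1 (stepOf alg o s).2.2 ∧
      Q (stepOf alg o s).1 (stepOf alg o s).2.1 := by
  obtain ⟨s', k, q, he, hQ⟩ := h
  have hex : ∃ x : State X × ℕ × ℕ, Exec (alg.code o) (s.load o) x.1 x.2.1 x.2.2 :=
    ⟨(s', k, q), he⟩
  have h1 := hex.choose_spec
  rw [stepOf, dif_pos hex]
  obtain ⟨e1, e2, -⟩ := h1.det he
  rw [e1, e2]
  rw [e1, e2] at h1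
  exact ⟨h1, hQ⟩

/-- The states before the operations. -/
def states (alg : Algorithm) (r : ℕ) (Δ : ℝ) (ops : List (Op X)) : ℕ → State X
  | 0 => State.initial r Δ
  | i + 1 => if h : i < ops.length then (stepOf alg ops[i] (states alg r Δ ops i)).1
      else states alg r Δ ops i

theorem exists_run {d : ℝ} (hX : DoublingDimLE X d) {r : ℕ} (hr : 1 ≤ r) {Δ : ℝ}
    {ops : List (Op X)} (hops : Admissible Δ ops) :
    ∃ R : Run algorithm r Δ ops, ∀ (i : ℕ) (hi : i < ops.length),
      OpSpec d r Δ (history (ops.take i)) ops[i] (R.state (i + 1)) (R.steps i) ∧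
        R.dists i ≤ R.steps i := by
  have htake : ∀ (i : ℕ) (hi : i < ops.length),
      history (ops.take (i + 1)) = history (ops.take i) ++ history [ops[i]] := fun i hi => by
    rw [← history_append, List.take_add_one, List.getElem?_eq_getElem hi]
    rfl
  have hsub : ∀ i, AspectRatioLE (pointSet (history (ops.take i))) Δ := fun i => by
    have hmem : ∀ x ∈ pointSet (history (ops.take i)), x ∈ pointSet (history ops) := by
      intro x hx
      rw [← List.take_append_drop i ops, history_append]
      exact List.mem_append_left _ hx
    exact fun x hx y hy u hu v hv =>
      hops.1 x (hmem x hx) y (hmem y hy) u (hmem u hu) v (hmem v hv)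
  have hstep : ∀ (i : ℕ) (hi : i < ops.length),
      Inv r Δ (distinctPts (history (ops.take i))) (states algorithm r Δ ops i) →
      wp (algorithm.code ops[i]) (OpSpec d r Δ (history (ops.take i)) ops[i])
        ((states algorithm r Δ ops i).load ops[i]) := fun i hi hinv =>
    wp_op hX hr hinv ops[i] (htake i hi ▸ hsub (i + 1)) fun p hp => hops.2 i hi p hp
  have hnext : ∀ (i : ℕ) (hi : i < ops.length), states algorithm r Δ ops (i + 1) =
      (stepOf algorithm ops[i] (states algorithm r Δ ops i)).1 := fun i hi => dif_pos hi
  have hinv : ∀ i ≤ ops.length,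
      Inv r Δ (distinctPts (history (ops.take i))) (states algorithm r Δ ops i) := by
    intro i
    induction i with
    | zero => exact fun _ => inv_initial r Δ
    | succ i ih =>
      intro hi
      have := (stepOf_spec (hstep i hi (ih (by omega)))).2.inv
      rw [htake i hi, hnext i hi]
      exact this
  refine ⟨⟨states algorithm r Δ ops,
    fun i => if h : i < ops.length then
      (stepOf algorithm ops[i] (states algorithm r Δ ops i)).2.1 else 0,
    fun i => if h : i < ops.length then
      (stepOf algorithm ops[i] (states algorithm r Δ ops i)).2.2 else 0, rfl, fun i hi => ?_⟩,
    fun i hi => ?_⟩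
  · have := (stepOf_spec (hstep i hi (hinv i hi.le))).1
    simpa only [dif_pos hi, hnext i hi] using this
  · obtain ⟨h1, h2⟩ := stepOf_spec (hstep i hi (hinv i hi.le))
    simp only [dif_pos hi, hnext i hi]
    exact ⟨h2, h1.dists_le⟩

/-- Let L = log Δ ≥ 2 and y = 2 ^ (3d) ≥ 1. A level costs at most (8 + 34 + 67) y² = 109 y², and the
depth plus one is at most 2 (L + 1) + 6 ≤ 6 L; the constant is 2 · 4 · 6 · 109 = 5232. The leading 2
pays for steps and distance computations. -/
theorem opCost_le {d : ℝ} (hd : 0 ≤ d) {Δ : ℝ} (hΔ : 4 ≤ Δ) :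
    2 * (opCost d Δ : ℝ) ≤ 5232 * 2 ^ (5232 * d) * Real.logb 2 Δ := by
  have hL : 2 ≤ Real.logb 2 Δ := by
    rw [Real.le_logb_iff_rpow_le (by norm_num) (by linarith)]
    norm_num
    exact hΔ
  have hm : (doublings Δ : ℝ) ≤ Real.logb 2 Δ + 1 := by
    rcases Nat.eq_zero_or_pos (doublings Δ) with h0 | h0
    · rw [h0]
      push_cast
      linarith
    · have h1 := two_pow_lt_of_lt_doublings (Δ := Δ) (i := doublings Δ - 1) (by omega)
      have h2 : ((doublings Δ - 1 : ℕ) : ℝ) ≤ Real.logb 2 Δ := by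
        rw [Real.le_logb_iff_rpow_le (by norm_num) (by linarith), Real.rpow_natCast]
        exact h1.le
      rw [Nat.cast_sub h0] at h2
      push_cast at h2
      linarith
  set y : ℝ := ((2 : ℝ) ^ d) ^ 3 with hy
  have hy1 : 1 ≤ y := one_le_pow₀ (Real.one_le_rpow (by norm_num) hd)
  have hM : (packing d : ℝ) ≤ y := Nat.floor_le (by positivity)
  have hM0 : (0 : ℝ) ≤ packing d := Nat.cast_nonneg _
  have hyy : y ^ 2 ≤ 2 ^ (5232 * d) := by
    have : y ^ 2 = 2 ^ (6 * d) := by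
      rw [hy, ← pow_mul, ← Real.rpow_natCast, ← Real.rpow_mul (by norm_num)]
      congr 1
      push_cast
      ring
    rw [this]
    exact Real.rpow_le_rpow_of_exponent_le (by norm_num) (by linarith)
  have hlc : (levelCost d : ℝ) ≤ 109 * y ^ 2 := by
    have : (levelCost d : ℝ) = packing d * (packing d * 8 + 34) + 67 := by
      unfold levelCost
      push_cast
      ring
    rw [this]
    nlinarith
  have hdep : (depth Δ : ℝ) + 1 ≤ 6 * Real.logb 2 Δ := by
    have : (depth Δ : ℝ) = 2 * doublings Δ + 5 := by
      unfold depth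
      push_cast
      ring
    rw [this]
    linarith
  have hop : (opCost d Δ : ℝ) = 4 * ((depth Δ + 1) * levelCost d) := by
    unfold opCost
    push_cast
    ring
  have h1 : ((depth Δ : ℝ) + 1) * levelCost d ≤ 6 * Real.logb 2 Δ * (109 * y ^ 2) := by
    gcongr
  have h2 : Real.logb 2 Δ * y ^ 2 ≤ Real.logb 2 Δ * 2 ^ (5232 * d) := by gcongr
  rw [hop]
  nlinarith

end Runs
end
end RGather

theorem mainTheorem7 :
    ∃ (alg : RGather.Algorithm) (A α : ℝ), 1 ≤ A ∧ 1 ≤ α ∧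
      ∀ (X : Type u) [MetricSpace X] (d : ℝ) (r : ℕ) (Δ τ : ℝ),
        0 ≤ d → RGather.DoublingDimLE X d → 1 ≤ r → 4 ≤ Δ → 1 ≤ τ →
        -- the maintained solution, as a function of the sequence of inserted points
        ∃ sol : (l : List X) → RGather.Clustering (RGather.pointSet l),
          (∀ l : List X, RGather.AspectRatioLE (RGather.pointSet l) Δ →
            r ≤ (RGather.pointSet l).ncard → (sol l).IsApprox r α) ∧
          ∀ ops : List (RGather.Op X), RGather.Admissible Δ ops →
            ∃ R : RGather.Run alg r Δ ops,
              -- worst-case update time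
              (∀ (i : ℕ) (hi : i < ops.length) (p : X), ops[i] = .insert p →
                R.time τ i ≤ r * (A * 2 ^ (A * d)) * Real.logb 2 Δ ^ 2 *
                  Real.logb 2 (Real.logb 2 Δ) * τ) ∧
              -- amortized update time
              R.totalInsertTime τ ≤ RGather.insertCount ops *
                ((A * 2 ^ (A * d)) * Real.logb 2 Δ ^ 2 * Real.logb 2 (Real.logb 2 Δ) * τ) ∧
              -- worst-case query time
              (∀ (i : ℕ) (hi : i < ops.length), (∀ p : X, ops[i] ≠ .insert p) →
                R.time τ i ≤ (A * 2 ^ (A * d)) * Real.logb 2 Δ ^ 2 * τ) ∧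
              -- every query returns the radius estimate
              (∀ (i : ℕ) (hi : i < ops.length), (∀ p : X, ops[i] ≠ .insert p) →
                r ≤ (RGather.pointSet (RGather.history (ops.take i))).ncard →
                ((sol (RGather.history (ops.take i))).radius : ℝ) ≤ R.radiusAnswer i ∧
                R.radiusAnswer i ≤ α * (sol (RGather.history (ops.take i))).radius) ∧
              -- a query with a point returns the center of its cluster
              (∀ (i : ℕ) (hi : i < ops.length) (p : X), ops[i] = .queryCenter p →
                r ≤ (RGather.pointSet (RGather.history (ops.take i))).ncard →
                ∃ j, p ∈ (sol (RGather.history (ops.take i))).cluster j ∧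
                  R.centerAnswer i = some ((sol (RGather.history (ops.take i))).center j)) := by
  refine ⟨RGather.algorithm, 5232, 32, by norm_num, by norm_num, ?_⟩
  intro X _ d r Δ τ hd hX hr hΔ hτ
  refine ⟨RGather.solution r Δ, fun l hP hl => RGather.solution_isApprox hr hP hl,
    fun ops hops => ?_⟩
  obtain ⟨R, hR⟩ := RGather.exists_run hX hr hops
  have hL : 2 ≤ Real.logb 2 Δ := by
    rw [Real.le_logb_iff_rpow_le (by norm_num) (by linarith)]
    norm_num
    exact hΔ
  have hLL : 1 ≤ Real.logb 2 (Real.logb 2 Δ) := by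
    rw [Real.le_logb_iff_rpow_le (by norm_num) (by linarith)]
    simpa using hL
  have hr' : (1 : ℝ) ≤ r := by exact_mod_cast hr
  have hcost := RGather.opCost_le hd hΔ
  set B : ℝ := 5232 * 2 ^ (5232 * d) with hB
  have hB0 : 0 ≤ B := by positivity
  -- This holds for every single operation, so the amortized bound is a plain sum.
  have htime : ∀ (i : ℕ) (hi : i < ops.length), R.time τ i ≤ B * Real.logb 2 Δ ^ 2 * τ := by
    intro i hi
    obtain ⟨h1, h2⟩ := hR i hi
    have h3 : (R.steps i : ℝ) ≤ RGather.opCost d Δ := by exact_mod_cast h1.cost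
    have h4 : (R.dists i : ℝ) ≤ R.steps i := by exact_mod_cast h2
    have h5 : (0 : ℝ) ≤ R.steps i := Nat.cast_nonneg _
    calc R.time τ i = R.steps i + R.dists i * τ := rfl
      _ ≤ R.steps i * τ + R.steps i * τ := by
        gcongr
        exact le_mul_of_one_le_right h5 hτ
      _ = 2 * R.steps i * τ := by ring
      _ ≤ 2 * RGather.opCost d Δ * τ := by gcongr
      _ ≤ B * Real.logb 2 Δ * τ := by gcongr
      _ ≤ B * Real.logb 2 Δ ^ 2 * τ := by
        gcongr
        exact le_self_pow₀ (by linarith) (by norm_num)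
  have hT0 : 0 ≤ B * Real.logb 2 Δ ^ 2 * τ := by positivity
  have htime' : ∀ (i : ℕ) (hi : i < ops.length),
      R.time τ i ≤ B * Real.logb 2 Δ ^ 2 * Real.logb 2 (Real.logb 2 Δ) * τ := by
    intro i hi
    refine (htime i hi).trans ?_
    linarith [mul_le_mul_of_nonneg_left hLL hT0]
  refine ⟨R, fun i hi p _ => ?_, ?_, fun i hi _ => htime i hi,
    fun i hi => (hR i hi).1.radius, fun i hi => (hR i hi).1.center⟩
  · refine (htime' i hi).trans ?_
    gcongr
    exact le_mul_of_one_le_left hB0 hr'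
  · rw [RGather.Run.totalInsertTime, RGather.insertCount_eq_sum, Finset.sum_mul]
    refine Finset.sum_le_sum fun i _ => ?_
    split_ifs
    · rw [one_mul]
      exact htime' i i.2
    · rw [zero_mul]
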